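/- Let $M$ be a compact smooth manifold of dimension $7$ without boundary. A smooth $3$-form $\Omega$ on $M$ is called positive if for every $x\in M$ there is a linear isomorphism $T_xM\cong\mathbb{R}^7$ identifying $\Omega_x$ with the standard $\mathrm{G}_2$-form $\varphi=e^{123}+e^{145}+e^{167}+e^{246}-e^{257}-e^{347}-e^{356}$. As the stabiliser of $\varphi$ in $\mathrm{GL}(7)$ is $\mathrm{G}_2\subset\mathrm{SO}(7)$, such an $\Omega$ induces a Riemannian metric $g_\Omega$, with volume $\mathrm{vol}_\Omega$, norms $|\cdot|_\Omega$ on forms (normalised so that $|\Omega|^2_\Omega=7$), Levi-Civita connection $\nabla^\Omega$ and codifferential $\delta_\Omega$. It is called torsion-free if its intrinsic torsion vanishes, i.e. if $\nabla^\Omega\Omega=0$. Put $$\mathcal D(\Omega)=\frac12\int_M\bigl(|d\Omega|^2_\Omega+|\delta_\Omega\Omega|^2_\Omega\bigr)\,\mathrm{vol}_\Omega,\qquad \mathcal H(\Omega)=\int_M\mathrm{vol}_\Omega,\qquad \|\Omega\|^2_{W^{1,2}_\Omega}=\int_M\bigl(|\Omega|^2_\Omega+|\nabla^\Omega\Omega|^2_\Omega\bigr)\,\mathrm{vol}_\Omega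 .$$ A solution of the Dirichlet energy flow on $[0,T)$, $0<T\le\infty$, is a family $(\Omega_t)_{t\in[0,T)}$ of positive $3$-forms, smooth in $(t,x)\in[0,T)\times M$, with $$\frac{\partial}{\partial t}\Omega_t=Q(\Omega_t),$$ where $Q(\Omega)=-\mathrm{grad}\,\mathcal D(\Omega)$ is the negative $L^2$-gradient of $\mathcal D$, i.e. the smooth $3$-form determined by $D_\Omega\mathcal D(\dot\Omega)=-\int_M\langle Q(\Omega),\dot\Omega\rangle_\Omega\,\mathrm{vol}_\Omega$ for all smooth $3$-forms $\dot\Omega$. **Proposition.** Let $(\Omega_t)_{t\in[0,T)}$ be a solution of the Dirichlet energy flow, and let $C_t:=4\mathcal D(\Omega_t)+7\mathcal H(\Omega_t)$. Then $$\|\Omega_t\|^2_{W^{1,2}_{\Omega_t}}\le C_t\le C_0\qquad\text{for all } t\in[0,T),$$ and $t\mapsto C_t$ is differentiable and monotonically decreasing (that is, non-increasing) on $[0,T)$. Moreover, for every $t_0\in[0,T)$ one has $\frac{d}{dt}\big|_{t=t_0}C_t=0$ if and only if $\Omega_{t_0}$ is torsion-free (the derivative at $t_0=0$ being the right derivative).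 -/

import Mathlib

open scoped Manifold ContDiff Topology
open Set MeasureTheory

noncomputable section

namespace G2Flow

/-- The Euclidean space `ℝ⁷`. -/
abbrev E7 : Type := EuclideanSpace ℝ (Fin 7)

/-! ### Linear algebra of positive 3-forms -/

section Linear

/-- The elementary 3-form `e^i ∧ e^j ∧ e^k` on `ℝ⁷`, that is
`(v₀, v₁, v₂) ↦ det (v_a (s b))_{a,b}` with `s = (i, j, k)`. -/
def elemForm (i j k : Fin 7) : E7 [⋀^Fin 3]→L[ℝ] ℝ :=
  { (Matrix.detRowAlternating (n := Fin 3) (R := ℝ)).compLinearMap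
      (LinearMap.pi fun b : Fin 3 => (EuclideanSpace.proj (𝕜 := ℝ) (![i, j, k] b) :
        E7 →L[ℝ] ℝ).toLinearMap) with
    cont := by
      change Continuous fun v : Fin 3 → E7 =>
        Matrix.det (Matrix.of fun a b : Fin 3 => v a (![i, j, k] b))
      refine Continuous.matrix_det ?_
      fun_prop }

theorem elemForm_apply (i j k : Fin 7) (v : Fin 3 → E7) :
    elemForm i j k v = Matrix.det (Matrix.of fun a b : Fin 3 => v a (![i, j, k] b)) := rfl

/-- The standard `G₂`-form on `ℝ⁷`,
`φ = e¹²³ + e¹⁴⁵ + e¹⁶⁷ + e²⁴⁶ - e²⁵⁷ - e³⁴⁷ - e³⁵⁶`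
(with indices shifted by one, since `Fin 7` starts at `0`).  Its stabiliser in `GL(7)` is
`G₂ ⊆ SO(7)`. -/
def stdForm : E7 [⋀^Fin 3]→L[ℝ] ℝ :=
  elemForm 0 1 2 + elemForm 0 3 4 + elemForm 0 5 6 + elemForm 1 3 5
    - elemForm 1 4 6 - elemForm 2 3 6 - elemForm 2 4 5

variable {V : Type*} [AddCommGroup V] [Module ℝ V] [TopologicalSpace V]

/-- A 3-form on a seven-dimensional vector space is positive if a linear isomorphism with `ℝ⁷`
identifies it with the standard `G₂`-form. -/
def IsPositive (σ : V [⋀^Fin 3]→L[ℝ] ℝ) : Prop :=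
  ∃ e : V ≃L[ℝ] E7, stdForm.compContinuousLinearMap (e : V →L[ℝ] E7) = σ

open Classical in
/-- A `G₂`-frame of a positive 3-form `σ`: a basis `(e_i)` of `V` in which `σ` takes the
standard form.  Two such frames differ by an element of `G₂ ⊆ SO(7)`. (Junk value `0` if `σ` is
not positive.) -/
def frame (σ : V [⋀^Fin 3]→L[ℝ] ℝ) (i : Fin 7) : V :=
  if h : IsPositive σ then h.choose.symm (EuclideanSpace.single i 1) else 0

open Classical in
/-- The inner product `g_σ` induced by a positive 3-form `σ`: the pull-back of the Euclidean inner
product under any isomorphism `V ≃ ℝ⁷` that identifies `σ` with the standard form; equivalently,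
the inner product for which `frame σ` is orthonormal. -/
def metric (σ : V [⋀^Fin 3]→L[ℝ] ℝ) (u v : V) : ℝ :=
  if h : IsPositive σ then inner ℝ (h.choose u) (h.choose v) else 0

/-- The inner product induced by `g_σ` on `k`-forms, normalised as usual so that the forms
`e^{i₁} ∧ ⋯ ∧ e^{i_k}` with `i₁ < ⋯ < i_k` are orthonormal for an orthonormal coframe `(e^i)`. -/
def formInner (σ : V [⋀^Fin 3]→L[ℝ] ℝ) {k : ℕ} (α β : (Fin k → V) → ℝ) : ℝ :=
  (k.factorial : ℝ)⁻¹ * ∑ i : Fin k → Fin 7, α (frame σ ∘ i) * β (frame σ ∘ i)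

/-- `|α|²_σ` for a `k`-form `α`. -/
def formNormSq (σ : V [⋀^Fin 3]→L[ℝ] ℝ) {k : ℕ} (α : (Fin k → V) → ℝ) : ℝ :=
  formInner σ α α

end Linear

/-! ### Differential forms on a 7-manifold, in charts -/

variable {M : Type*} [TopologicalSpace M] [ChartedSpace E7 M]

variable (M) in
/-- Differential `k`-forms on `M` (not necessarily smooth). -/
abbrev Form (k : ℕ) : Type _ := (x : M) → TangentSpace (𝓡 7) x [⋀^Fin k]→L[ℝ] ℝ

/-- The differential at `y` of the inverse of the chart around `c`; it sends the standard basis of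
`ℝ⁷` to the coordinate vector fields `∂_i`. -/
def chartInvDeriv (c : M) (y : E7) :
    E7 →L[ℝ] TangentSpace (𝓡 7) ((extChartAt (𝓡 7) c).symm y) :=
  mfderiv (𝓡 7) (𝓡 7) (extChartAt (𝓡 7) c).symm y

/-- The differential at `x` of the chart around `x`. -/
def chartDeriv (x : M) : TangentSpace (𝓡 7) x →L[ℝ] E7 :=
  mfderiv (𝓡 7) (𝓡 7) (extChartAt (𝓡 7) x) x

/-- The expression of a `k`-form in the chart around `c`. -/
def coordForm {k : ℕ} (α : Form M k) (c : M) (y : E7) : E7 [⋀^Fin k]→L[ℝ] ℝ :=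
  (α ((extChartAt (𝓡 7) c).symm y)).compContinuousLinearMap (chartInvDeriv c y)

/-- Smooth `k`-forms. -/
def IsSmoothForm {k : ℕ} (α : Form M k) : Prop :=
  ∀ c : M, ContDiffOn ℝ ∞ (coordForm α c) (extChartAt (𝓡 7) c).target

/-- Families of `k`-forms, parametrised by `t ∈ J`, that are smooth in `(t, x)`. -/
def IsSmoothFamily {k : ℕ} (J : Set ℝ) (α : ℝ → Form M k) : Prop :=
  ∀ c : M, ContDiffOn ℝ ∞ (fun p : ℝ × E7 => coordForm (α p.1) c p.2)
    (J ×ˢ (extChartAt (𝓡 7) c).target)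

/-- A positive 3-form (`G₂`-structure) on `M`: a smooth 3-form that is positive at each point. -/
def IsG2Structure (Ω : Form M 3) : Prop :=
  IsSmoothForm Ω ∧ ∀ x, IsPositive (Ω x)

/-- The exterior derivative `dα`, computed at `x` in the chart around `x`. -/
def extD {k : ℕ} (α : Form M k) : Form M (k + 1) := fun x =>
  (extDeriv (coordForm α x) (extChartAt (𝓡 7) x x)).compContinuousLinearMap (chartDeriv x)

/-! ### The Levi-Civita connection of `g_Ω` -/

/-- The coefficients `g_{ij}` of `g_Ω` in the chart around `c`. -/
def gram (Ω : Form M 3) (c : M) (y : E7) : Matrix (Fin 7) (Fin 7) ℝ :=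
  Matrix.of fun i j => metric (Ω ((extChartAt (𝓡 7) c).symm y))
    (chartInvDeriv c y (EuclideanSpace.single i 1)) (chartInvDeriv c y (EuclideanSpace.single j 1))

/-- The partial derivative `∂_l g_{ij}` in the chart around `c`. -/
def gramDeriv (Ω : Form M 3) (c : M) (y : E7) (l i j : Fin 7) : ℝ :=
  fderiv ℝ (fun z => gram Ω c z i j) y (EuclideanSpace.single l 1)

/-- The Christoffel symbols
`Γ^k_{ij} = ½ ∑_l g^{kl} (∂_i g_{jl} + ∂_j g_{il} - ∂_l g_{ij})` of `g_Ω`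
in the chart around `c`. -/
def christoffel (Ω : Form M 3) (c : M) (y : E7) (k i j : Fin 7) : ℝ :=
  (1 / 2) * ∑ l, (gram Ω c y)⁻¹ k l *
    (gramDeriv Ω c y i j l + gramDeriv Ω c y j i l - gramDeriv Ω c y l i j)

/-- The bilinear map `Γ(u, v) = ∑ u^i v^j Γ^k_{ij} ∂_k` in the chart around `c`. -/
def christoffelMap (Ω : Form M 3) (c : M) (y u v : E7) : E7 :=
  ∑ k, (∑ i, ∑ j, u i * v j * christoffel Ω c y k i j) • EuclideanSpace.single k (1 : ℝ)

/-- The covariant derivative `(∇^Ω_u α)(v₁, …, v_k)` at `x` of a `k`-form `α` with respect to the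
Levi-Civita connection of `g_Ω`, computed in the chart around `x`:
`∂_u α (v₁, …, v_k) - ∑_a α (v₁, …, Γ(u, v_a), …, v_k)`. -/
def covDeriv (Ω : Form M 3) {k : ℕ} (α : Form M k) (x : M)
    (u : TangentSpace (𝓡 7) x) (v : Fin k → TangentSpace (𝓡 7) x) : ℝ :=
  let y : E7 := extChartAt (𝓡 7) x x
  let u' : E7 := chartDeriv x u
  let v' : Fin k → E7 := fun a => chartDeriv x (v a)
  fderiv ℝ (coordForm α x) y u' v'
    - ∑ a, coordForm α x y (Function.update v' a (christoffelMap Ω x y u' (v' a)))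

/-- The codifferential `δ_Ω α = - ∑_i e_i ⌟ ∇^Ω_{e_i} α`, for a `g_Ω`-orthonormal frame
`(e_i)`. -/
def codiff (Ω : Form M 3) {k : ℕ} (α : Form M (k + 1)) (x : M)
    (v : Fin k → TangentSpace (𝓡 7) x) : ℝ :=
  - ∑ i, covDeriv Ω α x (frame (Ω x) i) (Fin.cons (frame (Ω x) i) v)

/-- `|∇^Ω α|²_Ω = ∑_i |∇^Ω_{e_i} α|²_Ω`, for a `g_Ω`-orthonormal frame `(e_i)`. -/
def covDerivNormSq (Ω : Form M 3) {k : ℕ} (α : Form M k) (x : M) : ℝ :=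
  ∑ i, formNormSq (Ω x) (covDeriv Ω α x (frame (Ω x) i))

/-- `Ω` is torsion-free.  The intrinsic torsion is the unique section `T` of `Λ¹ ⊗ Λ²₇` whose
action on `Ω` is `T(Ω) = ∇^Ω Ω`, so that it vanishes exactly if `∇^Ω Ω = 0`. -/
def IsTorsionFree (Ω : Form M 3) : Prop :=
  ∀ (x : M) (u : TangentSpace (𝓡 7) x) (v : Fin 3 → TangentSpace (𝓡 7) x),
    covDeriv Ω Ω x u v = 0

/-! ### The volume, and the functionals -/

section Measure

variable [MeasurableSpace M]

/-- The Riemannian volume of `g_Ω` restricted to the domain of the chart around `c`: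
the image of `√(det g_{ij}) dy¹ ⋯ dy⁷`. -/
def chartVolume (Ω : Form M 3) (c : M) : Measure M :=
  Measure.map (extChartAt (𝓡 7) c).symm
    ((volume.restrict (extChartAt (𝓡 7) c).target).withDensity
      fun y => ENNReal.ofReal (Real.sqrt (gram Ω c y).det))

/-- The Riemannian volume `vol_Ω` of `g_Ω`: the least measure on `M` which is at least
`chartVolume Ω c` for each `c`.  As the measures `chartVolume Ω c` agree on overlaps of
chart domains and countably many chart domains cover `M`, this is the measure whose restriction to
each chart domain is the respective `chartVolume Ω c`. -/
def vol (Ω : Form M 3) : Measure M := ⨆ c : M, chartVolume Ω c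

/-- The `L²` inner product `⟨α, β⟩_Ω` of `k`-forms. -/
def l2Inner (Ω : Form M 3) {k : ℕ} (α β : Form M k) : ℝ :=
  ∫ x, formInner (Ω x) (α x) (β x) ∂(vol Ω)

/-- The Dirichlet energy `𝒟(Ω) = ½ ∫ (|dΩ|² + |δ_Ω Ω|²) vol_Ω`. -/
def dirichletEnergy (Ω : Form M 3) : ℝ :=
  (1 / 2) * ∫ x, (formNormSq (Ω x) (extD Ω x) + formNormSq (Ω x) (codiff Ω Ω x)) ∂(vol Ω)

/-- The Hitchin functional `ℋ(Ω) = ∫ vol_Ω`. -/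
def hitchin (Ω : Form M 3) : ℝ := ∫ _x, (1 : ℝ) ∂(vol Ω)

/-- The squared Sobolev norm `‖α‖²_{W^{1,2}_Ω} = ∫ (|α|² + |∇^Ω α|²) vol_Ω`. -/
def sobolevNormSq (Ω : Form M 3) {k : ℕ} (α : Form M k) : ℝ :=
  ∫ x, (formNormSq (Ω x) (α x) + covDerivNormSq Ω α x) ∂(vol Ω)

/-- `Q` is the negative `L²`-gradient of `𝒟` at `Ω`: it is a smooth 3-form with
`D_Ω 𝒟 (η) = - ⟨Q, η⟩_Ω` for all smooth 3-forms `η`. -/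
def IsNegGradient (Ω Q : Form M 3) : Prop :=
  IsSmoothForm Q ∧ ∀ η : Form M 3, IsSmoothForm η →
    HasDerivAt (fun s : ℝ => dirichletEnergy (Ω + s • η)) (- l2Inner Ω Q η) 0

/-- The interval `[0, T)`, where `T` may be `∞`. -/
def timeInterval (T : EReal) : Set ℝ := {t | 0 ≤ t ∧ (t : EReal) < T}

/-- `(Ω_t)_{t ∈ [0, T)}` is a solution of the Dirichlet energy flow: a smooth family of positive
3-forms with `∂_t Ω_t = Q(Ω_t)`, where `Q(Ω_t)` is the negative `L²`-gradient of `𝒟` at `Ω_t`. -/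
def IsDirichletFlow (T : EReal) (Ω : ℝ → Form M 3) : Prop :=
  IsSmoothFamily (timeInterval T) Ω ∧
  (∀ t ∈ timeInterval T, IsG2Structure (Ω t)) ∧
  ∀ t ∈ timeInterval T, ∃ Q : Form M 3, IsNegGradient (Ω t) Q ∧
    ∀ (x : M) (v : Fin 3 → TangentSpace (𝓡 7) x),
      HasDerivWithinAt (fun s => Ω s x v) (Q x v) (timeInterval T) t

/-- The bound `C(Ω) = 4 𝒟(Ω) + 7 ℋ(Ω)`. -/
def boundC (Ω : Form M 3) : ℝ := 4 * dirichletEnergy Ω + 7 * hitchin Ω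

end Measure

end G2Flow

end

/-! Two facts carry the result: a pointwise inequality between `∇Ω` and the pair `dΩ`, `δΩ`, and the
homogeneity of the Dirichlet energy `𝒟`.

Pointwise inequality. The stabiliser of `φ` lies in `O(7)` (`inner_map_map_of_stdForm_comp`), so
metric and norms do not depend on the chosen frame, and `|Ω|² = 7`. The Levi-Civita connection
preserves the metric, hence `∇Ω` is the infinitesimal action on `Ω` of skew endomorphisms. The
algebra `g₂` acts trivially, so only the projection of `so(7)` to its 7-dimensional complement
counts: in a `G₂`-frame `∇_l Ω_{abc} = ∑ T_{lm} ψ_{mabc}` for some 7×7 matrix `T`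
(`exists_torsion`). Since `dΩ` and `-δΩ` are the alternation and the trace of `∇Ω`, the identity
`psi_quadratic` yields `2(|dΩ|² + |δΩ|²) - |∇Ω|² = 4 (tr T)² + 4 ∑ₖ (∑ T_{lm} φ_{lmk})² ≥ 0`
(`torsionAct_inequality`, `sum_nabla_sq_le`). Integration bounds the Sobolev norm by `4𝒟 + 7ℋ`. It
also follows that `𝒟(Ω) = 0` exactly for torsion-free `Ω`, because the integrand is continuous and
the volume charges all nonempty open sets (`dirichletEnergy_eq_zero_iff`).

Homogeneity. The form `μ³Ω` has metric `μ²g`, so `𝒟(μ³Ω) = μ⁵𝒟(Ω)` and Euler's identity reads `D𝒟(Ω)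
= (5/3)𝒟(Ω)`; that is, `⟨Q, Ω⟩ = -(5/3)𝒟`. The first variation of `ℋ` is `(1/3)⟨·, Ω⟩`. Along the
flow this gives `dC/dt = -4‖Q‖² - (35/9)𝒟 ≤ 0`. If the derivative vanishes then `𝒟 = 0`. Conversely,
if `𝒟 = 0` then `Ω` minimises `𝒟`, so `‖Q‖² = 0` as well.

Analysis. The frames come from arbitrary choices and carry no continuity. An explicit right inverse
of the infinitesimal action and the inverse function theorem provide coframes depending smoothly on
the form (`exists_local_coframe`); hence the integrands are smooth functions of the 1-jet in a
chart. Naturality under coordinate changes, a finite partition of `M` subordinate to charts and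
differentiation under the integral sign then turn the formal computation into a proof. -/

noncomputable section

namespace G2Flow

section

/-! ### The components of the standard `G₂`-form -/

/-- The multiplication table of the cross product on `ℝ⁷`: the entry at `(i, j)` is `± (k + 1)` if
`e_i × e_j = ± e_k`. -/
def crossTable : List (List ℤ) :=
  [[0, 3, -2, 5, -4, 7, -6],
   [-3, 0, 1, 6, -7, -4, 5],
   [2, -1, 0, -7, -6, 5, 4],
   [-5, -6, 7, 0, 1, 2, -3],
   [4, 7, 6, -1, 0, -3, -2],
   [-7, 4, -5, -2, 3, 0, 1],
   [6, -5, -4, 3, 2, -1, 0]]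

/-- The entry at `(i, j)` of the multiplication table. -/
def crossEntry (i j : Fin 7) : ℤ := (crossTable.getD i []).getD j 0

/-- The components `φ_{ijk}` of the standard `G₂`-form. -/
def phi (i j k : Fin 7) : ℤ :=
  if crossEntry i j = k + 1 then 1 else if crossEntry i j = -(k + 1) then -1 else 0

/-- The Kronecker symbol. -/
def kron (p q : Fin 7) : ℤ := if p = q then 1 else 0

/-- The components of `e^i ∧ e^j ∧ e^k`. -/
def detKron (i j k a b c : Fin 7) : ℤ :=
  kron a i * kron b j * kron c k - kron a i * kron b k * kron c j
    - kron a j * kron b i * kron c k + kron a j * kron b k * kron c i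
    + kron a k * kron b i * kron c j - kron a k * kron b j * kron c i

theorem phi_eq_detKron (a b c : Fin 7) :
    phi a b c = detKron 0 1 2 a b c + detKron 0 3 4 a b c + detKron 0 5 6 a b c
      + detKron 1 3 5 a b c - detKron 1 4 6 a b c - detKron 2 3 6 a b c - detKron 2 4 5 a b c := by
  revert a b c; decide +kernel

theorem phi_swap₁₂ (i j k : Fin 7) : phi j i k = -phi i j k := by
  revert i j k; decide +kernel

theorem phi_swap₂₃ (i j k : Fin 7) : phi i k j = -phi i j k := by
  revert i j k; decide +kernel

/-- The contraction `∑ₘ φ_{ijm} φ_{mkl}`. -/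
def phiPhi (i j k l : Fin 7) : ℤ :=
  let m := crossEntry i j
  if m = 0 then 0 else
    if 0 < m then phi (Fin.ofNat 7 (m.natAbs - 1)) k l else -phi (Fin.ofNat 7 (m.natAbs - 1)) k l

theorem sum_phi_mul_phi (i j k l : Fin 7) : ∑ m, phi i j m * phi m k l = phiPhi i j k l := by
  revert i j k l; decide +kernel

/-- The components of the 4-form dual to the standard `G₂`-form. -/
def psi (i j k l : Fin 7) : ℤ :=
  if i = k ∨ i = l ∨ j = k ∨ j = l then 0 else phiPhi i j k l

theorem sum_phi_phi (i l : Fin 7) : ∑ j, ∑ k, phi i j k * phi l j k = 6 * kron i l := by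
  revert i l; decide +kernel

theorem sum_psi_psi (m n : Fin 7) :
    ∑ a, ∑ b, ∑ c, psi m a b c * psi n a b c = 24 * kron m n := by
  revert m n; decide +kernel

/-- The contraction `∑ₘ φ_{ijm} ψ_{mabc}`. -/
def phiPsi (i j a b c : Fin 7) : ℤ :=
  let m := crossEntry i j
  if m = 0 then 0 else
    if 0 < m then psi (Fin.ofNat 7 (m.natAbs - 1)) a b c
      else -psi (Fin.ofNat 7 (m.natAbs - 1)) a b c

/-- The product `e_i × e_j` is zero or plus or minus one basis vector, so a contraction over the
last index of `φ` has at most one nonzero term. Reading that term off the table keeps identities in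
many indices within reach of kernel evaluation. -/
theorem sum_phi_mul (i j : Fin 7) (F : Fin 7 → ℤ) :
    ∑ m, phi i j m * F m = (if crossEntry i j = 0 then 0 else if 0 < crossEntry i j then
      F (Fin.ofNat 7 ((crossEntry i j).natAbs - 1))
        else -F (Fin.ofNat 7 ((crossEntry i j).natAbs - 1))) := by
  have h : ∀ i j m : Fin 7, phi i j m = if crossEntry i j = 0 then 0 else if 0 < crossEntry i j then
      kron m (Fin.ofNat 7 ((crossEntry i j).natAbs - 1))
        else -kron m (Fin.ofNat 7 ((crossEntry i j).natAbs - 1)) := by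
    decide +kernel
  simp_rw [h]
  split_ifs <;> simp [kron]

/-- The left side is the action of the elementary skew matrix in the `(i, j)` plane on `φ`. It
depends on `(i, j)` only through the vector `e_i × e_j`, which is why the kernel `g₂` of the action
on `so(7)` drops out. -/
theorem phiPsi_eq (i j a b c : Fin 7) :
    (kron a j * phi i b c + kron b j * phi a i c + kron c j * phi a b i)
      - (kron a i * phi j b c + kron b i * phi a j c + kron c i * phi a b j)
      = -phiPsi i j a b c := by
  revert i j a b c; decide +kernel

theorem sum_phi_mul_psi (i j a b c : Fin 7) :
    ∑ m, phi i j m * psi m a b c = phiPsi i j a b c := sum_phi_mul i j _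

/-- Contracted with `T_{lm} T_{an}`, the right side becomes a sum of squares; this is the algebraic
source of the pointwise inequality. -/
theorem psi_quadratic (l m a n : Fin 7) :
    4 * kron l a * kron m n - ∑ b, ∑ c, psi m a b c * psi n l b c
      + ∑ b, ∑ c, psi m l b c * psi n a b c
      = 4 * kron l m * kron a n + 4 * ∑ k, phi l m k * phi a n k := by
  revert l m a n; decide +kernel

/-- The coefficient of `η_{ijk}` in `36 (R η)_* φ`, where `R` is the right inverse of the
infinitesimal action. -/
def actCoeff (a b c i j k : Fin 7) : ℤ :=
  6 * (kron a i * phiPhi j k b c + kron b i * phiPhi j k c a + kron c i * phiPhi j k a b)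
    + 3 * (phi a j k * phi i b c + phi b j k * phi a i c + phi c j k * phi a b i)
    - 3 * (phi i j k * phi a b c)

/-- An alternating `η` sees only the alternation of the coefficients, and that part must be the
determinant. The weights 6, 3 and -1 in the right inverse are forced by equivariance: an equivariant
right inverse is a combination of the contraction of `η` with `φ`, its transpose and its trace,
fixed by the values on the three irreducible summands of `Λ³`. Ordered triples suffice by `lam_ext`.
-/
theorem actCoeff_alt : ∀ a b c : Fin 7, a < b → b < c → ∀ i j k : Fin 7,
    actCoeff a b c i j k - actCoeff a b c i k j - actCoeff a b c j i k + actCoeff a b c j k i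
      + actCoeff a b c k i j - actCoeff a b c k j i = 36 * detKron i j k a b c := by
  decide +kernel

end

section

/-! ### The stabiliser of the standard form is contained in `O(7)` -/

/-- The standard basis of `ℝ⁷`. -/
abbrev stdVec (i : Fin 7) : E7 := EuclideanSpace.single i 1

theorem stdVec_apply (i j : Fin 7) : stdVec i j = (kron i j : ℝ) := by
  simp only [stdVec, PiLp.single_apply, kron, eq_comm (a := i)]; split_ifs <;> simp

theorem sum_smul_stdVec (u : E7) : ∑ i, u i • stdVec i = u := by
  ext j
  simp [Pi.single_apply]

theorem stdForm_stdVec (s : Fin 3 → Fin 7) :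
    stdForm (fun k => stdVec (s k)) = (phi (s 0) (s 1) (s 2) : ℝ) := by
  rw [phi_eq_detKron]
  simp only [stdForm, ContinuousAlternatingMap.sub_apply, ContinuousAlternatingMap.add_apply,
    elemForm_apply, Matrix.det_fin_three, Matrix.of_apply, stdVec_apply, detKron]
  push_cast
  simp only [Matrix.cons_val]

theorem multilinear_eq_sum {V ι : Type*} [AddCommGroup V] [Module ℝ V] [Fintype ι]
    [DecidableEq ι] {k : ℕ} (α : MultilinearMap ℝ (fun _ : Fin k => V) ℝ) (b : ι → V)
    (c : Fin k → ι → ℝ) :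
    α (fun a => ∑ i, c a i • b i) = ∑ I : Fin k → ι, (∏ a, c a (I a)) * α (b ∘ I) := by
  rw [MultilinearMap.map_sum]
  refine Finset.sum_congr rfl fun I _ => ?_
  rw [MultilinearMap.map_smul_univ, smul_eq_mul]
  rfl

theorem sum_fin_three_fun {ι M : Type*} [Fintype ι] [AddCommMonoid M] (F : (Fin 3 → ι) → M) :
    ∑ I, F I = ∑ i, ∑ j, ∑ k, F ![i, j, k] := by
  rw [← (Fin.consEquiv (fun _ : Fin 3 => ι)).sum_comp, Fintype.sum_prod_type]
  refine Finset.sum_congr rfl fun i _ => ?_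
  rw [← (Fin.consEquiv (fun _ : Fin 2 => ι)).sum_comp, Fintype.sum_prod_type]
  refine Finset.sum_congr rfl fun j _ => ?_
  rw [← (Fin.consEquiv (fun _ : Fin 1 => ι)).sum_comp, Fintype.sum_prod_type]
  refine Finset.sum_congr rfl fun k _ => ?_
  simp only [Finset.univ_unique, Finset.sum_singleton]
  rfl

theorem stdForm_apply (u v w : E7) :
    stdForm ![u, v, w] = ∑ i, ∑ j, ∑ k, (phi i j k : ℝ) * (u i * v j * w k) := by
  have h := multilinear_eq_sum stdForm.toMultilinearMap stdVec
    (fun a i => (![u, v, w] a) i)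
  simp only [sum_smul_stdVec] at h
  refine h.trans ?_
  rw [sum_fin_three_fun]
  refine Finset.sum_congr rfl fun i _ => Finset.sum_congr rfl fun j _ =>
    Finset.sum_congr rfl fun k _ => ?_
  have := stdForm_stdVec ![i, j, k]
  simp only [Matrix.cons_val] at this
  rw [mul_comm, ← this]
  simp only [Fin.prod_univ_three]
  rfl

open Matrix in
/-- The matrix of the 2-form `u ⌟ φ`. -/
def crossMatrix (u : Fin 7 → ℝ) : Matrix (Fin 7) (Fin 7) ℝ :=
  Matrix.of fun i j => ∑ k, u k * (phi k i j : ℝ)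

open Matrix

theorem transpose_crossMatrix (u : Fin 7 → ℝ) : (crossMatrix u)ᵀ = -crossMatrix u := by
  ext i j
  rw [transpose_apply, Matrix.neg_apply]
  simp only [crossMatrix, of_apply, ← Finset.sum_neg_distrib]
  refine Finset.sum_congr rfl fun k _ => ?_
  rw [phi_swap₂₃]; push_cast; ring

/-- Polarisation in `u` of `|u × v|² = |u|²|v|² - ⟨u, v⟩²`. -/
theorem sum_phi_phi_symm (i j k l : Fin 7) :
    phiPhi k i l j + phiPhi l i k j = 2 * kron k l * kron i j - kron k j * kron i l
      - kron l j * kron i k := by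
  revert i j k l; decide +kernel

theorem phi_cyclic (i j k : Fin 7) : phi i j k = phi j k i := by
  rw [phi_swap₂₃ j i k, phi_swap₁₂ i j k]; ring

theorem crossMatrix_mul_self (u : Fin 7 → ℝ) :
    crossMatrix u * crossMatrix u = vecMulVec u u - (u ⬝ᵥ u) • (1 : Matrix (Fin 7) (Fin 7) ℝ) := by
  ext i j
  have h1 : (crossMatrix u * crossMatrix u) i j
      = ∑ k, ∑ l, u k * u l * -(phiPhi k i l j : ℝ) := by
    simp only [mul_apply, crossMatrix, of_apply, Finset.sum_mul_sum]
    rw [Finset.sum_comm]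
    refine Finset.sum_congr rfl fun k _ => ?_
    rw [Finset.sum_comm]
    refine Finset.sum_congr rfl fun l _ => ?_
    rw [← sum_phi_mul_phi]
    push_cast
    rw [← Finset.sum_neg_distrib, Finset.mul_sum]
    refine Finset.sum_congr rfl fun m _ => ?_
    rw [phi_swap₁₂ l m j]; push_cast; ring
  have h2 : (crossMatrix u * crossMatrix u) i j
      = ∑ k, ∑ l, u k * u l * -(phiPhi l i k j : ℝ) := by
    rw [h1, Finset.sum_comm]
    refine Finset.sum_congr rfl fun k _ => Finset.sum_congr rfl fun l _ => by ring
  have h3 : 2 * (crossMatrix u * crossMatrix u) i j = ∑ k, ∑ l, u k * u l *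
      -(2 * kron k l * kron i j - kron k j * kron i l - kron l j * kron i k : ℤ) := by
    rw [two_mul]
    nth_rewrite 1 [h1]
    rw [h2, ← Finset.sum_add_distrib]
    refine Finset.sum_congr rfl fun k _ => ?_
    rw [← Finset.sum_add_distrib]
    refine Finset.sum_congr rfl fun l _ => ?_
    rw [← sum_phi_phi_symm]; push_cast; ring
  have h4 : ∑ k, ∑ l, u k * u l *
      -((2 * kron k l * kron i j - kron k j * kron i l - kron l j * kron i k : ℤ) : ℝ)
      = 2 * (u i * u j) - 2 * ((u ⬝ᵥ u) * (kron i j : ℝ)) := by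
    push_cast
    simp only [mul_neg, mul_sub, Finset.sum_neg_distrib, Finset.sum_sub_distrib]
    have e1 : ∑ k, ∑ l, u k * u l * (2 * (kron k l : ℝ) * (kron i j : ℝ))
        = 2 * ((u ⬝ᵥ u) * (kron i j : ℝ)) := by
      simp only [dotProduct, Finset.sum_mul, Finset.mul_sum]
      refine Finset.sum_congr rfl fun k _ => ?_
      rw [Finset.sum_eq_single k (fun b _ hb => by simp [kron, hb.symm]) (by simp)]
      simp [kron]; ring
    have e2 : ∑ k, ∑ l, u k * u l * ((kron k j : ℝ) * (kron i l : ℝ)) = u i * u j := by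
      simp [kron, mul_comm]
    have e3 : ∑ k, ∑ l, u k * u l * ((kron l j : ℝ) * (kron i k : ℝ)) = u i * u j := by
      simp [kron]
    rw [e1, e2, e3]; ring
  rw [h4] at h3
  rw [Matrix.sub_apply, Matrix.smul_apply, vecMulVec_apply, one_apply, smul_eq_mul]
  have h5 : ((kron i j : ℤ) : ℝ) = if i = j then 1 else 0 := by simp [kron]
  rw [h5] at h3
  linarith

theorem crossMatrix_mulVec_self (u : Fin 7 → ℝ) : crossMatrix u *ᵥ u = 0 := by
  ext i
  have h : (crossMatrix u *ᵥ u) i = ∑ k, ∑ l, u k * u l * (phi k i l : ℝ) := by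
    simp only [mulVec, dotProduct, crossMatrix, of_apply, Finset.sum_mul]
    rw [Finset.sum_comm]
    exact Finset.sum_congr rfl fun k _ => Finset.sum_congr rfl fun l _ => by ring
  have h' : (crossMatrix u *ᵥ u) i = ∑ k, ∑ l, u k * u l * -(phi k i l : ℝ) := by
    rw [h, Finset.sum_comm]
    refine Finset.sum_congr rfl fun k _ => Finset.sum_congr rfl fun l _ => ?_
    rw [← phi_cyclic, phi_swap₁₂, phi_cyclic]
    rw [phi_swap₁₂, phi_cyclic, phi_cyclic]; push_cast; ring
  simp only [mul_neg, Finset.sum_neg_distrib] at h'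
  rw [← h] at h'
  simpa using self_eq_neg.mp h'

theorem vecMul_crossMatrix_self (u : Fin 7 → ℝ) : u ᵥ* crossMatrix u = 0 := by
  rw [← mulVec_transpose, transpose_crossMatrix, neg_mulVec, crossMatrix_mulVec_self, neg_zero]

theorem det_one_add_vecMulVec {n : Type*} [Fintype n] [DecidableEq n] (u v : n → ℝ) :
    (1 + vecMulVec u v).det = 1 + v ⬝ᵥ u := by
  rw [vecMulVec_eq Unit, det_one_add_replicateCol_mul_replicateRow]

/-- The matrix of `u ⌟ φ` is a multiple of a complex structure on the complement of `u` and kills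
`u`; the rank-one term fills in the missing direction. -/
theorem det_crossMatrix_add_self_sq {u : Fin 7 → ℝ} (hu : u ≠ 0) (x : ℝ) :
    (crossMatrix u + x • vecMulVec u u).det ^ 2 = (u ⬝ᵥ u) ^ 8 * x ^ 2 := by
  have hn : 0 < u ⬝ᵥ u := by
    have := dotProduct_self_star_pos_iff (v := u)
    simpa using this.2 hu
  set n := u ⬝ᵥ u with hn'
  -- With `s² n = 1` the matrix `N` is `√n` times an orthogonal one. The general coefficient `x` is
  -- reached from `s` by a rank-one perturbation of the identity.
  set s := (Real.sqrt n)⁻¹ with hs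
  have hs0 : 0 < s := inv_pos.2 (Real.sqrt_pos.2 hn)
  have hs2 : s ^ 2 * n = 1 := by
    rw [hs, inv_pow, Real.sq_sqrt hn.le, inv_mul_cancel₀ hn.ne']
  set N := crossMatrix u + s • vecMulVec u u with hN
  have hNN : N * Nᵀ = n • (1 : Matrix (Fin 7) (Fin 7) ℝ) := by
    have hT : Nᵀ = -crossMatrix u + s • vecMulVec u u := by
      rw [hN, transpose_add, transpose_crossMatrix, transpose_smul, transpose_vecMulVec]
    rw [hT, hN]
    simp only [add_mul, mul_add, mul_neg, crossMatrix_mul_self, smul_mul_assoc, mul_smul_comm,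
      mul_vecMulVec, vecMulVec_mul, crossMatrix_mulVec_self, vecMul_crossMatrix_self,
      zero_vecMulVec, vecMulVec_zero, smul_zero, add_zero, zero_add, ← hn', smul_smul]
    have hs3 : s * s * n = 1 := by rw [← sq, hs2]
    rw [vecMulVec_mulVec, ← hn', op_smul_eq_smul, smul_vecMulVec, smul_smul, hs3]
    module
  have hdN : N.det ^ 2 = n ^ 7 := by
    have := congrArg Matrix.det hNN
    rw [det_mul, det_transpose, det_smul, det_one, mul_one, Fintype.card_fin] at this
    rw [sq, this]
  have hfac : crossMatrix u + x • vecMulVec u u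
      = N * (1 + vecMulVec (((x - s) / (s * n)) • u) u) := by
    rw [hN]
    simp only [mul_add, mul_one, mul_vecMulVec, mulVec_smul, crossMatrix_mulVec_self, add_mulVec,
      smul_zero, zero_add, smul_mulVec, vecMulVec_mulVec, ← hn', op_smul_eq_smul]
    ext i j
    simp only [Matrix.add_apply, Matrix.smul_apply, vecMulVec_apply, smul_eq_mul, Pi.smul_apply,
      op_smul_eq_smul]
    field_simp
    ring
  rw [hfac, det_mul, det_one_add_vecMulVec, dotProduct_smul, ← hn', smul_eq_mul, mul_pow, hdN]
  have : 1 + (x - s) / (s * n) * n = x * s⁻¹ := by field_simp; ring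
  rw [this, mul_pow, inv_pow]
  have h2 : (s ^ 2)⁻¹ = n := by
    rw [inv_eq_iff_eq_inv]; exact eq_inv_of_mul_eq_one_left hs2
  rw [h2]; ring

theorem det_crossMatrix_add_sq {u ξ : Fin 7 → ℝ} (hu : u ≠ 0) (hξ : ξ ⬝ᵥ u ≠ 0) :
    (crossMatrix u + vecMulVec ξ ξ).det ^ 2 = (u ⬝ᵥ u) ^ 4 * (ξ ⬝ᵥ u) ^ 4 := by
  have hn : 0 < u ⬝ᵥ u := by
    have := dotProduct_self_star_pos_iff (v := u)
    simpa using this.2 hu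
  set n := u ⬝ᵥ u with hn'
  set t := ξ ⬝ᵥ u with ht
  have ht' : u ⬝ᵥ ξ = t := by rw [dotProduct_comm]
  -- Chosen so that `ξ + t q = (t / n) u` and `q ⬝ᵥ u = 0`. The shear `1 + q uᵀ` has determinant
  -- one, leaves the matrix of `u ⌟ φ` unchanged and moves `ξ` onto the line of `u`.
  set q : Fin 7 → ℝ := n⁻¹ • u - t⁻¹ • ξ with hq
  have hqu : q ⬝ᵥ u = 0 := by
    rw [hq, sub_dotProduct, smul_dotProduct, smul_dotProduct, ← hn', ← ht]
    simp [hn.ne', hξ]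
  have huq : u ⬝ᵥ q = 0 := by rw [dotProduct_comm, hqu]
  have hprod : (1 + vecMulVec q u) * (crossMatrix u + vecMulVec ξ ξ) * (1 + vecMulVec u q)
      = crossMatrix u + (t / n) ^ 2 • vecMulVec u u := by
    simp only [add_mul, mul_add, mul_one, one_mul, mul_vecMulVec, vecMulVec_mul,
      vecMulVec_mulVec, crossMatrix_mulVec_self, vecMul_crossMatrix_self,
      zero_vecMulVec, vecMulVec_zero, add_zero, zero_add, ← ht, ht', op_smul_eq_smul]
    ext i j
    simp only [Matrix.add_apply, Matrix.smul_apply, vecMulVec_apply, smul_eq_mul, Pi.smul_apply, hq,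
      op_smul_eq_smul, Pi.sub_apply]
    field_simp
    ring
  have := congrArg Matrix.det hprod
  rw [det_mul, det_mul, det_one_add_vecMulVec, det_one_add_vecMulVec, hqu, huq, add_zero, one_mul,
    mul_one] at this
  rw [this, det_crossMatrix_add_self_sq hu, ← hn']
  field_simp

theorem stdForm_eq_crossMatrix (u v w : E7) :
    stdForm ![u, v, w] = v ⬝ᵥ (crossMatrix u *ᵥ w) := by
  rw [stdForm_apply]
  simp only [dotProduct, mulVec, crossMatrix, of_apply, Finset.mul_sum, Finset.sum_mul]
  rw [Finset.sum_comm]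
  refine Finset.sum_congr rfl fun j _ => ?_
  rw [Finset.sum_comm]
  exact Finset.sum_congr rfl fun k _ => Finset.sum_congr rfl fun i _ => by ring

theorem inner_eq_dotProduct (u v : E7) : inner ℝ u v = (u : Fin 7 → ℝ) ⬝ᵥ v := by
  simp [PiLp.inner_apply, dotProduct, mul_comm]

/-- A linear automorphism preserving the standard form is an isometry. -/
theorem inner_map_map_of_stdForm_comp (A : E7 ≃L[ℝ] E7)
    (hA : stdForm.compContinuousLinearMap (A : E7 →L[ℝ] E7) = stdForm) (u v : E7) :
    inner ℝ (A u) (A v) = (inner ℝ u v : ℝ) := by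
  classical
  set a : Matrix (Fin 7) (Fin 7) ℝ := Matrix.of fun i j => A (stdVec j) i with ha
  have hmul : ∀ w : E7, (A w : Fin 7 → ℝ) = a *ᵥ w := by
    intro w
    conv_lhs => rw [← sum_smul_stdVec w]
    ext i
    simp [ha, mulVec, dotProduct, mul_comm]
  have hcross : ∀ w : E7, aᵀ * crossMatrix (A w) * a = crossMatrix w := by
    intro w
    have key : ∀ y z : Fin 7 → ℝ,
        y ⬝ᵥ ((aᵀ * crossMatrix (A w) * a) *ᵥ z) = y ⬝ᵥ (crossMatrix w *ᵥ z) := by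
      intro y z
      have h := DFunLike.congr_fun hA ![w, WithLp.toLp 2 y, WithLp.toLp 2 z]
      rw [stdForm_eq_crossMatrix] at h
      have h' : stdForm.compContinuousLinearMap (A : E7 →L[ℝ] E7)
          ![w, WithLp.toLp 2 y, WithLp.toLp 2 z]
          = stdForm ![A w, A (WithLp.toLp 2 y), A (WithLp.toLp 2 z)] := by
        change stdForm _ = _
        congr 1
        ext k
        fin_cases k <;> rfl
      rw [h', stdForm_eq_crossMatrix, hmul (WithLp.toLp 2 y), hmul (WithLp.toLp 2 z)] at h
      rw [← h, ← mulVec_mulVec, ← mulVec_mulVec, dotProduct_mulVec, vecMul_transpose]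
    ext i j
    have := key (Pi.single i 1) (Pi.single j 1)
    simpa using this
  have hdet : ∀ w : E7, |a.det| * ((A w : Fin 7 → ℝ) ⬝ᵥ A w) = (w : Fin 7 → ℝ) ⬝ᵥ w := by
    intro w
    by_cases hw : w = 0
    · simp [hw]
    have hw' : (w : Fin 7 → ℝ) ≠ 0 := fun h => hw (by ext i; exact congrFun h i)
    have hAw : (A w : Fin 7 → ℝ) ≠ 0 := fun h =>
      hw ((map_eq_zero_iff A A.injective).1 (by ext i; exact congrFun h i))
    have hn : 0 < (w : Fin 7 → ℝ) ⬝ᵥ w := by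
      simpa using (dotProduct_self_star_pos_iff (v := (w : Fin 7 → ℝ))).2 hw'
    have hm : 0 < (A w : Fin 7 → ℝ) ⬝ᵥ A w := by
      simpa using (dotProduct_self_star_pos_iff (v := (A w : Fin 7 → ℝ))).2 hAw
    -- Congruence by `a` turns the matrix of `Aw ⌟ φ` into that of `w ⌟ φ`, and `Aw (Aw)ᵀ` into `ξ
    -- ξᵀ` with `ξ ⬝ᵥ w = |Aw|²`. Comparing squared determinants gives `(det a)⁴ |Aw|¹⁶ = |w|⁸
    -- |Aw|⁸`, so `|det a|` is the only possible conformal factor.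
    set ξ : Fin 7 → ℝ := aᵀ *ᵥ (A w : Fin 7 → ℝ) with hξ
    have hξw : ξ ⬝ᵥ (w : Fin 7 → ℝ) = (A w : Fin 7 → ℝ) ⬝ᵥ A w := by
      rw [hξ, dotProduct_comm, dotProduct_mulVec, vecMul_transpose, ← hmul]
    have h1 : aᵀ * (crossMatrix (A w) + vecMulVec (A w) (A w)) * a
        = crossMatrix w + vecMulVec ξ ξ := by
      rw [mul_add, add_mul, hcross, mul_vecMulVec, vecMulVec_mul, ← hξ]
      congr 2
      rw [hξ, mulVec_transpose]
    have h2 := congrArg (fun m => Matrix.det m ^ 2) h1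
    simp only [det_mul, det_transpose, mul_pow] at h2
    rw [det_crossMatrix_add_sq hAw hm.ne', det_crossMatrix_add_sq hw' (by rw [hξw]; exact hm.ne'),
      hξw] at h2
    set m := (A w : Fin 7 → ℝ) ⬝ᵥ A w
    set n := (w : Fin 7 → ℝ) ⬝ᵥ w
    have h3 : (|a.det| * m) ^ 4 = n ^ 4 := by
      rw [mul_pow]
      have : |a.det| ^ 4 = a.det ^ 2 * a.det ^ 2 := by
        rw [← sq_abs a.det]; ring
      rw [this]
      refine mul_right_cancel₀ (pow_ne_zero 4 hm.ne') ?_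
      linarith [h2]
    exact (pow_left_inj₀ (mul_nonneg (abs_nonneg _) hm.le) hn.le (by norm_num)).1 h3
  have hpol : ∀ y z : E7, |a.det| * inner ℝ (A y) (A z) = (inner ℝ y z : ℝ) := by
    intro y z
    have h1 := hdet (y + z)
    have h2 := hdet y
    have h3 := hdet z
    simp only [← inner_eq_dotProduct, map_add, inner_add_left, inner_add_right] at h1 h2 h3
    rw [real_inner_comm y z, real_inner_comm (A y) (A z)] at h1
    linarith
  have hmat : |a.det| • (aᵀ * a) = 1 := by
    ext i j
    have := hpol (stdVec i) (stdVec j)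
    rw [inner_eq_dotProduct, inner_eq_dotProduct, hmul, hmul] at this
    simp only [Matrix.smul_apply, smul_eq_mul, mul_apply, transpose_apply]
    rw [one_apply, if_congr (eq_comm (a := i)) rfl rfl]
    simpa [dotProduct, mulVec, Pi.single_apply] using this
  -- Determinants in `|det a| aᵀa = 1`: seven powers from the scalar and two from `aᵀa`.
  have h9 : |a.det| ^ 9 = 1 := by
    have := congrArg Matrix.det hmat
    rw [det_smul, det_mul, det_transpose, det_one, Fintype.card_fin] at this
    have h' : |a.det| ^ 9 = |a.det| ^ 7 * (|a.det| * |a.det|) := by ring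
    rw [h', abs_mul_abs_self, this]
  have h1 : |a.det| = 1 := (pow_eq_one_iff_of_nonneg (abs_nonneg _) (by norm_num)).1 h9
  have := hpol u v
  rwa [h1, one_mul] at this

end

section

/-! ### The metric and the norms of a positive form do not depend on the choice of the frame -/

section Frames

variable {V W : Type*} [AddCommGroup V] [Module ℝ V] [TopologicalSpace V]
  [AddCommGroup W] [Module ℝ W] [TopologicalSpace W]

/-- Two identifications of `σ` with `φ` differ by an automorphism of `φ`, hence by an isometry. This
removes the choice hidden in `metric`. -/
theorem metric_eq_inner {σ : V [⋀^Fin 3]→L[ℝ] ℝ} (e : V ≃L[ℝ] E7)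
    (he : stdForm.compContinuousLinearMap (e : V →L[ℝ] E7) = σ) (u v : V) :
    metric σ u v = inner ℝ (e u) (e v) := by
  have h : IsPositive σ := ⟨e, he⟩
  rw [metric, dif_pos h]
  set e' := h.choose with he'
  have hs : stdForm.compContinuousLinearMap (e' : V →L[ℝ] E7) = σ := h.choose_spec
  have hA : stdForm.compContinuousLinearMap ((e.symm.trans e' : E7 ≃L[ℝ] E7) : E7 →L[ℝ] E7)
      = stdForm := by
    ext w
    have h1 := DFunLike.congr_fun hs (fun k => e.symm (w k))
    rw [← he] at h1
    refine h1.trans ?_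
    change stdForm (fun k => e (e.symm (w k))) = _
    simp
  have := inner_map_map_of_stdForm_comp (e.symm.trans e') hA (e u) (e v)
  simpa using this

theorem frame_eq {σ : V [⋀^Fin 3]→L[ℝ] ℝ} (h : IsPositive σ) :
    ∃ e : V ≃L[ℝ] E7, stdForm.compContinuousLinearMap (e : V →L[ℝ] E7) = σ ∧
      ∀ i, frame σ i = e.symm (stdVec i) :=
  ⟨h.choose, h.choose_spec, fun i => by rw [frame, dif_pos h]⟩

/-- Tensor powers of an orthogonal matrix are orthogonal: after multilinear expansion the sum over
`I` factors into the column products of `O`. -/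
theorem sum_mul_comp_orthogonal {ι : Type*} [Fintype ι] [DecidableEq ι] {k : ℕ}
    (α β : MultilinearMap ℝ (fun _ : Fin k => V) ℝ) (O : Matrix ι ι ℝ)
    (hO : O.transpose * O = 1) (f f' : ι → V) (hf : ∀ i, f' i = ∑ j, O i j • f j) :
    ∑ I : Fin k → ι, α (f' ∘ I) * β (f' ∘ I) = ∑ I : Fin k → ι, α (f ∘ I) * β (f ∘ I) := by
  have hexp : ∀ (γ : MultilinearMap ℝ (fun _ : Fin k => V) ℝ) (I : Fin k → ι),
      γ (f' ∘ I) = ∑ J : Fin k → ι, (∏ a, O (I a) (J a)) * γ (f ∘ J) := by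
    intro γ I
    rw [← multilinear_eq_sum γ f (fun a => O (I a))]
    congr 1
    ext a
    exact hf _
  have hprod : ∀ J K : Fin k → ι,
      ∑ I : Fin k → ι, (∏ a, O (I a) (J a)) * ∏ a, O (I a) (K a) = if J = K then 1 else 0 := by
    intro J K
    simp_rw [← Finset.prod_mul_distrib]
    rw [← Fintype.prod_sum (fun a i => O i (J a) * O i (K a))]
    have : ∀ a, ∑ i, O i (J a) * O i (K a) = if J a = K a then 1 else 0 := by
      intro a
      have := congrFun (congrFun hO (J a)) (K a)
      rw [Matrix.mul_apply, Matrix.one_apply] at this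
      simpa using this
    simp_rw [this]
    split_ifs with h
    · simp [h]
    · obtain ⟨a, ha⟩ := Function.ne_iff.1 h
      exact Finset.prod_eq_zero (Finset.mem_univ a) (by simp [ha])
  calc ∑ I : Fin k → ι, α (f' ∘ I) * β (f' ∘ I)
      = ∑ I : Fin k → ι, ∑ J : Fin k → ι, ∑ K : Fin k → ι,
          ((∏ a, O (I a) (J a)) * ∏ a, O (I a) (K a)) * (α (f ∘ J) * β (f ∘ K)) := by
        refine Finset.sum_congr rfl fun I _ => ?_
        rw [hexp α, hexp β, Finset.sum_mul_sum]
        refine Finset.sum_congr rfl fun J _ => Finset.sum_congr rfl fun K _ => by ring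
    _ = ∑ J : Fin k → ι, ∑ K : Fin k → ι,
          (∑ I : Fin k → ι, (∏ a, O (I a) (J a)) * ∏ a, O (I a) (K a))
            * (α (f ∘ J) * β (f ∘ K)) := by
        rw [Finset.sum_comm]
        refine Finset.sum_congr rfl fun J _ => ?_
        rw [Finset.sum_comm]
        simp_rw [Finset.sum_mul]
    _ = _ := by
        simp_rw [hprod]
        simp

/-- Two frames adapted to the same positive form differ by an orthogonal matrix. -/
theorem exists_orthogonal_of_adapted {σ : V [⋀^Fin 3]→L[ℝ] ℝ} (e e' : V ≃L[ℝ] E7)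
    (he : stdForm.compContinuousLinearMap (e : V →L[ℝ] E7) = σ)
    (he' : stdForm.compContinuousLinearMap (e' : V →L[ℝ] E7) = σ) :
    ∃ O : Matrix (Fin 7) (Fin 7) ℝ, O.transpose * O = 1 ∧
      ∀ i, e'.symm (stdVec i) = ∑ j, O i j • e.symm (stdVec j) := by
  refine ⟨Matrix.of fun i j => e (e'.symm (stdVec i)) j, ?_, fun i => ?_⟩
  · rw [mul_eq_one_comm]
    ext i j
    have h := metric_eq_inner e he (e'.symm (stdVec i)) (e'.symm (stdVec j))
    rw [metric_eq_inner e' he'] at h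
    simp only [ContinuousLinearEquiv.apply_symm_apply] at h
    rw [inner_eq_dotProduct, inner_eq_dotProduct] at h
    rw [Matrix.mul_apply, Matrix.one_apply]
    simp only [Matrix.transpose_apply, Matrix.of_apply]
    rw [dotProduct, dotProduct] at h
    rw [← h]
    simp [Pi.single_apply, eq_comm]
  · apply e.injective
    simp only [map_sum, map_smul, ContinuousLinearEquiv.apply_symm_apply, Matrix.of_apply]
    rw [sum_smul_stdVec]

/-- Permits any adapted coframe in place of the chosen one, in particular one that varies smoothly.
-/
theorem formInner_eq_sum {σ : V [⋀^Fin 3]→L[ℝ] ℝ} (e : V ≃L[ℝ] E7)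
    (he : stdForm.compContinuousLinearMap (e : V →L[ℝ] E7) = σ) {k : ℕ}
    (α β : MultilinearMap ℝ (fun _ : Fin k => V) ℝ) :
    formInner σ α β = (k.factorial : ℝ)⁻¹ * ∑ I : Fin k → Fin 7,
      α (fun a => e.symm (stdVec (I a))) * β (fun a => e.symm (stdVec (I a))) := by
  obtain ⟨e', he', hf⟩ := frame_eq ⟨e, he⟩
  obtain ⟨O, hO, hOf⟩ := exists_orthogonal_of_adapted e e' he he'
  rw [formInner]
  congr 1
  exact sum_mul_comp_orthogonal α β O hO (fun i => e.symm (stdVec i)) (frame σ)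
    (fun i => by rw [hf, hOf])

theorem sum_frame_bilinear {σ : V [⋀^Fin 3]→L[ℝ] ℝ} (e : V ≃L[ℝ] E7)
    (he : stdForm.compContinuousLinearMap (e : V →L[ℝ] E7) = σ) (B : V →ₗ[ℝ] V →ₗ[ℝ] ℝ) :
    ∑ i, B (frame σ i) (frame σ i) = ∑ i, B (e.symm (stdVec i)) (e.symm (stdVec i)) := by
  obtain ⟨e', he', hf⟩ := frame_eq ⟨e, he⟩
  obtain ⟨O, hO, hOf⟩ := exists_orthogonal_of_adapted e e' he he'
  simp_rw [hf, hOf]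
  simp only [map_sum, map_smul, LinearMap.sum_apply, LinearMap.smul_apply, smul_eq_mul]
  rw [Finset.sum_comm]
  refine Finset.sum_congr rfl fun j _ => ?_
  simp only [Finset.mul_sum]
  rw [Finset.sum_comm]
  have : ∀ k, ∑ i, O i j * (O i k * B (e.symm (stdVec k)) (e.symm (stdVec j)))
      = (if k = j then 1 else 0) * B (e.symm (stdVec k)) (e.symm (stdVec j)) := by
    intro k
    have h := congrFun (congrFun hO j) k
    rw [Matrix.mul_apply, Matrix.one_apply, if_congr (eq_comm (a := j)) rfl rfl] at h
    rw [← h, Finset.sum_mul]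
    exact Finset.sum_congr rfl fun i _ => by rw [Matrix.transpose_apply]; ring
  simp_rw [this]
  simp

theorem IsPositive.comp {σ : W [⋀^Fin 3]→L[ℝ] ℝ} (hσ : IsPositive σ) (D : V ≃L[ℝ] W) :
    IsPositive (σ.compContinuousLinearMap (D : V →L[ℝ] W)) := by
  obtain ⟨e, rfl⟩ := hσ
  exact ⟨D.trans e, rfl⟩

theorem metric_comp {σ : W [⋀^Fin 3]→L[ℝ] ℝ} (hσ : IsPositive σ) (D : V ≃L[ℝ] W) (u v : V) :
    metric (σ.compContinuousLinearMap (D : V →L[ℝ] W)) u v = metric σ (D u) (D v) := by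
  obtain ⟨e, he⟩ := hσ
  rw [metric_eq_inner e he, metric_eq_inner (D.trans e) (by rw [← he]; rfl)]
  rfl

theorem formInner_comp {σ : W [⋀^Fin 3]→L[ℝ] ℝ} (hσ : IsPositive σ) (D : V ≃L[ℝ] W) {k : ℕ}
    (α β : MultilinearMap ℝ (fun _ : Fin k => W) ℝ) :
    formInner (σ.compContinuousLinearMap (D : V →L[ℝ] W)) (fun v => α (fun a => D (v a)))
      (fun v => β (fun a => D (v a))) = formInner σ α β := by
  obtain ⟨e, he⟩ := hσ
  rw [formInner_eq_sum e he]
  refine (formInner_eq_sum (D.trans e) (by rw [← he]; rfl)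
    (α.compLinearMap fun _ => (D : V →L[ℝ] W).toLinearMap)
    (β.compLinearMap fun _ => (D : V →L[ℝ] W).toLinearMap)).trans ?_
  simp

theorem sum_frame_comp {σ : W [⋀^Fin 3]→L[ℝ] ℝ} (hσ : IsPositive σ) (D : V ≃L[ℝ] W)
    (B : W →ₗ[ℝ] W →ₗ[ℝ] ℝ) :
    ∑ i, B (D (frame (σ.compContinuousLinearMap (D : V →L[ℝ] W)) i))
      (D (frame (σ.compContinuousLinearMap (D : V →L[ℝ] W)) i))
      = ∑ i, B (frame σ i) (frame σ i) := by
  obtain ⟨e, he⟩ := hσ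
  rw [sum_frame_bilinear e he]
  refine (sum_frame_bilinear (D.trans e) (by rw [← he]; rfl)
    (B.compl₁₂ (D : V →L[ℝ] W).toLinearMap (D : V →L[ℝ] W).toLinearMap)).trans ?_
  simp

/-! ### Behaviour under scaling of the positive form -/

variable [ContinuousConstSMul ℝ V]

/-- Multiplication by a positive number. -/
theorem stdForm_comp_smul {σ : V [⋀^Fin 3]→L[ℝ] ℝ} (e : V ≃L[ℝ] E7)
    (he : stdForm.compContinuousLinearMap (e : V →L[ℝ] E7) = σ) {μ : ℝ} (hμ : μ ≠ 0) :
    stdForm.compContinuousLinearMap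
      ((((ContinuousLinearEquiv.smulLeft (Units.mk0 μ hμ)).trans e : V ≃L[ℝ] E7)) : V →L[ℝ] E7)
      = μ ^ 3 • σ := by
  ext v
  rw [← he]
  change stdForm (fun a => e (μ • v a)) = μ ^ 3 • stdForm (fun a => e (v a))
  simp only [map_smul]
  have := stdForm.toMultilinearMap.map_smul_univ (fun _ => μ) (fun a => e (v a))
  simpa using this

/-- A coframe multiplied by `μ` pulls the cubic form `φ` back to `μ³σ`. Taking the cube root as
parameter keeps the later weights integral: `μ²` for the metric, `μ^(-2k)` for pairings of
`k`-forms, `μ⁷` for volume. -/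
theorem IsPositive.smul {σ : V [⋀^Fin 3]→L[ℝ] ℝ} (hσ : IsPositive σ) {μ : ℝ} (hμ : μ ≠ 0) :
    IsPositive (μ ^ 3 • σ) := by
  obtain ⟨e, he⟩ := hσ
  exact ⟨_, stdForm_comp_smul e he hμ⟩

theorem metric_smul {σ : V [⋀^Fin 3]→L[ℝ] ℝ} (hσ : IsPositive σ) {μ : ℝ} (hμ : μ ≠ 0) (u v : V) :
    metric (μ ^ 3 • σ) u v = μ ^ 2 * metric σ u v := by
  obtain ⟨e, he⟩ := hσ
  rw [metric_eq_inner _ (stdForm_comp_smul e he hμ), metric_eq_inner e he]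
  change inner ℝ (e (μ • u)) (e (μ • v)) = _
  simp only [map_smul, inner_smul_left, inner_smul_right]
  simp; ring

theorem formInner_smul {σ : V [⋀^Fin 3]→L[ℝ] ℝ} (hσ : IsPositive σ) {μ : ℝ} (hμ : μ ≠ 0) {k : ℕ}
    (α β : MultilinearMap ℝ (fun _ : Fin k => V) ℝ) :
    formInner (μ ^ 3 • σ) α β = (μ⁻¹) ^ (2 * k) * formInner σ α β := by
  obtain ⟨e, he⟩ := hσ
  rw [formInner_eq_sum _ (stdForm_comp_smul e he hμ), formInner_eq_sum e he]
  have h : ∀ i, ((ContinuousLinearEquiv.smulLeft (Units.mk0 μ hμ)).trans e : V ≃L[ℝ] E7).symm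
      (stdVec i) = μ⁻¹ • e.symm (stdVec i) := by
    intro i
    rw [ContinuousLinearEquiv.symm_apply_eq]
    change _ = e (μ • (μ⁻¹ • _))
    rw [smul_smul, mul_inv_cancel₀ hμ, one_smul, ContinuousLinearEquiv.apply_symm_apply]
  simp_rw [h]
  have h2 : ∀ (γ : MultilinearMap ℝ (fun _ : Fin k => V) ℝ) (w : Fin k → V),
      γ (fun a => μ⁻¹ • w a) = μ⁻¹ ^ k * γ w := by
    intro γ w
    have := γ.map_smul_univ (fun _ => μ⁻¹) w
    simpa using this
  simp_rw [h2]
  rw [mul_left_comm, Finset.mul_sum (a := μ⁻¹ ^ (2 * k))]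
  congr 1
  exact Finset.sum_congr rfl fun I _ => by ring

theorem sum_frame_smul {σ : V [⋀^Fin 3]→L[ℝ] ℝ} (hσ : IsPositive σ) {μ : ℝ} (hμ : μ ≠ 0)
    (B : V →ₗ[ℝ] V →ₗ[ℝ] ℝ) :
    ∑ i, B (frame (μ ^ 3 • σ) i) (frame (μ ^ 3 • σ) i)
      = (μ⁻¹) ^ 2 * ∑ i, B (frame σ i) (frame σ i) := by
  obtain ⟨e, he⟩ := hσ
  rw [sum_frame_bilinear _ (stdForm_comp_smul e he hμ), sum_frame_bilinear e he]
  have h : ∀ i, ((ContinuousLinearEquiv.smulLeft (Units.mk0 μ hμ)).trans e : V ≃L[ℝ] E7).symm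
      (stdVec i) = μ⁻¹ • e.symm (stdVec i) := by
    intro i
    rw [ContinuousLinearEquiv.symm_apply_eq]
    change _ = e (μ • (μ⁻¹ • _))
    rw [smul_smul, mul_inv_cancel₀ hμ, one_smul, ContinuousLinearEquiv.apply_symm_apply]
  simp_rw [h]
  simp only [map_smul, LinearMap.smul_apply, smul_eq_mul, Finset.mul_sum]
  exact Finset.sum_congr rfl fun I _ => by ring

end Frames

end

section

/-! ### Local smooth sections of `GL(7) → Λ³` and smooth dependence of the metric -/

/-- The space of 3-forms on `ℝ⁷`. -/
abbrev Lam : Type := E7 [⋀^Fin 3]→L[ℝ] ℝ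

/-- The components of a 3-form. -/
def comps : Lam →L[ℝ] ((Fin 3 → Fin 7) → ℝ) :=
  ContinuousLinearMap.pi fun s => ContinuousAlternatingMap.apply ℝ E7 ℝ fun a => stdVec (s a)

theorem lam_apply_eq_sum (σ : Lam) (v : Fin 3 → E7) :
    σ v = ∑ I : Fin 3 → Fin 7, (∏ a, v a (I a)) * comps σ I := by
  have := multilinear_eq_sum σ.toMultilinearMap stdVec fun a i => v a i
  simp only [sum_smul_stdVec] at this
  exact this

theorem comps_injective : Function.Injective comps := by
  intro σ τ h
  ext v
  rw [lam_apply_eq_sum, lam_apply_eq_sum, h]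

instance finiteDimensional_lam : FiniteDimensional ℝ Lam :=
  FiniteDimensional.of_injective comps.toLinearMap comps_injective

theorem exists_comps_leftInverse : ∃ S : ((Fin 3 → Fin 7) → ℝ) →L[ℝ] Lam, ∀ σ, S (comps σ) = σ := by
  obtain ⟨S, hS⟩ := LinearMap.exists_leftInverse_of_injective comps.toLinearMap
    (LinearMap.ker_eq_bot.2 comps_injective)
  exact ⟨LinearMap.toContinuousLinearMap S, fun σ => LinearMap.congr_fun hS σ⟩

theorem contDiffAt_lam {X : Type*} [NormedAddCommGroup X] [NormedSpace ℝ X] {n : WithTop ℕ∞}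
    {f : X → Lam} {x : X} (h : ∀ s : Fin 3 → Fin 7,
      ContDiffAt ℝ n (fun z => f z fun a => stdVec (s a)) x) : ContDiffAt ℝ n f x := by
  obtain ⟨S, hS⟩ := exists_comps_leftInverse
  have h1 : ContDiffAt ℝ n (fun z => comps (f z)) x := contDiffAt_pi.2 h
  have h2 := S.contDiff.contDiffAt.comp x h1
  simpa [Function.comp_def, hS] using h2

theorem contDiffAt_coord {X : Type*} [NormedAddCommGroup X] [NormedSpace ℝ X] {n : WithTop ℕ∞}
    {f : X → E7} {x : X} (h : ContDiffAt ℝ n f x) (i : Fin 7) : ContDiffAt ℝ n (fun z => f z i) x :=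
  (EuclideanSpace.proj (𝕜 := ℝ) i : E7 →L[ℝ] ℝ).contDiff.contDiffAt.comp x h

theorem contDiffAt_lam_apply {X : Type*} [NormedAddCommGroup X] [NormedSpace ℝ X]
    {n : WithTop ℕ∞} {f : X → Lam} {v : X → Fin 3 → E7} {x : X} (hf : ContDiffAt ℝ n f x)
    (hv : ∀ a, ContDiffAt ℝ n (fun z => v z a) x) : ContDiffAt ℝ n (fun z => f z (v z)) x := by
  simp_rw [lam_apply_eq_sum]
  refine ContDiffAt.sum fun I _ => ContDiffAt.mul ?_ ?_
  · exact contDiffAt_prod fun a _ => contDiffAt_coord (hv a) _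
  · exact contDiffAt_pi.1 (comps.contDiff.contDiffAt.comp x hf) I

theorem contDiffAt_lam_comp {X : Type*} [NormedAddCommGroup X] [NormedSpace ℝ X]
    {n : WithTop ℕ∞} {f : X → Lam} {A : X → E7 →L[ℝ] E7} {x : X} (hf : ContDiffAt ℝ n f x)
    (hA : ContDiffAt ℝ n A x) :
    ContDiffAt ℝ n (fun z => (f z).compContinuousLinearMap (A z)) x := by
  refine contDiffAt_lam fun s => ?_
  change ContDiffAt ℝ n (fun z => f z fun a => A z (stdVec (s a))) x
  exact contDiffAt_lam_apply hf fun a => hA.clm_apply contDiffAt_const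

/-! ### The infinitesimal action on 3-forms and its right inverse -/

/-- The infinitesimal action of an endomorphism on 3-forms. -/
def act (σ : Lam) (B : E7 →L[ℝ] E7) : Lam :=
  σ.fderivCompContinuousLinearMap (ContinuousLinearMap.id ℝ E7) B

theorem act_apply (σ : Lam) (B : E7 →L[ℝ] E7) (v : Fin 3 → E7) :
    act σ B v = ∑ a, σ (Function.update v a (B (v a))) := by
  rw [act, ContinuousAlternatingMap.fderivCompContinuousLinearMap_apply]
  refine Finset.sum_congr rfl fun a _ => congrArg σ (funext fun b => ?_)
  by_cases h : b = a
  · subst h; simp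
  · simp [h]

/-- Writing `A + sB = A(1 + s A⁻¹B)` moves the derivative of the pull-back at an invertible `A` to
the identity. -/
theorem fderivComp_eq_act (σ : Lam) (A B : E7 →L[ℝ] E7) (e : E7 ≃L[ℝ] E7)
    (he : (e : E7 →L[ℝ] E7) = A) :
    σ.fderivCompContinuousLinearMap A B
      = act (σ.compContinuousLinearMap A) ((e.symm : E7 →L[ℝ] E7).comp B) := by
  subst he
  ext v
  rw [act_apply, ContinuousAlternatingMap.fderivCompContinuousLinearMap_apply]
  refine Finset.sum_congr rfl fun a _ => congrArg σ (funext fun b => ?_)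
  by_cases h : b = a
  · subst h; simp
  · simp [h]

/-- A linear right inverse of the infinitesimal action on the standard form. -/
def actInv : Lam →L[ℝ] E7 →L[ℝ] E7 :=
  ∑ m : Fin 7, ∑ a : Fin 7,
    ((36 : ℝ)⁻¹ • ∑ j, ∑ k, ((6 * phi m j k : ℝ) • ContinuousAlternatingMap.apply ℝ E7 ℝ
        ![stdVec a, stdVec j, stdVec k]
      + (3 * phi a j k : ℝ) • ContinuousAlternatingMap.apply ℝ E7 ℝ
        ![stdVec m, stdVec j, stdVec k]
      - (kron m a : ℝ) • ∑ i, (phi i j k : ℝ) • ContinuousAlternatingMap.apply ℝ E7 ℝ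
        ![stdVec i, stdVec j, stdVec k])).smulRight
    ((EuclideanSpace.proj (𝕜 := ℝ) a : E7 →L[ℝ] ℝ).smulRight (stdVec m))

theorem actInv_apply (η : Lam) (a m : Fin 7) :
    actInv η (stdVec a) m = (36 : ℝ)⁻¹ * ∑ j, ∑ k, ((6 * phi m j k : ℝ) *
        η ![stdVec a, stdVec j, stdVec k]
      + (3 * phi a j k : ℝ) * η ![stdVec m, stdVec j, stdVec k]
      - (kron m a : ℝ) * ∑ i, (phi i j k : ℝ) * η ![stdVec i, stdVec j, stdVec k]) := by
  simp only [actInv, ContinuousLinearMap.sum_apply, ContinuousLinearMap.smulRight_apply,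
    ContinuousLinearMap.smul_apply, ContinuousLinearMap.sub_apply, ContinuousLinearMap.add_apply,
    ContinuousAlternatingMap.apply_apply, smul_eq_mul, WithLp.ofLp_sum, Finset.sum_apply,
    WithLp.ofLp_smul, Pi.smul_apply, PiLp.proj_apply]
  rw [Finset.sum_eq_single m, Finset.sum_eq_single a]
  · simp
  · intro b _ hb
    simp [hb]
  · simp
  · intro b _ hb
    refine Finset.sum_eq_zero fun c _ => ?_
    simp [hb.symm]
  · simp

/-- Averaging over the six permutations of the indices: against an alternating tensor, a kernel may
be replaced by its alternation. -/
theorem alternating_sum_eq (η : Fin 7 → Fin 7 → Fin 7 → ℝ)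
    (h12 : ∀ i j k, η j i k = -η i j k) (h23 : ∀ i j k, η i k j = -η i j k)
    (K : Fin 7 → Fin 7 → Fin 7 → ℝ) :
    6 * ∑ i, ∑ j, ∑ k, K i j k * η i j k = ∑ i, ∑ j, ∑ k, (K i j k - K i k j - K j i k + K j k i
      + K k i j - K k j i) * η i j k := by
  have s12 : ∀ F : Fin 7 → Fin 7 → Fin 7 → ℝ,
      ∑ i, ∑ j, ∑ k, F j i k * η i j k = -∑ i, ∑ j, ∑ k, F i j k * η i j k := by
    intro F
    rw [Finset.sum_comm]
    simp only [← Finset.sum_neg_distrib]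
    refine Finset.sum_congr rfl fun i _ => Finset.sum_congr rfl fun j _ =>
      Finset.sum_congr rfl fun k _ => by rw [h12]; ring
  have s23 : ∀ F : Fin 7 → Fin 7 → Fin 7 → ℝ,
      ∑ i, ∑ j, ∑ k, F i k j * η i j k = -∑ i, ∑ j, ∑ k, F i j k * η i j k := by
    intro F
    rw [← Finset.sum_neg_distrib]
    refine Finset.sum_congr rfl fun i _ => ?_
    rw [Finset.sum_comm]
    simp only [← Finset.sum_neg_distrib]
    refine Finset.sum_congr rfl fun j _ => Finset.sum_congr rfl fun k _ => by rw [h23]; ring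
  have t3 := (s12 fun a b c => K a c b).trans (congrArg Neg.neg (s23 K))
  have t4 := (s23 fun a b c => K b a c).trans (congrArg Neg.neg (s12 K))
  have t5 := (s12 fun a b c => K c a b).trans (congrArg Neg.neg t4)
  simp only [sub_mul, add_mul, Finset.sum_sub_distrib, Finset.sum_add_distrib]
  rw [s12 K, s23 K, t3, t4, t5]
  ring

theorem lam_swap₁₂ (σ : Lam) (u v w : E7) : σ ![v, u, w] = -σ ![u, v, w] := by
  have := σ.toAlternatingMap.map_swap ![u, v, w] (i := 0) (j := 1) (by decide)
  rw [← show σ.toAlternatingMap ![u, v, w] = σ ![u, v, w] from rfl, ← this]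
  change σ _ = σ _
  congr 1
  ext a
  fin_cases a <;> rfl

theorem lam_swap₂₃ (σ : Lam) (u v w : E7) : σ ![u, w, v] = -σ ![u, v, w] := by
  have := σ.toAlternatingMap.map_swap ![u, v, w] (i := 1) (j := 2) (by decide)
  rw [← show σ.toAlternatingMap ![u, v, w] = σ ![u, v, w] from rfl, ← this]
  change σ _ = σ _
  congr 1
  ext a
  fin_cases a <;> rfl

theorem lam_ext {σ τ : Lam} (h : ∀ a b c : Fin 7, a < b → b < c →
    σ ![stdVec a, stdVec b, stdVec c] = τ ![stdVec a, stdVec b, stdVec c]) : σ = τ := by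
  have key : ∀ a b c : Fin 7, a ≠ b → a ≠ c → b ≠ c →
      σ ![stdVec a, stdVec b, stdVec c] = τ ![stdVec a, stdVec b, stdVec c] := by
    have h1 : ∀ a b c : Fin 7, a ≠ b → a ≠ c → b < c →
        σ ![stdVec a, stdVec b, stdVec c] = τ ![stdVec a, stdVec b, stdVec c] := by
      intro a b c hab hac hbc
      rcases lt_or_gt_of_ne hab with h' | h'
      · exact h a b c h' hbc
      · rw [lam_swap₁₂ σ, lam_swap₁₂ τ]
        rcases lt_or_gt_of_ne hac with h'' | h''
        · rw [h b a c h' h'']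
        · rw [lam_swap₂₃ σ, lam_swap₂₃ τ, h b c a hbc h'']
    intro a b c hab hac hbc
    rcases lt_or_gt_of_ne hbc with h' | h'
    · exact h1 a b c hab hac h'
    · rw [lam_swap₂₃ σ, lam_swap₂₃ τ, h1 a c b hac hab h']
  apply ContinuousAlternatingMap.toAlternatingMap_injective
  refine Module.Basis.ext_alternating (EuclideanSpace.basisFun (Fin 7) ℝ).toBasis fun v hv => ?_
  have := key (v 0) (v 1) (v 2) (hv.ne (by decide)) (hv.ne (by decide)) (hv.ne (by decide))
  have hv' : (fun i => (EuclideanSpace.basisFun (Fin 7) ℝ).toBasis (v i))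
      = ![stdVec (v 0), stdVec (v 1), stdVec (v 2)] := by
    ext i
    fin_cases i <;> simp
  rw [hv']
  exact this

theorem act_apply_three (σ : Lam) (B : E7 →L[ℝ] E7) (u v w : E7) :
    act σ B ![u, v, w] = σ ![B u, v, w] + σ ![u, B v, w] + σ ![u, v, B w] := by
  rw [act_apply, Fin.sum_univ_three]
  congr 2
  all_goals
    congr 1; ext a; fin_cases a <;> rfl

theorem stdForm_stdVec_three (a b c : Fin 7) :
    stdForm ![stdVec a, stdVec b, stdVec c] = (phi a b c : ℝ) := by
  rw [← show ((phi (![a, b, c] 0) (![a, b, c] 1) (![a, b, c] 2) : ℤ) : ℝ) = phi a b c from rfl,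
    ← stdForm_stdVec]
  congr 1
  ext i
  fin_cases i <;> rfl

theorem stdForm_map_stdVec (x : E7) (b c : Fin 7) :
    stdForm ![x, stdVec b, stdVec c] = ∑ m, x m * (phi m b c : ℝ) := by
  have h : stdForm ![∑ m, x m • stdVec m, stdVec b, stdVec c] = ∑ m, x m * (phi m b c : ℝ) := by
    have h0 := map_sum (stdForm.toMultilinearMap.toLinearMap ![0, stdVec b, stdVec c] 0)
      (fun m => x m • stdVec m) Finset.univ
    have hu : ∀ y : E7, stdForm.toMultilinearMap.toLinearMap ![0, stdVec b, stdVec c] 0 y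
        = stdForm ![y, stdVec b, stdVec c] := by
      intro y
      change stdForm (Function.update _ _ _) = _
      congr 1
      ext i
      fin_cases i <;> rfl
    rw [hu] at h0
    rw [h0]
    refine Finset.sum_congr rfl fun m _ => ?_
    rw [map_smul, hu, stdForm_stdVec_three, smul_eq_mul]
  rwa [sum_smul_stdVec] at h

theorem act_stdForm_stdVec (B : E7 →L[ℝ] E7) (a b c : Fin 7) :
    act stdForm B ![stdVec a, stdVec b, stdVec c] = ∑ m, (B (stdVec a) m * (phi m b c : ℝ)
      + B (stdVec b) m * (phi a m c : ℝ) + B (stdVec c) m * (phi a b m : ℝ)) := by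
  rw [act_apply_three, lam_swap₁₂ _ (B (stdVec b)), lam_swap₂₃ _ _ (B (stdVec c)),
    lam_swap₁₂ _ (B (stdVec c)), stdForm_map_stdVec, stdForm_map_stdVec, stdForm_map_stdVec]
  rw [← Finset.sum_neg_distrib, neg_neg, ← Finset.sum_add_distrib, ← Finset.sum_add_distrib]
  refine Finset.sum_congr rfl fun m _ => ?_
  rw [phi_swap₁₂ a m c, ← phi_cyclic m a b]
  push_cast; ring

theorem act_actInv (η : Lam) : act stdForm (actInv η) = η := by
  refine lam_ext fun a b c hab hbc => ?_
  set f : Fin 7 → Fin 7 → Fin 7 → ℝ := fun i j k => η ![stdVec i, stdVec j, stdVec k] with hf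
  have h12 : ∀ i j k, f j i k = -f i j k := fun i j k => lam_swap₁₂ _ _ _ _
  have h23 : ∀ i j k, f i k j = -f i j k := fun i j k => lam_swap₂₃ _ _ _ _
  have hB : ∀ a m, actInv η (stdVec a) m = (36 : ℝ)⁻¹ * ∑ i, ∑ j, ∑ k,
      ((6 * kron a i * phi m j k + 3 * kron m i * phi a j k - kron m a * phi i j k : ℤ) : ℝ)
        * f i j k := by
    intro a m
    rw [actInv_apply]
    congr 1
    conv_rhs => rw [Finset.sum_comm]
    refine Finset.sum_congr rfl fun j _ => ?_
    conv_rhs => rw [Finset.sum_comm]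
    refine Finset.sum_congr rfl fun k _ => ?_
    push_cast
    simp only [sub_mul, add_mul, Finset.sum_add_distrib, Finset.sum_sub_distrib]
    congr 1
    · congr 1
      · simp [kron, hf]
      · simp [kron, hf]
    · rw [Finset.mul_sum]
      exact Finset.sum_congr rfl fun i _ => by ring
  have hsum : act stdForm (actInv η) ![stdVec a, stdVec b, stdVec c]
      = (36 : ℝ)⁻¹ * ∑ i, ∑ j, ∑ k, (actCoeff a b c i j k : ℝ) * f i j k := by
    rw [act_stdForm_stdVec]
    simp_rw [hB]
    simp only [mul_assoc, ← Finset.mul_sum, ← mul_add, Finset.sum_mul, ← Finset.sum_add_distrib]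
    congr 1
    rw [Finset.sum_comm]
    refine Finset.sum_congr rfl fun i _ => ?_
    rw [Finset.sum_comm]
    refine Finset.sum_congr rfl fun j _ => ?_
    rw [Finset.sum_comm]
    refine Finset.sum_congr rfl fun k _ => ?_
    -- The composite of right inverse and action is a kernel in `(i, j, k)`. The sum over `m` joins
    -- two factors `φ` in the first group of terms and is absorbed by a Kronecker symbol in the
    -- other two.
    have hc : actCoeff a b c i j k = ∑ m,
        ((6 * kron a i * phi m j k + 3 * kron m i * phi a j k - kron m a * phi i j k) * phi m b c
        + (6 * kron b i * phi m j k + 3 * kron m i * phi b j k - kron m b * phi i j k) * phi a m c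
        + (6 * kron c i * phi m j k + 3 * kron m i * phi c j k - kron m c * phi i j k)
          * phi a b m) := by
      rw [actCoeff, ← sum_phi_mul_phi, ← sum_phi_mul_phi, ← sum_phi_mul_phi]
      have k1 : ∀ (x : Fin 7) (F : Fin 7 → ℤ), ∑ m, kron m x * F m = F x := by
        intro x F; simp [kron]
      have e1 := k1 i fun m => 3 * phi a j k * phi m b c
      have e2 := k1 i fun m => 3 * phi b j k * phi a m c
      have e3 := k1 i fun m => 3 * phi c j k * phi a b m
      have e4 := k1 a fun m => phi i j k * phi m b c
      have e5 := k1 b fun m => phi i j k * phi a m c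
      have e6 := k1 c fun m => phi i j k * phi a b m
      have : 6 * (kron a i * ∑ m, phi j k m * phi m b c + kron b i * ∑ m, phi j k m * phi m c a
          + kron c i * ∑ m, phi j k m * phi m a b)
          = ∑ m, (6 * kron a i * phi m j k * phi m b c + 6 * kron b i * phi m j k * phi a m c
            + 6 * kron c i * phi m j k * phi a b m) := by
        simp only [Finset.mul_sum, ← Finset.sum_add_distrib]
        refine Finset.sum_congr rfl fun m _ => ?_
        rw [← phi_cyclic m j k, ← phi_cyclic a m c, ← phi_cyclic m a b]
        ring
      rw [this]
      rw [show 3 * (phi a j k * phi i b c + phi b j k * phi a i c + phi c j k * phi a b i)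
        = 3 * phi a j k * phi i b c + 3 * phi b j k * phi a i c + 3 * phi c j k * phi a b i by ring,
        show 3 * (phi i j k * phi a b c) = phi i j k * phi a b c + phi i j k * phi a b c
          + phi i j k * phi a b c by ring, ← e1, ← e2, ← e3]
      nth_rewrite 1 [← e4]
      nth_rewrite 1 [← e5]
      nth_rewrite 1 [← e6]
      simp only [← Finset.sum_add_distrib, ← Finset.sum_sub_distrib]
      exact Finset.sum_congr rfl fun m _ => by ring
    rw [hc]
    push_cast
    rw [Finset.sum_mul]
    exact Finset.sum_congr rfl fun m _ => by ring
  have halt := alternating_sum_eq f h12 h23 fun i j k => (actCoeff a b c i j k : ℝ)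
  have hrw : ∀ i j k, ((actCoeff a b c i j k : ℝ) - actCoeff a b c i k j - actCoeff a b c j i k
      + actCoeff a b c j k i + actCoeff a b c k i j - actCoeff a b c k j i)
      = ((36 * detKron i j k a b c : ℤ) : ℝ) := by
    intro i j k
    rw [← actCoeff_alt a b c hab hbc i j k]; push_cast; ring
  simp_rw [hrw] at halt
  have hdet : ∑ i, ∑ j, ∑ k, ((36 * detKron i j k a b c : ℤ) : ℝ) * f i j k
      = 36 * (6 * f a b c) := by
    have k1 : ∀ (x y z : Fin 7), ∑ i, ∑ j, ∑ k, (kron x i * kron y j * kron z k : ℝ) * f i j k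
        = f x y z := by
      intro x y z
      simp [kron]
    have e1 := k1 a b c
    have e2 : ∑ i, ∑ j, ∑ k, (kron a i * kron b k * kron c j : ℝ) * f i j k = -f a b c := by
      rw [← h23, ← k1 a c b]
      exact Finset.sum_congr rfl fun i _ => Finset.sum_congr rfl fun j _ =>
        Finset.sum_congr rfl fun k _ => by ring
    have e3 : ∑ i, ∑ j, ∑ k, (kron a j * kron b i * kron c k : ℝ) * f i j k = -f a b c := by
      rw [← h12, ← k1 b a c]
      exact Finset.sum_congr rfl fun i _ => Finset.sum_congr rfl fun j _ =>
        Finset.sum_congr rfl fun k _ => by ring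
    have e4 : ∑ i, ∑ j, ∑ k, (kron a j * kron b k * kron c i : ℝ) * f i j k = f a b c := by
      rw [show f a b c = f c a b by rw [h12 a c b, h23 a b c]; ring, ← k1 c a b]
      exact Finset.sum_congr rfl fun i _ => Finset.sum_congr rfl fun j _ =>
        Finset.sum_congr rfl fun k _ => by ring
    have e5 : ∑ i, ∑ j, ∑ k, (kron a k * kron b i * kron c j : ℝ) * f i j k = f a b c := by
      rw [show f a b c = f b c a by rw [h23 b a c, h12 a b c]; ring, ← k1 b c a]
      exact Finset.sum_congr rfl fun i _ => Finset.sum_congr rfl fun j _ =>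
        Finset.sum_congr rfl fun k _ => by ring
    have e6 : ∑ i, ∑ j, ∑ k, (kron a k * kron b j * kron c i : ℝ) * f i j k = -f a b c := by
      rw [show -f a b c = f c b a by rw [h12 b c a, h23 b a c, h12 a b c]; ring, ← k1 c b a]
      exact Finset.sum_congr rfl fun i _ => Finset.sum_congr rfl fun j _ =>
        Finset.sum_congr rfl fun k _ => by ring
    push_cast [detKron]
    simp only [mul_assoc, ← Finset.mul_sum]
    congr 1
    simp only [← mul_assoc, sub_mul, add_mul, Finset.sum_add_distrib, Finset.sum_sub_distrib]
    rw [e1, e2, e3, e4, e5, e6]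
    ring
  rw [hdet] at halt
  rw [hsum]
  change _ = f a b c
  linarith

end

/-! ### Smooth local coframes and the variation of the metric -/

section

attribute [local irreducible] stdForm actInv act

/-- The derivative of `A ↦ A^*φ` at the identity is the infinitesimal action, which `actInv` inverts
on the right. Restricting to the slice `1 + actInv η` thus gives a local diffeomorphism. -/
theorem fderiv_comp_one_add_actInv :
    HasFDerivAt (fun η : Lam => stdForm.compContinuousLinearMap
      (ContinuousLinearMap.id ℝ E7 + actInv η))
      ((ContinuousLinearEquiv.refl ℝ Lam : Lam ≃L[ℝ] Lam) : Lam →L[ℝ] Lam) 0 := by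
  have h1 : HasFDerivAt (fun _ : Lam => (stdForm : Lam)) (0 : Lam →L[ℝ] Lam) 0 :=
    hasFDerivAt_const _ _
  have h2 : HasFDerivAt (fun η : Lam => ContinuousLinearMap.id ℝ E7 + actInv η) actInv 0 :=
    actInv.hasFDerivAt.const_add _
  have h := h1.continuousAlternatingMapCompContinuousLinearMap h2
  convert! h using 1
  ext1 η
  simp only [map_zero, add_zero, ContinuousLinearMap.comp_zero, zero_add]
  have := act_actInv η
  rw [act] at this
  exact this.symm

theorem contDiff_comp_one_add_actInv :
    ContDiff ℝ ∞ (fun η : Lam => stdForm.compContinuousLinearMap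
      (ContinuousLinearMap.id ℝ E7 + actInv η)) :=
  contDiff_iff_contDiffAt.2 fun η => contDiffAt_lam_comp contDiffAt_const
    (contDiffAt_const.add actInv.contDiff.contDiffAt)

/-- Near a positive form there are coframes depending smoothly on the form. -/
theorem exists_local_coframe {σ₀ : Lam} (h : IsPositive σ₀) :
    ∃ A : Lam → E7 →L[ℝ] E7, ContDiffAt ℝ ∞ A σ₀ ∧
      ∀ᶠ σ in 𝓝 σ₀, ∃ e : E7 ≃L[ℝ] E7, (e : E7 →L[ℝ] E7) = A σ ∧
        stdForm.compContinuousLinearMap (e : E7 →L[ℝ] E7) = σ := by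
  obtain ⟨e₀, he₀⟩ := h
  have hC := contDiff_comp_one_add_actInv.contDiffAt (x := 0)
  have hn : (∞ : WithTop ℕ∞) ≠ 0 := by simp
  set Φ : Lam → Lam := fun η => stdForm.compContinuousLinearMap
      (ContinuousLinearMap.id ℝ E7 + actInv η) with hΦ
  have hΦ0 : Φ 0 = stdForm := by
    ext v
    simp only [hΦ, map_zero, add_zero]
    rfl
  -- The local inverse `G` gives coframes near `φ` itself; conjugation by a fixed coframe `e₀` of
  -- `σ₀` transports them to a neighbourhood of `σ₀`.
  set G := hC.localInverse fderiv_comp_one_add_actInv hn with hG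
  have hGs : ContDiffAt ℝ ∞ G (Φ 0) := hC.to_localInverse fderiv_comp_one_add_actInv hn
  have hstrict := hC.hasStrictFDerivAt' fderiv_comp_one_add_actInv hn
  have hGr : ∀ᶠ τ in 𝓝 (Φ 0), Φ (G τ) = τ := hstrict.eventually_right_inverse
  have hG0 : G (Φ 0) = 0 := hstrict.localInverse_apply_image
  rw [hΦ0] at hGs hGr hG0
  set P : Lam →L[ℝ] Lam :=
    ContinuousAlternatingMap.compContinuousLinearMapCLM (e₀.symm : E7 →L[ℝ] E7) with hP
  have hPσ : P σ₀ = stdForm := by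
    ext v
    rw [hP, ← he₀]
    change stdForm (fun a => e₀ (e₀.symm (v a))) = _
    simp
  set A : Lam → E7 →L[ℝ] E7 := fun σ =>
    (ContinuousLinearMap.id ℝ E7 + actInv (G (P σ))).comp (e₀ : E7 →L[ℝ] E7) with hA
  have hAs : ContDiffAt ℝ ∞ A σ₀ := by
    have h1 : ContDiffAt ℝ ∞ (fun σ => G (P σ)) σ₀ := by
      refine ContDiffAt.comp σ₀ (g := G) (f := P) ?_ P.contDiff.contDiffAt
      rw [hPσ]; exact hGs
    exact (contDiffAt_const.add (actInv.contDiff.contDiffAt.comp σ₀ h1)).clm_comp contDiffAt_const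
  have hA0 : A σ₀ = (e₀ : E7 →L[ℝ] E7) := by
    simp only [hA, hPσ, hG0, map_zero, add_zero]
    rfl
  refine ⟨A, hAs, ?_⟩
  have hinv : ∀ᶠ σ in 𝓝 σ₀, A σ ∈ range ((↑) : (E7 ≃L[ℝ] E7) → E7 →L[ℝ] E7) := by
    refine hAs.continuousAt.eventually ?_
    rw [hA0]
    exact ContinuousLinearEquiv.nhds e₀
  have hev : ∀ᶠ σ in 𝓝 σ₀, Φ (G (P σ)) = P σ := by
    refine P.continuous.continuousAt.eventually (p := fun τ => Φ (G τ) = τ) ?_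
    rw [hPσ]; exact hGr
  filter_upwards [hinv, hev] with σ ⟨e, he⟩ hσ
  refine ⟨e, he, ?_⟩
  rw [he]
  ext v
  have h2 := DFunLike.congr_fun hσ (fun a => e₀ (v a))
  refine h2.trans ?_
  change σ (fun a => e₀.symm (e₀ (v a))) = _
  simp

theorem isOpen_isPositive : IsOpen {σ : Lam | IsPositive σ} := by
  refine isOpen_iff_mem_nhds.2 fun σ₀ h => ?_
  obtain ⟨A, -, hA⟩ := exists_local_coframe h
  filter_upwards [hA] with σ hσ
  obtain ⟨e, -, he⟩ := hσ
  exact ⟨e, he⟩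

theorem contDiffAt_metric {σ₀ : Lam} (h : IsPositive σ₀) (u v : E7) :
    ContDiffAt ℝ ∞ (fun σ : Lam => metric σ u v) σ₀ := by
  obtain ⟨A, hA, hev⟩ := exists_local_coframe h
  have : (fun σ : Lam => metric σ u v) =ᶠ[𝓝 σ₀] fun σ => inner ℝ (A σ u) (A σ v) := by
    filter_upwards [hev] with σ ⟨e, heA, he⟩
    rw [metric_eq_inner e he, ← heA]
    rfl
  exact ((hA.clm_apply contDiffAt_const).inner ℝ
    (hA.clm_apply contDiffAt_const)).congr_of_eventuallyEq this

open Classical in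
/-- The inner product of a positive form as a bilinear form. -/
def metricForm (σ : Lam) : E7 →ₗ[ℝ] E7 →ₗ[ℝ] ℝ :=
  if h : IsPositive σ then
    (innerₗ E7).compl₁₂ (h.choose : E7 →L[ℝ] E7).toLinearMap (h.choose : E7 →L[ℝ] E7).toLinearMap
  else 0

theorem metricForm_apply (σ : Lam) (u v : E7) : metricForm σ u v = metric σ u v := by
  rw [metricForm, metric]
  split_ifs <;> rfl

theorem metric_comm (σ : Lam) (u v : E7) : metric σ u v = metric σ v u := by
  rw [metric, metric]
  split_ifs
  · exact real_inner_comm _ _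
  · rfl

theorem metric_add_left (σ : Lam) (u v w : E7) :
    metric σ (u + v) w = metric σ u w + metric σ v w := by
  simp only [← metricForm_apply, map_add, LinearMap.add_apply]

theorem metric_sub_left (σ : Lam) (u v w : E7) :
    metric σ (u - v) w = metric σ u w - metric σ v w := by
  simp only [← metricForm_apply, map_sub, LinearMap.sub_apply]

theorem eq_of_metric_eq {σ : Lam} (h : IsPositive σ) {u v : E7}
    (huv : ∀ w, metric σ u w = metric σ v w) : u = v := by
  obtain ⟨e, he⟩ := h
  have := huv (u - v)
  rw [← sub_eq_zero, ← metric_sub_left, metric_eq_inner e he, inner_self_eq_zero,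
    map_eq_zero_iff e e.injective] at this
  exact sub_eq_zero.1 this

/-- Equivariance: pulling back along `D` conjugates the acting endomorphism. -/
theorem act_comp (σ : Lam) (D B B' : E7 →L[ℝ] E7) (h : B'.comp D = D.comp B) :
    act (σ.compContinuousLinearMap D) B = (act σ B').compContinuousLinearMap D := by
  ext v
  rw [act_apply]
  change _ = act σ B' (fun a => D (v a))
  rw [act_apply]
  refine Finset.sum_congr rfl fun a _ => congrArg σ (funext fun b => ?_)
  by_cases hb : b = a
  · subst hb
    simpa using (DFunLike.congr_fun h (v b)).symm
  · simp [hb]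

/-- Each 3-form is obtained from a positive form `σ` by the infinitesimal action of an endomorphism,
which may be chosen to depend linearly on it, and which also describes the variation of the
metric. -/
theorem exists_act_eq {σ : Lam} (h : IsPositive σ) :
    ∃ a : Lam →L[ℝ] E7 →L[ℝ] E7, (∀ q, act σ (a q) = q) ∧
      ∀ q v w, fderiv ℝ (fun s : Lam => metric s v w) σ q
        = metric σ (a q v) w + metric σ v (a q w) := by
  obtain ⟨A, hA, hev⟩ := exists_local_coframe h
  obtain ⟨e, heA, he⟩ := hev.self_of_nhds
  have hd : HasFDerivAt A (fderiv ℝ A σ) σ := (hA.differentiableAt (by simp)).hasFDerivAt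
  -- The logarithmic derivative `A⁻¹ dA` of a smooth coframe. Differentiating `A(s)^*φ = s` gives
  -- the first property, and differentiating `g_s(v, w) = ⟨A(s)v, A(s)w⟩` gives the second.
  refine ⟨(ContinuousLinearMap.compL ℝ E7 E7 E7 (e.symm : E7 →L[ℝ] E7)).comp (fderiv ℝ A σ),
    fun q => ?_, fun q v w => ?_⟩
  · have h1 : HasFDerivAt (fun _ : Lam => (stdForm : Lam)) (0 : Lam →L[ℝ] Lam) σ :=
      hasFDerivAt_const _ _
    have h2 := h1.continuousAlternatingMapCompContinuousLinearMap hd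
    have h3 : (fun s : Lam => stdForm.compContinuousLinearMap (A s)) =ᶠ[𝓝 σ] id := by
      filter_upwards [hev] with s ⟨e, heA, he⟩
      rw [← heA, he]; rfl
    have h4 := (h2.congr_of_eventuallyEq h3.symm).unique (hasFDerivAt_id σ)
    have h5 := DFunLike.congr_fun h4 q
    simp only [ContinuousLinearMap.comp_zero, zero_add] at h5
    have h6 := fderivComp_eq_act stdForm (A σ) (fderiv ℝ A σ q) e heA
    rw [← heA, he] at h6
    rw [← heA] at h5
    exact h6.symm.trans h5
  · have h3 : (fun s : Lam => metric s v w) =ᶠ[𝓝 σ] fun s => inner ℝ (A s v) (A s w) := by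
      filter_upwards [hev] with s ⟨e, heA, he⟩
      rw [metric_eq_inner e he, ← heA]
      rfl
    have hv : HasFDerivAt (fun s => A s v) ((fderiv ℝ A σ).flip v) σ := by
      simpa using hd.clm_apply (hasFDerivAt_const v σ)
    have hw : HasFDerivAt (fun s => A s w) ((fderiv ℝ A σ).flip w) σ := by
      simpa using hd.clm_apply (hasFDerivAt_const w σ)
    rw [h3.fderiv_eq, (hv.inner ℝ hw).fderiv]
    simp only [ContinuousLinearMap.comp_apply, ContinuousLinearMap.prod_apply,
      fderivInnerCLM_apply, ContinuousLinearMap.flip_apply]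
    rw [metric_eq_inner e he, metric_eq_inner e he, ← heA]
    simp [add_comm]

/-! ### The volume density -/

/-- The Gram matrix of the metric of a 3-form in the standard basis. -/
def gramMatrix (σ : Lam) : Matrix (Fin 7) (Fin 7) ℝ :=
  Matrix.of fun i j => metric σ (stdVec i) (stdVec j)

/-- The volume density of the metric of a 3-form. -/
def volDensity (σ : Lam) : ℝ := Real.sqrt (gramMatrix σ).det

/-- The matrix of an endomorphism of `ℝ⁷`. -/
def mat (D : E7 →L[ℝ] E7) : Matrix (Fin 7) (Fin 7) ℝ := Matrix.of fun i j => D (stdVec j) i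

theorem mat_eq_toMatrix (D : E7 →L[ℝ] E7) :
    mat D = LinearMap.toMatrix (EuclideanSpace.basisFun (Fin 7) ℝ).toBasis
      (EuclideanSpace.basisFun (Fin 7) ℝ).toBasis D.toLinearMap := by
  ext i j
  simp [mat, LinearMap.toMatrix_apply]

theorem mat_comp (D D' : E7 →L[ℝ] E7) : mat (D.comp D') = mat D * mat D' := by
  simp only [mat_eq_toMatrix]
  rw [← LinearMap.toMatrix_comp, ContinuousLinearMap.toLinearMap_comp]

theorem det_mat (D : E7 →L[ℝ] E7) : (mat D).det = D.det := by
  rw [mat_eq_toMatrix, LinearMap.det_toMatrix]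

theorem gramMatrix_eq (e : E7 ≃L[ℝ] E7) {σ : Lam}
    (he : stdForm.compContinuousLinearMap (e : E7 →L[ℝ] E7) = σ) :
    gramMatrix σ = (mat e).transpose * mat e := by
  ext i j
  rw [gramMatrix, Matrix.of_apply, metric_eq_inner e he, inner_eq_dotProduct, Matrix.mul_apply]
  rfl

theorem det_gramMatrix_eq (e : E7 ≃L[ℝ] E7) {σ : Lam}
    (he : stdForm.compContinuousLinearMap (e : E7 →L[ℝ] E7) = σ) :
    (gramMatrix σ).det = (e : E7 →L[ℝ] E7).det ^ 2 := by
  rw [gramMatrix_eq e he, Matrix.det_mul, Matrix.det_transpose, det_mat, sq]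

theorem volDensity_eq (e : E7 ≃L[ℝ] E7) {σ : Lam}
    (he : stdForm.compContinuousLinearMap (e : E7 →L[ℝ] E7) = σ) :
    volDensity σ = |(e : E7 →L[ℝ] E7).det| := by
  rw [volDensity, det_gramMatrix_eq e he, Real.sqrt_sq_eq_abs]

theorem det_equiv_ne_zero (e : E7 ≃L[ℝ] E7) : (e : E7 →L[ℝ] E7).det ≠ 0 :=
  (LinearEquiv.isUnit_det' e.toLinearEquiv).ne_zero

theorem det_gramMatrix_pos {σ : Lam} (h : IsPositive σ) : 0 < (gramMatrix σ).det := by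
  obtain ⟨e, he⟩ := h
  rw [det_gramMatrix_eq e he]
  exact (sq_pos_of_ne_zero (det_equiv_ne_zero e))

theorem volDensity_pos {σ : Lam} (h : IsPositive σ) : 0 < volDensity σ :=
  Real.sqrt_pos.2 (det_gramMatrix_pos h)

theorem contDiffAt_det_gramMatrix {σ : Lam} (h : IsPositive σ) :
    ContDiffAt ℝ ∞ (fun s => (gramMatrix s).det) σ := by
  simp only [Matrix.det_apply]
  refine ContDiffAt.sum fun p _ => ContDiffAt.const_smul _ ?_
  exact contDiffAt_prod fun i _ => contDiffAt_metric h _ _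

theorem contDiffAt_volDensity {σ : Lam} (h : IsPositive σ) : ContDiffAt ℝ ∞ volDensity σ :=
  (contDiffAt_det_gramMatrix h).sqrt (det_gramMatrix_pos h).ne'

theorem volDensity_comp {σ : Lam} (h : IsPositive σ) (D : E7 ≃L[ℝ] E7) :
    volDensity (σ.compContinuousLinearMap (D : E7 →L[ℝ] E7))
      = |(D : E7 →L[ℝ] E7).det| * volDensity σ := by
  obtain ⟨e, he⟩ := h
  rw [volDensity_eq e he, volDensity_eq (D.trans e) (by rw [← he]; rfl), ← abs_mul]
  congr 1
  rw [← det_mat, ← det_mat, ← det_mat, mul_comm, ← Matrix.det_mul, ← mat_comp]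
  rfl

theorem volDensity_smul {σ : Lam} (h : IsPositive σ) {μ : ℝ} (hμ : 0 < μ) :
    volDensity (μ ^ 3 • σ) = μ ^ 7 * volDensity σ := by
  rw [volDensity, volDensity]
  have : gramMatrix (μ ^ 3 • σ) = μ ^ 2 • gramMatrix σ := by
    ext i j
    simp [gramMatrix, metric_smul h hμ.ne']
  rw [this, Matrix.det_smul, Fintype.card_fin, ← pow_mul, Real.sqrt_mul (by positivity),
    show μ ^ (2 * 7) = (μ ^ 7) ^ 2 by ring, Real.sqrt_sq (by positivity)]

/-- Since `∑ φ_{mbc} φ_{abc} = 6 δ_{ma}`, each of the three slots contributes `6 tr B`; division by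
`3!` leaves `3 tr B`. -/
theorem formInner_act_self {σ : Lam} (h : IsPositive σ) (B : E7 →L[ℝ] E7) :
    formInner σ (act σ B) σ = 3 * (mat B).trace := by
  obtain ⟨e, he⟩ := h
  set B' : E7 →L[ℝ] E7 := (e : E7 →L[ℝ] E7).comp (B.comp (e.symm : E7 →L[ℝ] E7)) with hB'
  have hconj : B'.comp (e : E7 →L[ℝ] E7) = (e : E7 →L[ℝ] E7).comp B := by
    ext1 x; simp [hB']
  have htr : (mat B).trace = ∑ m, B' (stdVec m) m := by
    have h1 : (mat B').trace = (mat B).trace := by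
      rw [hB', mat_comp, Matrix.trace_mul_comm, mat_comp, Matrix.mul_assoc, ← mat_comp]
      have : (e.symm : E7 →L[ℝ] E7).comp (e : E7 →L[ℝ] E7) = ContinuousLinearMap.id ℝ E7 := by
        ext1 x; simp
      rw [this, ← mat_comp, ContinuousLinearMap.comp_id]
    rw [← h1]; rfl
  have hin := formInner_eq_sum e he (act σ B).toMultilinearMap σ.toMultilinearMap
  refine hin.trans ?_
  rw [sum_fin_three_fun]
  have hs : ∀ a b c : Fin 7, σ.toMultilinearMap (fun i => e.symm (stdVec (![a, b, c] i)))
      = (phi a b c : ℝ) := by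
    intro a b c
    rw [← stdForm_stdVec_three]
    change σ _ = _
    rw [← he]
    change stdForm (fun i => e (e.symm (stdVec (![a, b, c] i)))) = _
    congr 1
    ext1 i
    fin_cases i <;> simp
  have hq : ∀ a b c : Fin 7, (act σ B).toMultilinearMap (fun i => e.symm (stdVec (![a, b, c] i)))
      = ∑ m, (B' (stdVec a) m * (phi m b c : ℝ)
      + B' (stdVec b) m * (phi a m c : ℝ) + B' (stdVec c) m * (phi a b m : ℝ)) := by
    intro a b c
    rw [← act_stdForm_stdVec]
    change act σ B _ = _
    rw [← he, act_comp stdForm e B B' hconj]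
    change act stdForm B' (fun i => e (e.symm (stdVec (![a, b, c] i)))) = _
    congr 1
    ext1 i
    fin_cases i <;> simp
  simp_rw [hs, hq]
  have hphi : ∀ a m : Fin 7, ∑ b, ∑ c, (phi m b c : ℝ) * phi a b c = 6 * kron m a := by
    intro a m
    exact_mod_cast sum_phi_phi m a
  have key : ∀ x : Fin 7 → Fin 7 → ℝ,
      ∑ a, ∑ b, ∑ c, (∑ m, x a m * (phi m b c : ℝ)) * (phi a b c : ℝ) = 6 * ∑ m, x m m := by
    intro x
    rw [Finset.mul_sum]
    refine Finset.sum_congr rfl fun a _ => ?_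
    have : ∑ b, ∑ c, (∑ m, x a m * (phi m b c : ℝ)) * (phi a b c : ℝ)
        = ∑ m, x a m * ∑ b, ∑ c, (phi m b c : ℝ) * phi a b c := by
      simp only [Finset.sum_mul, Finset.mul_sum]
      rw [Finset.sum_comm]
      conv_rhs => rw [Finset.sum_comm]
      conv_rhs => enter [2, b]; rw [Finset.sum_comm]
      rw [Finset.sum_comm]
      exact Finset.sum_congr rfl fun b _ => Finset.sum_congr rfl fun c _ =>
        Finset.sum_congr rfl fun m _ => by ring
    rw [this]
    simp_rw [hphi]
    simp [kron]; ring
  have k1 := key fun a m => B' (stdVec a) m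
  have k2 : ∑ a, ∑ b, ∑ c, (∑ m, B' (stdVec b) m * (phi a m c : ℝ)) * (phi a b c : ℝ)
      = 6 * ∑ m, B' (stdVec m) m := by
    rw [← k1, Finset.sum_comm]
    refine Finset.sum_congr rfl fun a _ => Finset.sum_congr rfl fun b _ =>
      Finset.sum_congr rfl fun c _ => ?_
    rw [phi_swap₁₂ a b c]
    simp_rw [phi_swap₁₂ _ b c]
    push_cast
    simp [Finset.sum_neg_distrib]
  have k3 : ∑ a, ∑ b, ∑ c, (∑ m, B' (stdVec c) m * (phi a b m : ℝ)) * (phi a b c : ℝ)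
      = 6 * ∑ m, B' (stdVec m) m := by
    rw [← k2]
    refine Finset.sum_congr rfl fun a _ => ?_
    rw [Finset.sum_comm]
    refine Finset.sum_congr rfl fun b _ => Finset.sum_congr rfl fun c _ => ?_
    rw [phi_swap₂₃ a b c]
    simp_rw [phi_swap₂₃ a _ c]
    push_cast
    simp [Finset.sum_neg_distrib]
  simp only [Finset.sum_add_distrib, add_mul]
  rw [k1, k2, k3, htr]
  norm_num [Nat.factorial]
  ring

theorem hasDerivAt_comp_id_add (σ : Lam) (B : E7 →L[ℝ] E7) :
    HasDerivAt (fun s : ℝ => σ.compContinuousLinearMap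
      (ContinuousLinearMap.id ℝ E7 + s • B)) (act σ B) 0 := by
  have hlin : HasDerivAt (fun s : ℝ => ContinuousLinearMap.id ℝ E7 + s • B) B 0 := by
    simpa using ((hasDerivAt_id (0 : ℝ)).smul_const B).const_add (ContinuousLinearMap.id ℝ E7)
  have h1 : HasFDerivAt (fun _ : ℝ => σ) (0 : ℝ →L[ℝ] Lam) 0 := hasFDerivAt_const _ _
  have h2 := (h1.continuousAlternatingMapCompContinuousLinearMap hlin.hasFDerivAt).hasDerivAt
  have h3 : ContinuousLinearMap.id ℝ E7 + (0 : ℝ) • B = ContinuousLinearMap.id ℝ E7 := by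
    rw [zero_smul ℝ B, add_zero]
  rw [h3] at h2
  rw [act]
  simpa using h2

/-- The first variation of the volume density. -/
theorem fderiv_volDensity {σ : Lam} (h : IsPositive σ) (q : Lam) :
    fderiv ℝ volDensity σ q = 1 / 3 * formInner σ q σ * volDensity σ := by
  obtain ⟨a, ha, -⟩ := exists_act_eq h
  set B := a q with hB
  have hq : act σ B = q := ha q
  -- The direction `q` is realised by the curve `(1 + sB)^*σ`, along which the density is exactly
  -- `det(1 + sB)` times its initial value for small `s`. The derivative is therefore `tr B`, which
  -- is `(1/3)⟨q, σ⟩`.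
  have hcurve := hasDerivAt_comp_id_add σ B
  rw [hq] at hcurve
  have h0 : σ.compContinuousLinearMap (ContinuousLinearMap.id ℝ E7 + (0 : ℝ) • B) = σ := by
    ext v; simp
  have hvd : HasFDerivAt volDensity (fderiv ℝ volDensity σ)
      (σ.compContinuousLinearMap (ContinuousLinearMap.id ℝ E7 + (0 : ℝ) • B)) := by
    rw [h0]
    exact ((contDiffAt_volDensity h).differentiableAt (by simp)).hasFDerivAt
  have hchain := hvd.comp_hasDerivAt (0 : ℝ) hcurve
  have hdet : ∀ s : ℝ, (ContinuousLinearMap.id ℝ E7 + s • B).det = (1 + s • mat B).det := by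
    intro s
    rw [← det_mat]
    congr 1
    ext i j
    simp [mat, Matrix.one_apply, Pi.single_apply]
  have hpoly : HasDerivAt (fun s : ℝ => (1 + s • mat B).det) (mat B).trace 0 := by
    set P := (1 + (Polynomial.X : Polynomial ℝ) • (mat B).map Polynomial.C).det with hP
    have hPe : ∀ s : ℝ, (1 + s • mat B).det = P.eval s := by
      intro s
      rw [hP, ← Polynomial.coe_evalRingHom, RingHom.map_det]
      congr 1
      ext i j
      simp [Matrix.one_apply, apply_ite (Polynomial.eval s), mul_comm s (mat B i j)]
    simp_rw [hPe]
    rw [← Matrix.derivative_det_one_add_X_smul]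
    exact P.hasDerivAt 0
  have hpos : ∀ᶠ s : ℝ in 𝓝 0, 0 < (1 + s • mat B).det := by
    refine hpoly.continuousAt.eventually (lt_mem_nhds ?_)
    simp
  have heq : (volDensity ∘ fun s : ℝ => σ.compContinuousLinearMap
      (ContinuousLinearMap.id ℝ E7 + s • B)) =ᶠ[𝓝 0]
      fun s => (1 + s • mat B).det * volDensity σ := by
    filter_upwards [hpos] with s hs
    have hu : IsUnit (ContinuousLinearMap.id ℝ E7 + s • B).det := by
      rw [hdet]; exact hs.ne'.isUnit
    set D := (ContinuousLinearMap.id ℝ E7 + s • B).toContinuousLinearEquivOfDetNeZero hu.ne_zero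
    have hD : (D : E7 →L[ℝ] E7) = ContinuousLinearMap.id ℝ E7 + s • B := by
      ext1 x; rfl
    rw [Function.comp_apply, ← hD, volDensity_comp h, hD, hdet, abs_of_pos hs]
  have h3 := (hchain.congr_of_eventuallyEq heq.symm).unique (hpoly.mul_const (volDensity σ))
  rw [h3, ← hq, formInner_act_self h]
  ring

end

section

attribute [local irreducible] stdForm actInv act

/-! ### The Levi-Civita connection as a function of the 1-jet of a positive form -/

/-- The derivative of `g_σ(v, w)` with respect to `σ`. -/
def metricDeriv (σ q : Lam) (v w : E7) : ℝ := fderiv ℝ (fun s : Lam => metric s v w) σ q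

theorem metricDeriv_comm (σ q : Lam) (v w : E7) : metricDeriv σ q v w = metricDeriv σ q w v := by
  simp only [metricDeriv, metric_comm _ v w]

theorem metricDeriv_add (σ q q' : Lam) (v w : E7) :
    metricDeriv σ (q + q') v w = metricDeriv σ q v w + metricDeriv σ q' v w := by
  simp only [metricDeriv, map_add]

theorem hasFDerivAt_metric {σ : Lam} (h : IsPositive σ) (v w : E7) :
    HasFDerivAt (fun s : Lam => metric s v w) (fderiv ℝ (fun s : Lam => metric s v w) σ) σ :=
  ((contDiffAt_metric h v w).differentiableAt (by simp)).hasFDerivAt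

/-- Derivative of the naturality `metric_comp`, which holds in a neighbourhood because positivity is
an open condition. -/
theorem metricDeriv_comp {σ : Lam} (h : IsPositive σ) (T : E7 ≃L[ℝ] E7) (q : Lam) (v w : E7) :
    metricDeriv (σ.compContinuousLinearMap (T : E7 →L[ℝ] E7))
      (q.compContinuousLinearMap (T : E7 →L[ℝ] E7)) v w = metricDeriv σ q (T v) (T w) := by
  set P : Lam →L[ℝ] Lam :=
    ContinuousAlternatingMap.compContinuousLinearMapCLM (T : E7 →L[ℝ] E7) with hP
  have h1 := (hasFDerivAt_metric (h.comp T) v w).comp (f := P) σ P.hasFDerivAt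
  have h2 : (fun s : Lam => metric s (T v) (T w)) =ᶠ[𝓝 σ] (fun s : Lam => metric s v w) ∘ P := by
    filter_upwards [isOpen_isPositive.mem_nhds h] with s hs
    exact (metric_comp hs T v w).symm
  exact (DFunLike.congr_fun ((h1.congr_of_eventuallyEq h2).fderiv) q).symm

theorem metricDeriv_act {σ : Lam} (h : IsPositive σ) (B : E7 →L[ℝ] E7) (v w : E7) :
    metricDeriv σ (act σ B) v w = metric σ (B v) w + metric σ v (B w) := by
  obtain ⟨e, he⟩ := h
  have hc := hasDerivAt_comp_id_add σ B
  have h0 : σ.compContinuousLinearMap (ContinuousLinearMap.id ℝ E7 + (0 : ℝ) • B) = σ := by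
    ext v; simp
  have hm : HasFDerivAt (fun s : Lam => metric s v w) (fderiv ℝ (fun s : Lam => metric s v w) σ)
      (σ.compContinuousLinearMap (ContinuousLinearMap.id ℝ E7 + (0 : ℝ) • B)) := by
    rw [h0]; exact hasFDerivAt_metric ⟨e, he⟩ v w
  have h1 := hm.comp_hasDerivAt (0 : ℝ) hc
  have hev : ∀ᶠ s : ℝ in 𝓝 0, ContinuousLinearMap.id ℝ E7 + s • B
      ∈ range ((↑) : (E7 ≃L[ℝ] E7) → E7 →L[ℝ] E7) := by
    have hcont : Continuous fun s : ℝ => ContinuousLinearMap.id ℝ E7 + s • B := by fun_prop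
    refine hcont.continuousAt.eventually ?_
    beta_reduce
    have h3 : ContinuousLinearMap.id ℝ E7 + (0 : ℝ) • B
        = ((ContinuousLinearEquiv.refl ℝ E7 : E7 ≃L[ℝ] E7) : E7 →L[ℝ] E7) := by
      rw [zero_smul ℝ B, add_zero]; rfl
    rw [h3]
    exact ContinuousLinearEquiv.nhds _
  have h2 : (fun s : ℝ => (inner ℝ (e (v + s • B v)) (e (w + s • B w)) : ℝ)) =ᶠ[𝓝 0]
      (fun s : Lam => metric s v w) ∘ fun s : ℝ => σ.compContinuousLinearMap
        (ContinuousLinearMap.id ℝ E7 + s • B) := by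
    filter_upwards [hev] with s ⟨D, hD⟩
    rw [Function.comp_apply, ← hD, metric_comp ⟨e, he⟩, metric_eq_inner e he]
    have : ∀ x, D x = x + s • B x := fun x => by
      have := DFunLike.congr_fun hD x
      simpa using this
    rw [this, this]
  have hlin : ∀ x : E7, HasDerivAt (fun s : ℝ => e (x + s • B x)) (e (B x)) 0 := by
    intro x
    have : HasDerivAt (fun s : ℝ => e x + s • e (B x)) (e (B x)) 0 := by
      simpa using ((hasDerivAt_id (0 : ℝ)).smul_const (e (B x))).const_add (e x)
    simpa using this
  have h3 := (hlin v).inner ℝ (hlin w)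
  have h4 := (h1.congr_of_eventuallyEq h2).unique h3
  rw [metricDeriv, h4, metric_eq_inner e he, metric_eq_inner e he]
  simp [add_comm]

/-- The Christoffel symbols of the metric of a field of positive 3-forms with value `σ` and
derivative `p`. -/
def chr (σ : Lam) (p : E7 →L[ℝ] Lam) (k i j : Fin 7) : ℝ :=
  (1 / 2) * ∑ l, (gramMatrix σ)⁻¹ k l *
    (metricDeriv σ (p (stdVec i)) (stdVec j) (stdVec l)
      + metricDeriv σ (p (stdVec j)) (stdVec i) (stdVec l)
      - metricDeriv σ (p (stdVec l)) (stdVec i) (stdVec j))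

/-- The bilinear map given by the Christoffel symbols. -/
def chrMap (σ : Lam) (p : E7 →L[ℝ] Lam) : E7 →L[ℝ] E7 →L[ℝ] E7 :=
  ∑ k : Fin 7, ∑ i : Fin 7, ∑ j : Fin 7, chr σ p k i j •
    (EuclideanSpace.proj (𝕜 := ℝ) i : E7 →L[ℝ] ℝ).smulRight
      ((EuclideanSpace.proj (𝕜 := ℝ) j : E7 →L[ℝ] ℝ).smulRight (stdVec k))

theorem chrMap_apply (σ : Lam) (p : E7 →L[ℝ] Lam) (u v : E7) :
    chrMap σ p u v = ∑ k, (∑ i, ∑ j, u i * v j * chr σ p k i j) • stdVec k := by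
  simp only [chrMap, ContinuousLinearMap.sum_apply, ContinuousLinearMap.smul_apply,
    ContinuousLinearMap.smulRight_apply, PiLp.proj_apply, Finset.sum_smul]
  refine Finset.sum_congr rfl fun k _ => Finset.sum_congr rfl fun i _ =>
    Finset.sum_congr rfl fun j _ => ?_
  simp only [smul_smul]
  congr 1; ring

theorem linear_eq_sum (f : E7 →ₗ[ℝ] ℝ) (x : E7) : f x = ∑ i, x i * f (stdVec i) := by
  conv_lhs => rw [← sum_smul_stdVec x]
  simp only [map_sum, map_smul, smul_eq_mul]

theorem trilinear_eq_sum (D : E7 →ₗ[ℝ] E7 →ₗ[ℝ] E7 →ₗ[ℝ] ℝ) (x y z : E7) :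
    D x y z = ∑ i, x i * ∑ j, y j * ∑ l, z l * D (stdVec i) (stdVec j) (stdVec l) := by
  refine (linear_eq_sum (LinearMap.applyₗ z ∘ₗ LinearMap.applyₗ y ∘ₗ D) x).trans ?_
  refine Finset.sum_congr rfl fun i _ => congrArg _ ?_
  refine (linear_eq_sum (LinearMap.applyₗ z ∘ₗ D (stdVec i)) y).trans ?_
  refine Finset.sum_congr rfl fun j _ => congrArg _ ?_
  exact linear_eq_sum (D (stdVec i) (stdVec j)) z

/-- `(u, v, w) ↦ ∂_u g(v, w)` as a trilinear form. -/
theorem exists_trilinear_metricDeriv {σ : Lam} (h : IsPositive σ) (p : E7 →L[ℝ] Lam) :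
    ∃ D : E7 →ₗ[ℝ] E7 →ₗ[ℝ] E7 →ₗ[ℝ] ℝ, ∀ u v w, D u v w = metricDeriv σ (p u) v w := by
  obtain ⟨a, -, ha⟩ := exists_act_eq h
  refine ⟨LinearMap.mk₂ ℝ (fun u v => metricForm σ (a (p u) v) + (metricForm σ v).comp
    (a (p u)).toLinearMap) ?_ ?_ ?_ ?_, fun u v w => ?_⟩
  · intro u u' v; ext w; simp; ring
  · intro c u v; ext w; simp
  · intro u v v'; ext w; simp; ring
  · intro c u v; ext w; simp
  · rw [metricDeriv, ha, LinearMap.mk₂_apply, LinearMap.add_apply, LinearMap.comp_apply,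
      metricForm_apply, metricForm_apply]
    rfl

theorem isUnit_det_gramMatrix {σ : Lam} (h : IsPositive σ) : IsUnit (gramMatrix σ).det :=
  (det_gramMatrix_pos h).ne'.isUnit

/-- The Koszul formula. -/
theorem metric_chrMap {σ : Lam} (h : IsPositive σ) (p : E7 →L[ℝ] Lam) (u v w : E7) :
    2 * metric σ (chrMap σ p u v) w
      = metricDeriv σ (p u) v w + metricDeriv σ (p v) u w - metricDeriv σ (p w) u v := by
  obtain ⟨D, hD⟩ := exists_trilinear_metricDeriv h p
  have hL : ∃ L : E7 →ₗ[ℝ] E7 →ₗ[ℝ] E7 →ₗ[ℝ] ℝ, ∀ u v w, L u v w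
      = 2 * metric σ (chrMap σ p u v) w := by
    refine ⟨LinearMap.mk₂ ℝ (fun u v => (2 : ℝ) • metricForm σ (chrMap σ p u v)) ?_ ?_ ?_ ?_,
      fun u v w => ?_⟩
    · intro u u' v; ext w; simp
    · intro c u v; ext w; simp; ring
    · intro u v v'; ext w; simp
    · intro c u v; ext w; simp; ring
    · rw [← metricForm_apply]; rfl
  obtain ⟨L, hL⟩ := hL
  have hR : ∃ R : E7 →ₗ[ℝ] E7 →ₗ[ℝ] E7 →ₗ[ℝ] ℝ, ∀ u v w, R u v w
      = D u v w + D v u w - D w u v := by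
    refine ⟨LinearMap.mk₂ ℝ (fun u v => D u v + D v u - (LinearMap.applyₗ v ∘ₗ
      LinearMap.applyₗ u ∘ₗ D)) ?_ ?_ ?_ ?_, fun u v w => rfl⟩
    · intro u u' v; ext w; simp; ring
    · intro c u v; ext w; simp; ring
    · intro u v v'; ext w; simp; ring
    · intro c u v; ext w; simp; ring
  obtain ⟨R, hR⟩ := hR
  rw [← hL, ← hD, ← hD, ← hD, ← hR, trilinear_eq_sum L, trilinear_eq_sum R]
  refine Finset.sum_congr rfl fun i _ => congrArg _ (Finset.sum_congr rfl fun j _ =>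
    congrArg _ (Finset.sum_congr rfl fun l _ => congrArg _ ?_))
  rw [hL, hR, hD, hD, hD]
  have hc : chrMap σ p (stdVec i) (stdVec j) = ∑ k, chr σ p k i j • stdVec k := by
    rw [chrMap_apply]
    refine Finset.sum_congr rfl fun k _ => ?_
    simp [Pi.single_apply]
  have hm : metric σ (∑ k, chr σ p k i j • stdVec k) (stdVec l)
      = ∑ k, chr σ p k i j * gramMatrix σ k l := by
    rw [← metricForm_apply]
    simp only [map_sum, map_smul, LinearMap.sum_apply, LinearMap.smul_apply, smul_eq_mul,
      metricForm_apply]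
    rfl
  rw [hc, hm]
  simp only [chr]
  set X : Fin 7 → ℝ := fun l => metricDeriv σ (p (stdVec i)) (stdVec j) (stdVec l)
      + metricDeriv σ (p (stdVec j)) (stdVec i) (stdVec l)
      - metricDeriv σ (p (stdVec l)) (stdVec i) (stdVec j) with hX
  have hsymm : ∀ a b, gramMatrix σ a b = gramMatrix σ b a := fun a b => metric_comm _ _ _
  have hinv : ∀ a, ∑ k, gramMatrix σ l k * (gramMatrix σ)⁻¹ k a = if l = a then 1 else 0 := by
    intro a
    rw [← Matrix.mul_apply, Matrix.mul_nonsing_inv _ (isUnit_det_gramMatrix h), Matrix.one_apply]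
  calc 2 * ∑ k, 1 / 2 * (∑ a, (gramMatrix σ)⁻¹ k a * X a) * gramMatrix σ k l
      = ∑ k, ∑ a, gramMatrix σ l k * (gramMatrix σ)⁻¹ k a * X a := by
        rw [Finset.mul_sum]
        refine Finset.sum_congr rfl fun k _ => ?_
        rw [hsymm k l]
        simp only [Finset.mul_sum, Finset.sum_mul]
        exact Finset.sum_congr rfl fun a _ => by ring
    _ = ∑ a, (∑ k, gramMatrix σ l k * (gramMatrix σ)⁻¹ k a) * X a := by
        rw [Finset.sum_comm]
        simp only [Finset.sum_mul]
    _ = X l := by simp [hinv]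

theorem chrMap_comm {σ : Lam} (h : IsPositive σ) (p : E7 →L[ℝ] Lam) (u v : E7) :
    chrMap σ p u v = chrMap σ p v u := by
  refine eq_of_metric_eq h fun w => ?_
  have h1 := metric_chrMap h p u v w
  have h2 := metric_chrMap h p v u w
  rw [metricDeriv_comm σ (p w) v u] at h2
  linarith

/-- The Levi-Civita connection is compatible with the metric. -/
theorem metricDeriv_eq_chrMap {σ : Lam} (h : IsPositive σ) (p : E7 →L[ℝ] Lam) (u v w : E7) :
    metricDeriv σ (p u) v w = metric σ (chrMap σ p u v) w + metric σ v (chrMap σ p u w) := by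
  have h1 := metric_chrMap h p u v w
  have h2 := metric_chrMap h p u w v
  rw [metric_comm σ v]
  rw [metricDeriv_comm σ (p u) w v] at h2
  linarith

/-- The covariant derivative of a field of positive 3-forms with value `σ` and derivative `p`, with
respect to its own Levi-Civita connection. -/
def nabla (σ : Lam) (p : E7 →L[ℝ] Lam) : E7 →L[ℝ] Lam :=
  p - (σ.fderivCompContinuousLinearMap (ContinuousLinearMap.id ℝ E7)).comp (chrMap σ p)

theorem nabla_apply (σ : Lam) (p : E7 →L[ℝ] Lam) (u : E7) :
    nabla σ p u = p u - act σ (chrMap σ p u) := by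
  rw [act]; rfl

theorem act_sub (σ : Lam) (B B' : E7 →L[ℝ] E7) : act σ (B - B') = act σ B - act σ B' := by
  rw [act, act, act, map_sub]

theorem act_neg (σ : Lam) (B : E7 →L[ℝ] E7) : act σ (-B) = -act σ B := by
  rw [act, act, map_neg]

/-- The covariant derivative of a positive form is given by the infinitesimal action of
skew-symmetric endomorphisms. -/
theorem exists_nabla_eq_act {σ : Lam} (h : IsPositive σ) (p : E7 →L[ℝ] Lam) :
    ∃ C : E7 → E7 →L[ℝ] E7, (∀ u, nabla σ p u = act σ (C u)) ∧
      ∀ u v w, metric σ (C u v) w + metric σ v (C u w) = 0 := by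
  obtain ⟨a, ha, ha'⟩ := exists_act_eq h
  -- Both `a (p u)` and the Christoffel endomorphism account for the derivative of the metric along
  -- `u`, so their difference is skew.
  refine ⟨fun u => a (p u) - chrMap σ p u, fun u => ?_, fun u v w => ?_⟩
  · rw [nabla_apply, act_sub, ha]
  · have h1 := ha' (p u) v w
    have h2 := metricDeriv_eq_chrMap h p u v w
    rw [metricDeriv] at h2
    simp only [ContinuousLinearMap.sub_apply]
    rw [metric_sub_left, metric_comm σ v, metric_sub_left, metric_comm σ _ v, metric_comm σ _ v]
    linarith

/-- The covariant derivative does not depend on the choice of coordinates. -/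
theorem nabla_pullback {σ σ' : E7 → Lam} {τ : E7 → E7} {y : E7} (hτ : ContDiffAt ℝ 2 τ y)
    (hσ : DifferentiableAt ℝ σ (τ y)) (hpos : IsPositive (σ (τ y))) (T : E7 ≃L[ℝ] E7)
    (hT : (T : E7 →L[ℝ] E7) = fderiv ℝ τ y)
    (hσ' : σ' =ᶠ[𝓝 y] fun z => (σ (τ z)).compContinuousLinearMap (fderiv ℝ τ z)) (u : E7) :
    nabla (σ' y) (fderiv ℝ σ' y) u = (nabla (σ (τ y)) (fderiv ℝ σ (τ y))
      (T u)).compContinuousLinearMap (T : E7 →L[ℝ] E7) := by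
  have hτd : HasFDerivAt τ (fderiv ℝ τ y) y := (hτ.differentiableAt (by simp)).hasFDerivAt
  have hτ2 : HasFDerivAt (fderiv ℝ τ) (fderiv ℝ (fderiv ℝ τ) y) y :=
    ((hτ.fderiv_right (m := 1) (by norm_num)).differentiableAt (by simp)).hasFDerivAt
  have hS : ∀ u v, fderiv ℝ (fderiv ℝ τ) y u v = fderiv ℝ (fderiv ℝ τ) y v u := fun u v =>
    (hτ.isSymmSndFDerivAt (by simp)).eq u v
  set S := fderiv ℝ (fderiv ℝ τ) y with hSdef
  set σ₁ := σ (τ y) with hσ₁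
  set p := fderiv ℝ σ (τ y) with hp
  have hσ'y : σ' y = σ₁.compContinuousLinearMap (T : E7 →L[ℝ] E7) := by
    rw [hσ'.self_of_nhds, hT]
  have hpos' : IsPositive (σ' y) := hσ'y ▸ hpos.comp T
  have hp' : ∀ u, fderiv ℝ σ' y u = (p (T u)).compContinuousLinearMap (T : E7 →L[ℝ] E7)
      + act (σ' y) ((T.symm : E7 →L[ℝ] E7).comp (S u)) := by
    intro u
    have h1 := (hσ.hasFDerivAt.comp y hτd).continuousAlternatingMapCompContinuousLinearMap hτ2
    have h2 := DFunLike.congr_fun (h1.congr_of_eventuallyEq hσ').fderiv u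
    rw [h2, hσ'y, hT, ← fderivComp_eq_act _ _ _ T hT, ← hT]
    rfl
  have hm : ∀ v w, metric (σ' y) v w = metric σ₁ (T v) (T w) := fun v w => by
    rw [hσ'y, metric_comp hpos]
  have hmd : ∀ u v w, metricDeriv (σ' y) (fderiv ℝ σ' y u) v w
      = metricDeriv σ₁ (p (T u)) (T v) (T w) + metric σ₁ (S u v) (T w)
        + metric σ₁ (T v) (S u w) := by
    intro u v w
    rw [hp', metricDeriv_add, metricDeriv_act hpos', hm, hm]
    nth_rewrite 1 [hσ'y]
    rw [metricDeriv_comp hpos]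
    simp [add_assoc]
  -- The inhomogeneous transformation law. In the Koszul formula the second derivatives of `τ`
  -- combine, by their symmetry, to `2⟨S(u, v), Tw⟩`.
  have hΓ : ∀ u v, T (chrMap (σ' y) (fderiv ℝ σ' y) u v)
      = chrMap σ₁ p (T u) (T v) + S u v := by
    intro u v
    refine eq_of_metric_eq hpos fun w => ?_
    obtain ⟨w, rfl⟩ := T.surjective w
    have h1 := metric_chrMap hpos' (fderiv ℝ σ' y) u v w
    have h2 := metric_chrMap hpos p (T u) (T v) (T w)
    rw [hm, hmd, hmd, hmd, hS v u, hS w u, hS w v] at h1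
    rw [metric_add_left]
    rw [metric_comm σ₁ (S u w) (T v)] at h1
    linarith
  rw [nabla_apply, hp', nabla_apply]
  -- The term `S(u)` from differentiating the pull-back cancels the inhomogeneous term of the
  -- Christoffel symbols.
  have hconj : (-chrMap σ₁ p (T u)).comp (T : E7 →L[ℝ] E7) = (T : E7 →L[ℝ] E7).comp
      ((T.symm : E7 →L[ℝ] E7).comp (S u) - chrMap (σ' y) (fderiv ℝ σ' y) u) := by
    ext1 v
    simp [hΓ]
  rw [add_sub_assoc, ← act_sub, sub_eq_add_neg (p (T u)), ← act_neg]
  nth_rewrite 1 [hσ'y]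
  rw [act_comp σ₁ _ _ _ hconj]
  rfl

end

section

attribute [local irreducible] stdForm actInv act

/-! ### The pointwise energy -/

/-- A constant rescaling of the metric does not change its Levi-Civita connection: both sides of the
Koszul formula acquire the factor `μ²`. -/
theorem chr_smul {σ : Lam} (h : IsPositive σ) (p : E7 →L[ℝ] Lam) {μ : ℝ} (hμ : μ ≠ 0) :
    chrMap (μ ^ 3 • σ) (μ ^ 3 • p) = chrMap σ p := by
  have hmd : ∀ (q : Lam) v w, metricDeriv (μ ^ 3 • σ) (μ ^ 3 • q) v w
      = μ ^ 2 * metricDeriv σ q v w := by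
    intro q v w
    have h1 : HasFDerivAt (fun s : Lam => μ ^ 3 • s) (μ ^ 3 • ContinuousLinearMap.id ℝ Lam) σ :=
      (hasFDerivAt_id σ).const_smul (μ ^ 3)
    have h2 := (hasFDerivAt_metric (h.smul hμ) v w).comp σ h1
    have h3 : (fun s : Lam => μ ^ 2 * metric s v w) =ᶠ[𝓝 σ]
        (fun s : Lam => metric s v w) ∘ fun s => μ ^ 3 • s := by
      filter_upwards [isOpen_isPositive.mem_nhds h] with s hs
      exact (metric_smul hs hμ v w).symm
    have h4 := (h2.congr_of_eventuallyEq h3).unique ((hasFDerivAt_metric h v w).const_mul (μ ^ 2))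
    have h5 := DFunLike.congr_fun h4 q
    simpa [metricDeriv] using h5
  ext1 u
  ext1 v
  refine eq_of_metric_eq h fun w => ?_
  have h1 := metric_chrMap (h.smul hμ) (μ ^ 3 • p) u v w
  have h2 := metric_chrMap h p u v w
  simp only [ContinuousLinearMap.smul_apply, hmd, metric_smul h hμ] at h1
  have hμ2 : μ ^ 2 ≠ 0 := pow_ne_zero 2 hμ
  refine mul_left_cancel₀ hμ2 ?_
  linear_combination (1 / 2 : ℝ) * h1 - (1 / 2 : ℝ) * μ ^ 2 * h2

theorem nabla_smul {σ : Lam} (h : IsPositive σ) (p : E7 →L[ℝ] Lam) {μ : ℝ} (hμ : μ ≠ 0) :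
    nabla (μ ^ 3 • σ) (μ ^ 3 • p) = μ ^ 3 • nabla σ p := by
  ext1 u
  rw [ContinuousLinearMap.smul_apply, nabla_apply, nabla_apply, chr_smul h p hμ, smul_sub]
  congr 1
  ext v
  simp [act_apply, Finset.mul_sum]

/-- The contraction `- ∑ᵢ eᵢ ⌟ N(eᵢ)` for a `G₂`-frame `(eᵢ)` of `σ`. -/
def contraction (σ : Lam) (N : E7 →L[ℝ] Lam) (v : Fin 2 → E7) : ℝ :=
  -∑ i, N (frame σ i) (Fin.cons (frame σ i) v)

/-- The energy `|alt N|² + |contraction N|²` of an element of `(ℝ⁷)^* ⊗ Λ³`. -/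
def energy (σ : Lam) (N : E7 →L[ℝ] Lam) : ℝ :=
  formNormSq σ (ContinuousAlternatingMap.alternatizeUncurryFin N) + formNormSq σ (contraction σ N)

/-- Insertion of two vectors. -/
def insertBilin (N : E7 →L[ℝ] Lam) (v : Fin 2 → E7) : E7 →ₗ[ℝ] E7 →ₗ[ℝ] ℝ :=
  LinearMap.mk₂ ℝ (fun x y => N x (Fin.cons y v))
    (fun x x' y => by simp) (fun c x y => by simp)
    (fun x y y' => (N x).toMultilinearMap.cons_add v y y')
    (fun c x y => (N x).toMultilinearMap.cons_smul v c y)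

theorem contraction_eq (σ : Lam) (N : E7 →L[ℝ] Lam) (v : Fin 2 → E7) :
    contraction σ N v = -∑ i, insertBilin N v (frame σ i) (frame σ i) := rfl

/-- The contraction as a multilinear map. -/
def contractionMap (σ : Lam) (N : E7 →L[ℝ] Lam) : MultilinearMap ℝ (fun _ : Fin 2 => E7) ℝ :=
  -∑ i, (N (frame σ i)).toMultilinearMap.curryLeft (frame σ i)

theorem coe_contractionMap (σ : Lam) (N : E7 →L[ℝ] Lam) :
    ⇑(contractionMap σ N) = contraction σ N := by
  ext v
  simp [contractionMap, contraction]

theorem energy_nonneg (σ : Lam) (N : E7 →L[ℝ] Lam) : 0 ≤ energy σ N := by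
  have : ∀ {k : ℕ} (α : (Fin k → E7) → ℝ), 0 ≤ formNormSq σ α := fun α =>
    mul_nonneg (by positivity) (Finset.sum_nonneg fun _ _ => mul_self_nonneg _)
  exact add_nonneg (this _) (this _)

/-- Naturality makes the energy of `∇Ω` a function on `M`, computable in any chart. -/
theorem energy_comp {σ : Lam} (h : IsPositive σ) (T : E7 ≃L[ℝ] E7) {N N' : E7 →L[ℝ] Lam}
    (hN : ∀ u, N' u = (N (T u)).compContinuousLinearMap (T : E7 →L[ℝ] E7)) :
    energy (σ.compContinuousLinearMap (T : E7 →L[ℝ] E7)) N' = energy σ N := by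
  rw [energy, energy]
  congr 1
  · have h1 := formInner_comp h T
      (ContinuousAlternatingMap.alternatizeUncurryFin N).toMultilinearMap
      (ContinuousAlternatingMap.alternatizeUncurryFin N).toMultilinearMap
    have h2 : ⇑(ContinuousAlternatingMap.alternatizeUncurryFin N') = fun v =>
        (ContinuousAlternatingMap.alternatizeUncurryFin N).toMultilinearMap fun a => T (v a) := by
      ext v
      change _ = ContinuousAlternatingMap.alternatizeUncurryFin N fun a => T (v a)
      rw [ContinuousAlternatingMap.alternatizeUncurryFin_apply,
        ContinuousAlternatingMap.alternatizeUncurryFin_apply]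
      refine Finset.sum_congr rfl fun i _ => ?_
      rw [hN]
      rfl
    rw [formNormSq, h2, h1]
    rfl
  · have h1 := formInner_comp h T (contractionMap σ N) (contractionMap σ N)
    have h2 : contraction (σ.compContinuousLinearMap (T : E7 →L[ℝ] E7)) N' = fun v =>
        contractionMap σ N fun a => T (v a) := by
      ext v
      rw [coe_contractionMap, contraction_eq, contraction_eq,
        ← sum_frame_comp h T (insertBilin N fun a => T (v a))]
      congr 1
      refine Finset.sum_congr rfl fun i _ => ?_
      change N' _ (Fin.cons _ v) = N (T _) (Fin.cons (T _) fun a => T (v a))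
      rw [hN]
      change N _ (fun a => T _) = _
      congr 1
      ext1 a
      refine Fin.cases rfl (fun b => rfl) a
    rw [formNormSq, h2, h1, coe_contractionMap]
    rfl

/-- Both summands have weight `-2`: the 4-form gives `μ⁶ · μ⁻⁸`. The contraction is itself
multiplied by `μ`, since the frame enters twice, and gives `μ² · μ⁻⁴`. -/
theorem energy_smul {σ : Lam} (h : IsPositive σ) (N : E7 →L[ℝ] Lam) {μ : ℝ} (hμ : μ ≠ 0) :
    energy (μ ^ 3 • σ) (μ ^ 3 • N) = (μ⁻¹) ^ 2 * energy σ N := by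
  have hs : ∀ {k : ℕ} (α : MultilinearMap ℝ (fun _ : Fin k => E7) ℝ) (c : ℝ),
      formNormSq (μ ^ 3 • σ) (fun v => c * α v) = c ^ 2 * ((μ⁻¹) ^ (2 * k) * formNormSq σ α) := by
    intro k α c
    rw [formNormSq, formNormSq, ← formInner_smul h hμ, formInner, formInner, mul_left_comm,
      Finset.mul_sum (a := c ^ 2)]
    congr 1
    exact Finset.sum_congr rfl fun I _ => by ring
  have h1 : ⇑(ContinuousAlternatingMap.alternatizeUncurryFin (μ ^ 3 • N)) = fun v => μ ^ 3 *
      (ContinuousAlternatingMap.alternatizeUncurryFin N).toMultilinearMap v := by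
    ext v
    change _ = μ ^ 3 * ContinuousAlternatingMap.alternatizeUncurryFin N v
    rw [ContinuousAlternatingMap.alternatizeUncurryFin_apply,
      ContinuousAlternatingMap.alternatizeUncurryFin_apply, Finset.mul_sum]
    refine Finset.sum_congr rfl fun i _ => ?_
    simp only [ContinuousLinearMap.smul_apply, ContinuousAlternatingMap.smul_apply, smul_eq_mul]
    simp; ring
  have h2 : contraction (μ ^ 3 • σ) (μ ^ 3 • N) = fun v => μ * contractionMap σ N v := by
    ext v
    rw [coe_contractionMap, contraction_eq, sum_frame_smul h hμ, contraction_eq]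
    have : ∀ x y, insertBilin (μ ^ 3 • N) v x y = μ ^ 3 * insertBilin N v x y := fun x y => rfl
    simp_rw [this]
    rw [← Finset.mul_sum]
    field_simp
  rw [energy, h1, h2, hs, hs, energy, coe_contractionMap]
  have e1 : (μ ^ 3) ^ 2 * (μ⁻¹) ^ (2 * 4) = (μ⁻¹) ^ 2 := by field_simp; norm_num [div_pow]; try field_simp
  have e2 : μ ^ 2 * (μ⁻¹) ^ (2 * 2) = (μ⁻¹) ^ 2 := by field_simp; norm_num [div_pow]; try field_simp
  rw [← mul_assoc, ← mul_assoc, e1, e2]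
  rw [mul_add]
  rfl

/-- The Lagrangian of the Dirichlet energy, a function of the 1-jet of a positive form. -/
def energyDensity (j : Lam × (E7 →L[ℝ] Lam)) : ℝ :=
  energy j.1 (nabla j.1 j.2) * volDensity j.1

/-- Weight `-2` of the energy plus weight `7` of the volume; this exponent five is the origin of the
factor `5/3` in Euler's identity. -/
theorem energyDensity_smul {σ : Lam} (h : IsPositive σ) (p : E7 →L[ℝ] Lam) {μ : ℝ} (hμ : 0 < μ) :
    energyDensity (μ ^ 3 • σ, μ ^ 3 • p) = μ ^ 5 * energyDensity (σ, p) := by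
  simp only [energyDensity]
  rw [nabla_smul h p hμ.ne', energy_smul h _ hμ.ne', volDensity_smul h hμ]
  field_simp

/-! ### Smoothness of the Lagrangian -/

section Smooth

variable {j : Lam × (E7 →L[ℝ] Lam)}

theorem contDiffAt_inv_gramMatrix {σ : Lam} (h : IsPositive σ) (k l : Fin 7) :
    ContDiffAt ℝ ∞ (fun s => (gramMatrix s)⁻¹ k l) σ := by
  have : (fun s => (gramMatrix s)⁻¹ k l)
      = fun s => ((gramMatrix s).det)⁻¹ * (gramMatrix s).adjugate k l := by
    ext s
    simp [Matrix.inv_def]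
  rw [this]
  refine ((contDiffAt_det_gramMatrix h).inv (det_gramMatrix_pos h).ne').mul ?_
  simp only [Matrix.adjugate_apply, Matrix.det_apply]
  refine ContDiffAt.sum fun q _ => ContDiffAt.const_smul _ (contDiffAt_prod fun i _ => ?_)
  by_cases hi : q i = l
  · subst hi
    simp only [Matrix.updateRow_self]
    exact contDiffAt_const
  · simp only [Matrix.updateRow_ne hi]
    exact contDiffAt_metric h _ _

theorem contDiffAt_metricDeriv (h : IsPositive j.1) (u v w : E7) :
    ContDiffAt ℝ ∞ (fun i : Lam × (E7 →L[ℝ] Lam) => metricDeriv i.1 (i.2 u) v w) j := by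
  have h1 : ContDiffAt ℝ ∞ (fun σ : Lam => fderiv ℝ (fun s : Lam => metric s v w) σ) j.1 :=
    (contDiffAt_metric h v w).fderiv_right (by simp)
  exact (h1.comp j contDiffAt_fst).clm_apply (contDiffAt_snd.clm_apply contDiffAt_const)

theorem contDiffAt_chr (h : IsPositive j.1) (k a b : Fin 7) :
    ContDiffAt ℝ ∞ (fun i : Lam × (E7 →L[ℝ] Lam) => chr i.1 i.2 k a b) j := by
  refine contDiffAt_const.mul (ContDiffAt.sum fun l _ => ContDiffAt.mul ?_ ?_)
  · exact (contDiffAt_inv_gramMatrix h k l).comp j contDiffAt_fst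
  · exact ((contDiffAt_metricDeriv h _ _ _).add (contDiffAt_metricDeriv h _ _ _)).sub
      (contDiffAt_metricDeriv h _ _ _)

theorem contDiffAt_smul_right {E F : Type*} [NormedAddCommGroup E] [NormedSpace ℝ E]
    [NormedAddCommGroup F] [NormedSpace ℝ F] {f : E → ℝ} {x : E} (hf : ContDiffAt ℝ ∞ f x) (c : F) :
    ContDiffAt ℝ ∞ (fun y => f y • c) x := hf.smul contDiffAt_const

theorem contDiffAt_chrMap (h : IsPositive j.1) :
    ContDiffAt ℝ ∞ (fun i : Lam × (E7 →L[ℝ] Lam) => chrMap i.1 i.2) j := by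
  refine ContDiffAt.sum fun k _ => ContDiffAt.sum fun a _ => ContDiffAt.sum fun b _ => ?_
  exact contDiffAt_smul_right (F := E7 →L[ℝ] E7 →L[ℝ] E7) (contDiffAt_chr h k a b) _

theorem contDiffAt_nabla_apply (h : IsPositive j.1) {u : Lam × (E7 →L[ℝ] Lam) → E7}
    {v : Lam × (E7 →L[ℝ] Lam) → Fin 3 → E7} (hu : ContDiffAt ℝ ∞ u j)
    (hv : ∀ a, ContDiffAt ℝ ∞ (fun i => v i a) j) :
    ContDiffAt ℝ ∞ (fun i => nabla i.1 i.2 (u i) (v i)) j := by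
  have : (fun i : Lam × (E7 →L[ℝ] Lam) => nabla i.1 i.2 (u i) (v i)) = fun i =>
      i.2 (u i) (v i) - ∑ a, i.1 (Function.update (v i) a (chrMap i.1 i.2 (u i) (v i a))) := by
    ext i
    rw [nabla_apply, ContinuousAlternatingMap.sub_apply, act_apply]
  rw [this]
  refine (contDiffAt_lam_apply (contDiffAt_snd.clm_apply hu) hv).sub
    (ContDiffAt.sum fun a _ => contDiffAt_lam_apply contDiffAt_fst fun b => ?_)
  by_cases hb : b = a
  · subst hb
    simp only [Function.update_self]
    exact ((contDiffAt_chrMap h).clm_apply hu).clm_apply (hv b)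
  · simp only [Function.update_of_ne hb]
    exact hv b

/-- The chosen frames need not be continuous in the form, but the energy is the same in any adapted
frame, so it is computed in the frame dual to a smooth local coframe. -/
theorem contDiffAt_energyDensity (h : IsPositive j.1) : ContDiffAt ℝ ∞ energyDensity j := by
  refine ContDiffAt.mul ?_ ((contDiffAt_volDensity h).comp j contDiffAt_fst)
  obtain ⟨A, hA, hev⟩ := exists_local_coframe h
  obtain ⟨e₀, he₀, -⟩ := hev.self_of_nhds
  set F : Lam × (E7 →L[ℝ] Lam) → Fin 7 → E7 := fun i a => (A i.1).inverse (stdVec a) with hF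
  have hFs : ∀ a, ContDiffAt ℝ ∞ (fun i => F i a) j := by
    intro a
    have h1 : ContDiffAt ℝ ∞ (ContinuousLinearMap.inverse : (E7 →L[ℝ] E7) → _) (A j.1) := by
      rw [← he₀]
      exact contDiffAt_map_inverse e₀
    exact ((h1.comp j.1 hA).comp j contDiffAt_fst).clm_apply contDiffAt_const
  have heq : (fun i : Lam × (E7 →L[ℝ] Lam) => energy i.1 (nabla i.1 i.2)) =ᶠ[𝓝 j] fun i =>
      ((4).factorial : ℝ)⁻¹ * ∑ I : Fin 4 → Fin 7,
        (∑ k : Fin 4, (-1) ^ (k : ℕ) • nabla i.1 i.2 (F i (I k)) (fun a => F i (I (k.succAbove a))))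
        * (∑ k : Fin 4, (-1) ^ (k : ℕ) • nabla i.1 i.2 (F i (I k))
          (fun a => F i (I (k.succAbove a))))
      + ((2).factorial : ℝ)⁻¹ * ∑ J : Fin 2 → Fin 7,
        (-∑ k, nabla i.1 i.2 (F i k) ![F i k, F i (J 0), F i (J 1)])
        * (-∑ k, nabla i.1 i.2 (F i k) ![F i k, F i (J 0), F i (J 1)]) := by
    filter_upwards [continuousAt_fst.eventually hev] with i ⟨e, heA, he⟩
    have hFe : ∀ a, F i a = e.symm (stdVec a) := by
      intro a
      simp only [hF]
      rw [← heA, ContinuousLinearMap.inverse_equiv]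
      rfl
    rw [energy]
    congr 1
    · refine (formInner_eq_sum e he
        (ContinuousAlternatingMap.alternatizeUncurryFin (nabla i.1 i.2)).toMultilinearMap
        (ContinuousAlternatingMap.alternatizeUncurryFin (nabla i.1 i.2)).toMultilinearMap).trans ?_
      congr 1
      refine Finset.sum_congr rfl fun I _ => ?_
      have : (ContinuousAlternatingMap.alternatizeUncurryFin (nabla i.1 i.2)).toMultilinearMap
          (fun a => e.symm (stdVec (I a))) = ∑ k : Fin 4, (-1) ^ (k : ℕ) •
            nabla i.1 i.2 (F i (I k)) (fun a => F i (I (k.succAbove a))) := by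
        simp_rw [hFe]
        exact ContinuousAlternatingMap.alternatizeUncurryFin_apply _ _
      rw [this]
    · rw [← coe_contractionMap]
      refine (formInner_eq_sum e he _ _).trans ?_
      congr 1
      refine Finset.sum_congr rfl fun J _ => ?_
      have : contractionMap i.1 (nabla i.1 i.2) (fun a => e.symm (stdVec (J a)))
          = -∑ k, nabla i.1 i.2 (F i k) ![F i k, F i (J 0), F i (J 1)] := by
        simp_rw [hFe]
        rw [coe_contractionMap, contraction_eq, sum_frame_bilinear e he]
        congr 1
        refine Finset.sum_congr rfl fun k _ => ?_
        change nabla i.1 i.2 _ (Fin.cons _ _) = _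
        congr 1
        ext1 a
        fin_cases a <;> rfl
      rw [this]
  refine ContDiffAt.congr_of_eventuallyEq ?_ heq
  refine ContDiffAt.add (contDiffAt_const.mul (ContDiffAt.sum fun I _ => ?_))
    (contDiffAt_const.mul (ContDiffAt.sum fun J _ => ?_))
  · have : ContDiffAt ℝ ∞ (fun i : Lam × (E7 →L[ℝ] Lam) => ∑ k : Fin 4, (-1) ^ (k : ℕ) •
      nabla i.1 i.2 (F i (I k)) (fun a => F i (I (k.succAbove a)))) j :=
      ContDiffAt.sum fun k _ => ContDiffAt.const_smul _
        (contDiffAt_nabla_apply h (hFs _) fun a => hFs _)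
    exact this.mul this
  · have : ContDiffAt ℝ ∞ (fun i : Lam × (E7 →L[ℝ] Lam) =>
        -∑ k, nabla i.1 i.2 (F i k) ![F i k, F i (J 0), F i (J 1)]) j := by
      refine (ContDiffAt.sum fun k _ => contDiffAt_nabla_apply h (hFs _) fun a => ?_).neg
      fin_cases a <;> exact hFs _
    exact this.mul this

end Smooth

end

section

attribute [local irreducible] stdForm actInv act

/-! ### The covariant derivative is controlled by the exterior derivative and codifferential -/

section Pointwise

theorem sum_mul_sum_bilinear {ι κ κ' : Type*} [Fintype ι] [Fintype κ] [Fintype κ'] (A : κ → ℝ)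
    (B : κ' → ℝ) (x : κ → ι → ℝ) (y : κ' → ι → ℝ) :
    ∑ i, (∑ m, A m * x m i) * (∑ n, B n * y n i) = ∑ m, ∑ n, A m * B n * ∑ i, x m i * y n i := by
  simp_rw [Finset.sum_mul_sum, Finset.mul_sum]
  rw [Finset.sum_comm]
  refine Finset.sum_congr rfl fun m _ => ?_
  rw [Finset.sum_comm]
  exact Finset.sum_congr rfl fun n _ => Finset.sum_congr rfl fun i _ => by ring

variable (T : Fin 7 → Fin 7 → ℝ)

/-- The components of `∇σ` in terms of the torsion tensor. -/
def torsionAct (l a b c : Fin 7) : ℝ := ∑ m, T l m * (psi m a b c : ℝ)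

theorem sum_torsionAct_sq : ∑ l, ∑ a, ∑ b, ∑ c, torsionAct T l a b c * torsionAct T l a b c
    = 24 * ∑ l, ∑ m, T l m * T l m := by
  rw [Finset.mul_sum]
  refine Finset.sum_congr rfl fun l _ => ?_
  have h := sum_mul_sum_bilinear (T l) (T l)
    (fun m (i : Fin 7 × Fin 7 × Fin 7) => (psi m i.1 i.2.1 i.2.2 : ℝ))
    (fun m (i : Fin 7 × Fin 7 × Fin 7) => (psi m i.1 i.2.1 i.2.2 : ℝ))
  simp only [Fintype.sum_prod_type] at h
  refine h.trans ?_
  have h2 : ∀ m n, ∑ a, ∑ b, ∑ c, (psi m a b c : ℝ) * (psi n a b c : ℝ)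
      = 24 * (kron m n : ℝ) := fun m n => by exact_mod_cast sum_psi_psi m n
  simp only [h2, kron]
  simp [Finset.mul_sum]
  exact Finset.sum_congr rfl fun m _ => by ring

theorem sum_torsionAct_swap :
    ∑ l, ∑ a, ∑ b, ∑ c, torsionAct T l a b c * torsionAct T a l b c
      = ∑ l, ∑ m, ∑ a, ∑ n, T l m * T a n *
        ∑ b, ∑ c, (psi m a b c : ℝ) * (psi n l b c : ℝ) := by
  refine Finset.sum_congr rfl fun l _ => ?_
  rw [Finset.sum_comm (s := Finset.univ (α := Fin 7)) (t := Finset.univ (α := Fin 7))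
    (f := fun m a => ∑ n, T l m * T a n * ∑ b, ∑ c, (psi m a b c : ℝ) * (psi n l b c : ℝ))]
  refine Finset.sum_congr rfl fun a _ => ?_
  have h := sum_mul_sum_bilinear (T l) (T a)
    (fun m (i : Fin 7 × Fin 7) => (psi m a i.1 i.2 : ℝ))
    (fun m (i : Fin 7 × Fin 7) => (psi m l i.1 i.2 : ℝ))
  simpa only [torsionAct, Fintype.sum_prod_type] using h

theorem sum_torsionAct_trace :
    ∑ b, ∑ c, (∑ l, torsionAct T l l b c) * (∑ l, torsionAct T l l b c)
      = ∑ l, ∑ m, ∑ a, ∑ n, T l m * T a n *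
        ∑ b, ∑ c, (psi m l b c : ℝ) * (psi n a b c : ℝ) := by
  have h := sum_mul_sum_bilinear (fun i : Fin 7 × Fin 7 => T i.1 i.2)
    (fun i : Fin 7 × Fin 7 => T i.1 i.2)
    (fun j (i : Fin 7 × Fin 7) => (psi j.2 j.1 i.1 i.2 : ℝ))
    (fun j (i : Fin 7 × Fin 7) => (psi j.2 j.1 i.1 i.2 : ℝ))
  simpa only [torsionAct, Fintype.sum_prod_type] using h

theorem sum_torsion_phi : ∑ k, (∑ l, ∑ m, T l m * (phi l m k : ℝ)) *
      (∑ l, ∑ m, T l m * (phi l m k : ℝ))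
      = ∑ l, ∑ m, ∑ a, ∑ n, T l m * T a n * ∑ k, (phi l m k : ℝ) * (phi a n k : ℝ) := by
  have h := sum_mul_sum_bilinear (fun i : Fin 7 × Fin 7 => T i.1 i.2)
    (fun i : Fin 7 × Fin 7 => T i.1 i.2)
    (fun j k => (phi j.1 j.2 k : ℝ)) (fun j k => (phi j.1 j.2 k : ℝ))
  simpa only [Fintype.sum_prod_type] using h

/-- The expression equals `4 (∑ T_{ll})² + 4 ∑ₖ (∑ T_{lm} φ_{lmk})²`, by contracting `psi_quadratic`
with `T_{lm} T_{an}`. -/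
theorem torsionAct_inequality :
    0 ≤ (1 / 6) * (∑ l, ∑ a, ∑ b, ∑ c, torsionAct T l a b c * torsionAct T l a b c)
      - (∑ l, ∑ a, ∑ b, ∑ c, torsionAct T l a b c * torsionAct T a l b c)
      + ∑ b, ∑ c, (∑ l, torsionAct T l l b c) * (∑ l, torsionAct T l l b c) := by
  have hq : ∀ l m a n, (4 * (kron l a : ℝ) * kron m n
      - ∑ b, ∑ c, (psi m a b c : ℝ) * (psi n l b c : ℝ))
      + ∑ b, ∑ c, (psi m l b c : ℝ) * (psi n a b c : ℝ)
      = 4 * kron l m * kron a n + 4 * ∑ k, (phi l m k : ℝ) * (phi a n k : ℝ) := fun l m a n => by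
    exact_mod_cast psi_quadratic l m a n
  have h1 : ∑ l, ∑ m, ∑ a, ∑ n, T l m * T a n * (4 * (kron l a : ℝ) * kron m n)
      = 4 * ∑ l, ∑ m, T l m * T l m := by
    simp [kron, Finset.mul_sum]
    exact Finset.sum_congr rfl fun l _ => Finset.sum_congr rfl fun m _ => by ring
  have h2 : ∑ l, ∑ m, ∑ a, ∑ n, T l m * T a n * (4 * (kron l m : ℝ) * kron a n)
      = 4 * ((∑ l, T l l) * ∑ l, T l l) := by
    simp only [kron, Int.cast_ite, Int.cast_one, Int.cast_zero, mul_ite, mul_one, mul_zero,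
      Finset.sum_ite_eq, Finset.mem_univ, if_true]
    rw [Finset.sum_mul_sum, Finset.mul_sum]
    refine Finset.sum_congr rfl fun l _ => ?_
    rw [Finset.mul_sum]
    simp
    exact Finset.sum_congr rfl fun m _ => by ring
  have h3 : ∑ l, ∑ m, ∑ a, ∑ n, T l m * T a n * ((4 * (kron l a : ℝ) * kron m n
      - ∑ b, ∑ c, (psi m a b c : ℝ) * (psi n l b c : ℝ))
      + ∑ b, ∑ c, (psi m l b c : ℝ) * (psi n a b c : ℝ))
      = ∑ l, ∑ m, ∑ a, ∑ n, T l m * T a n * (4 * kron l m * kron a n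
        + 4 * ∑ k, (phi l m k : ℝ) * (phi a n k : ℝ)) := by
    simp_rw [hq]
  have h4 : ∑ l, ∑ m, ∑ a, ∑ n, T l m * T a n * (4 * ∑ k, (phi l m k : ℝ) * (phi a n k : ℝ))
      = 4 * ∑ k, (∑ l, ∑ m, T l m * (phi l m k : ℝ)) *
      (∑ l, ∑ m, T l m * (phi l m k : ℝ)) := by
    rw [sum_torsion_phi, Finset.mul_sum]
    refine Finset.sum_congr rfl fun l _ => ?_
    rw [Finset.mul_sum]
    refine Finset.sum_congr rfl fun m _ => ?_
    rw [Finset.mul_sum]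
    refine Finset.sum_congr rfl fun a _ => ?_
    rw [Finset.mul_sum]
    exact Finset.sum_congr rfl fun n _ => by ring
  simp only [mul_add, mul_sub, Finset.sum_add_distrib, Finset.sum_sub_distrib] at h3
  rw [h1, h2, h4, ← sum_torsionAct_swap, ← sum_torsionAct_trace] at h3
  rw [sum_torsionAct_sq]
  have h5 : 0 ≤ ∑ k, (∑ l, ∑ m, T l m * (phi l m k : ℝ)) *
      (∑ l, ∑ m, T l m * (phi l m k : ℝ)) := Finset.sum_nonneg fun _ _ => mul_self_nonneg _
  have h6 := mul_self_nonneg (∑ l, T l l)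
  linarith

/-- The infinitesimal action of a skew matrix on `φ` factors through its torsion part. -/
theorem sum_skew_mul_phi (C : Fin 7 → Fin 7 → ℝ) (hC : ∀ i j, C i j = -C j i) (a b c : Fin 7) :
    ∑ m, (C a m * (phi m b c : ℝ) + C b m * (phi a m c : ℝ) + C c m * (phi a b m : ℝ))
      = ∑ m, (-(1 / 2) * ∑ i, ∑ j, C j i * (phi i j m : ℝ)) * (psi m a b c : ℝ) := by
  have h1 : ∀ i j, ((kron a j : ℝ) * phi i b c + kron b j * phi a i c + kron c j * phi a b i)
      - (kron a i * phi j b c + kron b i * phi a j c + kron c i * phi a b j)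
      = -∑ m, (phi i j m : ℝ) * (psi m a b c : ℝ) := fun i j => by
    have := phiPsi_eq i j a b c
    rw [← sum_phi_mul_psi] at this
    exact_mod_cast this
  have h2 : ∑ i, ∑ j, C j i * ((kron a j : ℝ) * phi i b c + kron b j * phi a i c
      + kron c j * phi a b i)
      = ∑ m, (C a m * (phi m b c : ℝ) + C b m * (phi a m c : ℝ) + C c m * (phi a b m : ℝ)) := by
    refine Finset.sum_congr rfl fun i _ => ?_
    simp [kron, mul_add, Finset.sum_add_distrib]
  have h3 : ∑ i, ∑ j, C j i * ((kron a i : ℝ) * phi j b c + kron b i * phi a j c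
      + kron c i * phi a b j)
      = -∑ m, (C a m * (phi m b c : ℝ) + C b m * (phi a m c : ℝ) + C c m * (phi a b m : ℝ)) := by
    rw [← h2, Finset.sum_comm, ← Finset.sum_neg_distrib]
    refine Finset.sum_congr rfl fun i _ => ?_
    rw [← Finset.sum_neg_distrib]
    exact Finset.sum_congr rfl fun j _ => by rw [hC i j]; ring
  have h4 : ∑ i, ∑ j, C j i * (((kron a j : ℝ) * phi i b c + kron b j * phi a i c
      + kron c j * phi a b i) - (kron a i * phi j b c + kron b i * phi a j c
      + kron c i * phi a b j)) = ∑ i, ∑ j, C j i * -∑ m, (phi i j m : ℝ) * (psi m a b c : ℝ) := by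
    simp_rw [h1]
  simp only [mul_sub, Finset.sum_sub_distrib] at h4
  rw [h2, h3] at h4
  have h5 : ∑ i, ∑ j, C j i * -∑ m, (phi i j m : ℝ) * (psi m a b c : ℝ)
      = -∑ m, (∑ i, ∑ j, C j i * (phi i j m : ℝ)) * (psi m a b c : ℝ) := by
    simp_rw [mul_neg, Finset.sum_neg_distrib, Finset.sum_mul, Finset.mul_sum]
    congr 1
    rw [Finset.sum_comm' (s := Finset.univ) (t := fun _ => Finset.univ) (t' := Finset.univ)
      (s' := fun _ => Finset.univ) (by simp)]
    rw [Finset.sum_comm]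
    rw [Finset.sum_comm (s := Finset.univ (α := Fin 7)) (t := Finset.univ (α := Fin 7))
      (f := fun m i => ∑ j, C j i * (phi i j m : ℝ) * (psi m a b c : ℝ))]
    refine Finset.sum_congr rfl fun i _ => ?_
    rw [Finset.sum_comm]
    exact Finset.sum_congr rfl fun m _ => Finset.sum_congr rfl fun j _ => by ring
  rw [h5] at h4
  simp_rw [mul_assoc, ← Finset.mul_sum]
  linarith

/-- The squared norm of the alternation of a tensor which is alternating in its last three
arguments. -/
theorem sum_alternation_sq (n : Fin 7 → Fin 7 → Fin 7 → Fin 7 → ℝ)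
    (h₁ : ∀ l a b c, n l b a c = -n l a b c) (h₂ : ∀ l a b c, n l a c b = -n l a b c) :
    ∑ l, ∑ a, ∑ b, ∑ c, (n l a b c - n a l b c + n b l a c - n c l a b)
        * (n l a b c - n a l b c + n b l a c - n c l a b)
      = 4 * (∑ l, ∑ a, ∑ b, ∑ c, n l a b c * n l a b c)
        - 12 * ∑ l, ∑ a, ∑ b, ∑ c, n l a b c * n a l b c := by
  have s12 : ∀ F : Fin 7 → Fin 7 → Fin 7 → Fin 7 → ℝ, ∑ l, ∑ a, ∑ b, ∑ c, F a l b c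
      = ∑ l, ∑ a, ∑ b, ∑ c, F l a b c := fun F => Finset.sum_comm
  have s23 : ∀ F : Fin 7 → Fin 7 → Fin 7 → Fin 7 → ℝ, ∑ l, ∑ a, ∑ b, ∑ c, F l b a c
      = ∑ l, ∑ a, ∑ b, ∑ c, F l a b c := fun F =>
    Finset.sum_congr rfl fun l _ => Finset.sum_comm
  have s34 : ∀ F : Fin 7 → Fin 7 → Fin 7 → Fin 7 → ℝ, ∑ l, ∑ a, ∑ b, ∑ c, F l a c b
      = ∑ l, ∑ a, ∑ b, ∑ c, F l a b c := fun F =>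
    Finset.sum_congr rfl fun l _ => Finset.sum_congr rfl fun a _ => Finset.sum_comm
  -- Four squares and six cross terms. The alternating symmetry brings each cross term to the shape
  -- `-2 n_{xy··} n_{yx··}`, so after renaming indices all six sums coincide; hence the coefficients
  -- 4 and 12.
  have hexp : ∀ l a b c, (n l a b c - n a l b c + n b l a c - n c l a b)
        * (n l a b c - n a l b c + n b l a c - n c l a b)
      = n l a b c * n l a b c + n a l b c * n a l b c + n b l a c * n b l a c
        + n c l a b * n c l a b - 2 * (n l a b c * n a l b c) - 2 * (n l b a c * n b l a c)
        - 2 * (n l c a b * n c l a b) - 2 * (n a b l c * n b a l c) - 2 * (n a c l b * n c a l b)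
        - 2 * (n b c l a * n c b l a) := by
    intro l a b c
    have e1 : n l c a b = n l a b c := by rw [h₁ l a c b, h₂ l a b c, neg_neg]
    have e2 : n a c l b = n a l b c := by rw [h₁ a l c b, h₂ a l b c, neg_neg]
    have e3 : n b c l a = n b l a c := by rw [h₁ b l c a, h₂ b l a c, neg_neg]
    have e4 : n c b l a = n c l a b := by rw [h₁ c l b a, h₂ c l a b, neg_neg]
    rw [h₁ l a b c, h₁ a l b c, h₁ b l a c, h₁ c l a b, e1, e2, e3, e4]
    ring
  simp_rw [hexp]
  simp only [Finset.sum_add_distrib, Finset.sum_sub_distrib, ← Finset.mul_sum]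
  have t1 := s12 (fun l a b c => n l a b c * n l a b c)
  have t2 : ∑ l, ∑ a, ∑ b, ∑ c, n b l a c * n b l a c
      = ∑ l, ∑ a, ∑ b, ∑ c, n l a b c * n l a b c := by
    rw [s23 (fun l a b c => n a l b c * n a l b c), t1]
  have t3 : ∑ l, ∑ a, ∑ b, ∑ c, n c l a b * n c l a b
      = ∑ l, ∑ a, ∑ b, ∑ c, n l a b c * n l a b c := by
    rw [s34 (fun l a b c => n b l a c * n b l a c), t2]
  have u13 : ∑ l, ∑ a, ∑ b, ∑ c, n l b a c * n b l a c
      = ∑ l, ∑ a, ∑ b, ∑ c, n l a b c * n a l b c :=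
    s23 (fun l a b c => n l a b c * n a l b c)
  have u14 : ∑ l, ∑ a, ∑ b, ∑ c, n l c a b * n c l a b
      = ∑ l, ∑ a, ∑ b, ∑ c, n l a b c * n a l b c := by
    rw [s34 (fun l a b c => n l b a c * n b l a c), u13]
  have u23 : ∑ l, ∑ a, ∑ b, ∑ c, n a b l c * n b a l c
      = ∑ l, ∑ a, ∑ b, ∑ c, n l a b c * n a l b c := by
    rw [s12 (fun l a b c => n l b a c * n b l a c), u13]
  have u24 : ∑ l, ∑ a, ∑ b, ∑ c, n a c l b * n c a l b
      = ∑ l, ∑ a, ∑ b, ∑ c, n l a b c * n a l b c := by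
    rw [s34 (fun l a b c => n a b l c * n b a l c), u23]
  have u34 : ∑ l, ∑ a, ∑ b, ∑ c, n b c l a * n c b l a
      = ∑ l, ∑ a, ∑ b, ∑ c, n l a b c * n a l b c := by
    rw [s23 (fun l a b c => n a c l b * n c a l b), u24]
  rw [t1, t2, t3, u13, u14, u23, u24, u34]
  ring


end Pointwise

/-! ### From components to forms: the pointwise inequality -/

theorem sum_fin_two_fun {ι M : Type*} [Fintype ι] [AddCommMonoid M] (F : (Fin 2 → ι) → M) :
    ∑ I, F I = ∑ i, ∑ j, F ![i, j] := by
  rw [← (Fin.consEquiv (fun _ : Fin 2 => ι)).sum_comp, Fintype.sum_prod_type]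
  refine Finset.sum_congr rfl fun i _ => ?_
  rw [← (Fin.consEquiv (fun _ : Fin 1 => ι)).sum_comp, Fintype.sum_prod_type]
  refine Finset.sum_congr rfl fun j _ => ?_
  simp only [Finset.univ_unique, Finset.sum_singleton]
  rfl

theorem sum_fin_four_fun {ι M : Type*} [Fintype ι] [AddCommMonoid M] (F : (Fin 4 → ι) → M) :
    ∑ I, F I = ∑ l, ∑ i, ∑ j, ∑ k, F ![l, i, j, k] := by
  rw [← (Fin.consEquiv (fun _ : Fin 4 => ι)).sum_comp, Fintype.sum_prod_type]
  exact Finset.sum_congr rfl fun l _ => sum_fin_three_fun _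

/-- The squared components of `φ` sum to `7 · 6`, and `3!` divides out the repetitions. -/
theorem formNormSq_self {V : Type*} [AddCommGroup V] [Module ℝ V] [TopologicalSpace V]
    {σ : V [⋀^Fin 3]→L[ℝ] ℝ} (h : IsPositive σ) : formNormSq σ σ = 7 := by
  obtain ⟨e, he⟩ := h
  have h1 := formInner_eq_sum e he σ.toMultilinearMap σ.toMultilinearMap
  have h2 : ∀ I : Fin 3 → Fin 7, σ.toMultilinearMap (fun a => e.symm (stdVec (I a)))
      = (phi (I 0) (I 1) (I 2) : ℝ) := by
    intro I
    rw [← stdForm_stdVec, ← he]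
    change stdForm (fun a => e (e.symm (stdVec (I a)))) = _
    simp_rw [e.apply_symm_apply]
  refine h1.trans ?_
  simp_rw [h2]
  rw [sum_fin_three_fun]
  have h3 : ∀ i : Fin 7, ∑ j, ∑ k, (phi i j k : ℝ) * (phi i j k : ℝ) = 6 := fun i => by
    have := sum_phi_phi i i
    simp only [kron, if_true] at this
    exact_mod_cast this
  change _ * ∑ i, ∑ j, ∑ k, (phi i j k : ℝ) * (phi i j k : ℝ) = 7
  simp_rw [h3]
  simp [Nat.factorial]
  norm_num

/-- In a suitable `G₂`-frame, the covariant derivative is given by a torsion tensor. -/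
theorem exists_torsion {σ : Lam} (h : IsPositive σ) (p : E7 →L[ℝ] Lam) :
    ∃ e : E7 ≃L[ℝ] E7, stdForm.compContinuousLinearMap (e : E7 →L[ℝ] E7) = σ ∧
      (∀ i, frame σ i = e.symm (stdVec i)) ∧ ∃ T : Fin 7 → Fin 7 → ℝ, ∀ l a b c,
      nabla σ p (e.symm (stdVec l)) ![e.symm (stdVec a), e.symm (stdVec b), e.symm (stdVec c)]
        = torsionAct T l a b c := by
  obtain ⟨e, he, hf⟩ := frame_eq h
  obtain ⟨C, hN, hC⟩ := exists_nabla_eq_act h p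
  -- The contraction with `φ` projects the skew matrix to the 7-dimensional complement of `g₂`; the
  -- factor comes from `sum_skew_mul_phi`.
  refine ⟨e, he, hf, fun l m => -(1 / 2) * ∑ i, ∑ j,
    (e (C (e.symm (stdVec l)) (e.symm (stdVec j)))) i * (phi i j m : ℝ), fun l a b c => ?_⟩
  rw [torsionAct, ← sum_skew_mul_phi (fun j i => (e (C (e.symm (stdVec l)) (e.symm (stdVec j)))) i)]
  · set B : E7 →L[ℝ] E7 := (e : E7 →L[ℝ] E7).comp ((C (e.symm (stdVec l))).comp
      (e.symm : E7 →L[ℝ] E7)) with hB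
    have h1 : B.comp (e : E7 →L[ℝ] E7) = (e : E7 →L[ℝ] E7).comp (C (e.symm (stdVec l))) := by
      ext1 v; simp [hB]
    have h2 := act_comp stdForm (e : E7 →L[ℝ] E7) (C (e.symm (stdVec l))) B h1
    rw [hN, ← he, h2]
    have h3 : ((e : E7 →L[ℝ] E7) ∘ ![e.symm (stdVec a), e.symm (stdVec b), e.symm (stdVec c)])
        = ![stdVec a, stdVec b, stdVec c] := by
      ext1 i
      fin_cases i <;> exact e.apply_symm_apply _
    change act stdForm B ((e : E7 →L[ℝ] E7) ∘ _) = _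
    rw [h3, act_stdForm_stdVec]
    rfl
  · intro i j
    have h1 := hC (e.symm (stdVec l)) (e.symm (stdVec i)) (e.symm (stdVec j))
    rw [metric_eq_inner e he, metric_eq_inner e he, e.apply_symm_apply, e.apply_symm_apply] at h1
    rw [EuclideanSpace.inner_single_right, EuclideanSpace.inner_single_left] at h1
    simp at h1
    linarith

/-- Let `S`, `X`, `Y` be the sum of squares, the swapped sum and the trace term of
`torsionAct_inequality`. The weights `1/3!`, `1/4!`, `1/2!` make the three norms `S/6`, `S/6 - X/2`
and `Y/2`, so the gap is exactly `S/6 - X + Y`. -/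
theorem sum_nabla_sq_le {σ : Lam} (h : IsPositive σ) (p : E7 →L[ℝ] Lam) :
    ∑ i, formNormSq σ (nabla σ p (frame σ i)) ≤ 2 * energy σ (nabla σ p) := by
  obtain ⟨e, he, hf, T, hT⟩ := exists_torsion h p
  set n := torsionAct T with hn
  have h₁ : ∀ l a b c, n l b a c = -n l a b c := fun l a b c => by
    rw [← hT, ← hT, lam_swap₁₂]
  have h₂ : ∀ l a b c, n l a c b = -n l a b c := fun l a b c => by
    rw [← hT, ← hT, lam_swap₂₃]
  have hS1 : ∑ i, formNormSq σ (nabla σ p (frame σ i))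
      = (1 / 6) * ∑ l, ∑ a, ∑ b, ∑ c, n l a b c * n l a b c := by
    rw [Finset.mul_sum]
    refine Finset.sum_congr rfl fun l _ => ?_
    rw [formNormSq, formInner, sum_fin_three_fun]
    congr 1
    · simp [Nat.factorial]
    · refine Finset.sum_congr rfl fun a _ => Finset.sum_congr rfl fun b _ =>
        Finset.sum_congr rfl fun c _ => ?_
      have : frame σ ∘ ![a, b, c]
          = ![e.symm (stdVec a), e.symm (stdVec b), e.symm (stdVec c)] := by
        ext1 i
        fin_cases i <;> exact hf _
      rw [this, hf, hT]
  have hS2 : formNormSq σ (ContinuousAlternatingMap.alternatizeUncurryFin (nabla σ p))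
      = (1 / 24) * (4 * (∑ l, ∑ a, ∑ b, ∑ c, n l a b c * n l a b c)
        - 12 * ∑ l, ∑ a, ∑ b, ∑ c, n l a b c * n a l b c) := by
    rw [← sum_alternation_sq n h₁ h₂, formNormSq, formInner, sum_fin_four_fun]
    congr 1
    · simp [Nat.factorial]
    · refine Finset.sum_congr rfl fun l _ => Finset.sum_congr rfl fun a _ =>
        Finset.sum_congr rfl fun b _ => Finset.sum_congr rfl fun c _ => ?_
      have : ContinuousAlternatingMap.alternatizeUncurryFin (nabla σ p) (frame σ ∘ ![l, a, b, c])
          = n l a b c - n a l b c + n b l a c - n c l a b := by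
        rw [ContinuousAlternatingMap.alternatizeUncurryFin_apply, Fin.sum_univ_four]
        have hr : ∀ k : Fin 4, ∀ l' a' b' c' : Fin 7, ![l, a, b, c] k = l' →
            ![l, a, b, c] ∘ k.succAbove = ![a', b', c'] →
            nabla σ p ((frame σ ∘ ![l, a, b, c]) k)
              (k.removeNth (frame σ ∘ ![l, a, b, c])) = n l' a' b' c' := by
          intro k l' a' b' c' hl hk
          rw [← hT]
          have h1 : (k.removeNth (frame σ ∘ ![l, a, b, c]))
              = ![e.symm (stdVec a'), e.symm (stdVec b'), e.symm (stdVec c')] := by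
            change frame σ ∘ (![l, a, b, c] ∘ k.succAbove) = _
            rw [hk]
            ext1 i
            fin_cases i <;> exact hf _
          rw [h1, Function.comp_apply, hl, hf]
        rw [hr 0 l a b c rfl (by ext1 i; fin_cases i <;> rfl),
          hr 1 a l b c rfl (by ext1 i; fin_cases i <;> rfl),
          hr 2 b l a c rfl (by ext1 i; fin_cases i <;> rfl),
          hr 3 c l a b rfl (by ext1 i; fin_cases i <;> rfl)]
        simp [pow_succ]
        ring
      rw [this]
  have hS3 : formNormSq σ (contraction σ (nabla σ p))
      = (1 / 2) * ∑ b, ∑ c, (∑ l, n l l b c) * (∑ l, n l l b c) := by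
    rw [formNormSq, formInner, sum_fin_two_fun]
    congr 1
    · simp [Nat.factorial]
    · refine Finset.sum_congr rfl fun b _ => Finset.sum_congr rfl fun c _ => ?_
      have : contraction σ (nabla σ p) (frame σ ∘ ![b, c]) = -∑ l, n l l b c := by
        rw [contraction]
        congr 1
        refine Finset.sum_congr rfl fun l _ => ?_
        rw [← hT, ← hf, ← hf, ← hf]
        congr 1
        ext1 i
        fin_cases i <;> rfl
      rw [this, neg_mul_neg]
  have := torsionAct_inequality T
  rw [energy, hS1, hS2, hS3]
  linarith

theorem energy_eq_zero_iff {σ : Lam} (h : IsPositive σ) (p : E7 →L[ℝ] Lam) :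
    energy σ (nabla σ p) = 0 ↔ nabla σ p = 0 := by
  refine ⟨fun h0 => ?_, fun h0 => ?_⟩
  · have h1 := sum_nabla_sq_le h p
    rw [h0, mul_zero] at h1
    have hnn : ∀ i, 0 ≤ formNormSq σ (nabla σ p (frame σ i)) := fun i =>
      mul_nonneg (by positivity) (Finset.sum_nonneg fun _ _ => mul_self_nonneg _)
    have h2 := (Finset.sum_eq_zero_iff_of_nonneg fun i _ => hnn i).1
      (le_antisymm h1 (Finset.sum_nonneg fun i _ => hnn i))
    obtain ⟨e, he, hf, T, hT⟩ := exists_torsion h p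
    have h3 : ∀ i, nabla σ p (e.symm (stdVec i)) = 0 := by
      intro i
      have h4 := h2 i (Finset.mem_univ i)
      rw [hf, formNormSq, formInner, mul_eq_zero] at h4
      have h5 := (Finset.sum_eq_zero_iff_of_nonneg fun _ _ => mul_self_nonneg _).1
        (h4.resolve_left (by positivity))
      have h6 : (nabla σ p (e.symm (stdVec i))).compContinuousLinearMap (e.symm : E7 →L[ℝ] E7)
          = 0 := by
        refine lam_ext fun a b c _ _ => ?_
        have h7 := mul_self_eq_zero.1 (h5 ![a, b, c] (Finset.mem_univ _))
        refine Eq.trans ?_ h7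
        change nabla σ p _ _ = _
        congr 1
        ext1 k
        fin_cases k <;> exact (hf _).symm
      ext v
      have h7 := DFunLike.congr_fun h6 (e ∘ v)
      refine Eq.trans ?_ h7
      change nabla σ p _ _ = nabla σ p _ _
      congr 1
      ext1 k
      exact (e.symm_apply_apply _).symm
    ext1 u
    obtain ⟨w, rfl⟩ := e.symm.surjective u
    rw [← sum_smul_stdVec w]
    simp only [map_sum, map_smul, h3]
    simp
  · rw [h0, energy]
    have h1 : ⇑(ContinuousAlternatingMap.alternatizeUncurryFin (0 : E7 →L[ℝ] Lam)) = 0 := by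
      ext v
      simp [ContinuousAlternatingMap.alternatizeUncurryFin_apply]
    have h2 : contraction σ (0 : E7 →L[ℝ] Lam) = 0 := by
      ext v
      simp [contraction]
    rw [h1, h2]
    simp [formNormSq, formInner]

/-- The exterior derivative is the alternation of the covariant derivative. -/
theorem alternatizeUncurryFin_nabla {σ : Lam} (h : IsPositive σ) (p : E7 →L[ℝ] Lam) :
    ContinuousAlternatingMap.alternatizeUncurryFin (nabla σ p)
      = ContinuousAlternatingMap.alternatizeUncurryFin p := by
  ext v
  have hs := chrMap_comm h p
  rw [ContinuousAlternatingMap.alternatizeUncurryFin_apply,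
    ContinuousAlternatingMap.alternatizeUncurryFin_apply, Fin.sum_univ_four, Fin.sum_univ_four]
  have hr : ∀ k : Fin 4, ∀ a b c d : Fin 4, k = d → k.succAbove 0 = a → k.succAbove 1 = b →
      k.succAbove 2 = c → k.removeNth v = ![v a, v b, v c] := by
    rintro k a b c d - rfl rfl rfl
    ext1 i
    fin_cases i <;> rfl
  rw [hr 0 1 2 3 0 rfl rfl rfl rfl, hr 1 0 2 3 1 rfl rfl rfl rfl, hr 2 0 1 3 2 rfl rfl rfl rfl,
    hr 3 0 1 2 3 rfl rfl rfl rfl]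
  simp only [nabla_apply, ContinuousAlternatingMap.sub_apply, act_apply_three]
  generalize v 0 = v0
  generalize v 1 = v1
  generalize v 2 = v2
  generalize v 3 = v3
  -- Symmetry of the Christoffel map makes the twelve correction terms cancel in pairs under the
  -- alternating sum.
  rw [hs v1 v0, hs v2 v0, hs v2 v1, hs v3 v0, hs v3 v1, hs v3 v2]
  rw [lam_swap₁₂ σ (chrMap σ p v0 v2) v1 v3, lam_swap₂₃ σ v1 (chrMap σ p v0 v3) v2,
    lam_swap₁₂ σ (chrMap σ p v0 v3) v1 v2, lam_swap₂₃ σ v0 (chrMap σ p v1 v3) v2]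
  simp [pow_succ]
  ring

end

section

attribute [local irreducible] stdForm actInv act

/-! ### Forms in charts -/

section Charts

variable {M : Type*} [TopologicalSpace M] [ChartedSpace E7 M]

/-- The coordinate change from the chart around `c` to the chart around `c'`. -/
def tr (c c' : M) (y : E7) : E7 := extChartAt (𝓡 7) c' ((extChartAt (𝓡 7) c).symm y)

theorem tr_tr {c c' : M} (c'' : M) {y : E7}
    (hy' : (extChartAt (𝓡 7) c).symm y ∈ (extChartAt (𝓡 7) c').source) :
    tr c' c'' (tr c c' y) = tr c c'' y := by
  rw [tr, tr, (extChartAt (𝓡 7) c').left_inv hy', tr]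

theorem tr_self {c : M} {y : E7} (hy : y ∈ (extChartAt (𝓡 7) c).target) : tr c c y = y :=
  (extChartAt (𝓡 7) c).right_inv hy

theorem tr_mem_target {c c' : M} {y : E7}
    (hy' : (extChartAt (𝓡 7) c).symm y ∈ (extChartAt (𝓡 7) c').source) :
    tr c c' y ∈ (extChartAt (𝓡 7) c').target :=
  (extChartAt (𝓡 7) c').map_source hy'

theorem symm_tr {c c' : M} {y : E7}
    (hy' : (extChartAt (𝓡 7) c).symm y ∈ (extChartAt (𝓡 7) c').source) :
    (extChartAt (𝓡 7) c').symm (tr c c' y) = (extChartAt (𝓡 7) c).symm y :=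
  (extChartAt (𝓡 7) c').left_inv hy'

theorem eventually_mem_target {c : M} {y : E7} (hy : y ∈ (extChartAt (𝓡 7) c).target) :
    ∀ᶠ z in 𝓝 y, z ∈ (extChartAt (𝓡 7) c).target :=
  (isOpen_extChartAt_target c).mem_nhds hy

theorem eventually_symm_mem_source {c c' : M} {y : E7} (hy : y ∈ (extChartAt (𝓡 7) c).target)
    (hy' : (extChartAt (𝓡 7) c).symm y ∈ (extChartAt (𝓡 7) c').source) :
    ∀ᶠ z in 𝓝 y, (extChartAt (𝓡 7) c).symm z ∈ (extChartAt (𝓡 7) c').source :=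
  (continuousAt_extChartAt_symm'' hy).eventually ((isOpen_extChartAt_source c').mem_nhds hy')

variable [IsManifold (𝓡 7) ∞ M]

theorem contDiffAt_tr {c c' : M} {y : E7} (hy : y ∈ (extChartAt (𝓡 7) c).target)
    (hy' : (extChartAt (𝓡 7) c).symm y ∈ (extChartAt (𝓡 7) c').source) :
    ContDiffAt ℝ ∞ (tr c c') y := by
  have h := contDiffWithinAt_ext_coord_change (I := 𝓡 7) (n := ∞) c' c (y := y)
    (by rw [PartialEquiv.trans_source]; exact ⟨hy, hy'⟩)
  rw [(𝓡 7).range_eq_univ, contDiffWithinAt_univ] at h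
  exact h

theorem differentiableAt_tr {c c' : M} {y : E7} (hy : y ∈ (extChartAt (𝓡 7) c).target)
    (hy' : (extChartAt (𝓡 7) c).symm y ∈ (extChartAt (𝓡 7) c').source) :
    DifferentiableAt ℝ (tr c c') y :=
  (contDiffAt_tr hy hy').differentiableAt (by simp)

theorem fderiv_tr_comp {c c' c'' : M} {y : E7} (hy : y ∈ (extChartAt (𝓡 7) c).target)
    (hy' : (extChartAt (𝓡 7) c).symm y ∈ (extChartAt (𝓡 7) c').source)
    (hy'' : (extChartAt (𝓡 7) c).symm y ∈ (extChartAt (𝓡 7) c'').source) :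
    (fderiv ℝ (tr c' c'') (tr c c' y)).comp (fderiv ℝ (tr c c') y) = fderiv ℝ (tr c c'') y := by
  have h1 : tr c' c'' ∘ tr c c' =ᶠ[𝓝 y] tr c c'' := by
    filter_upwards [eventually_symm_mem_source hy hy'] with z hz
    exact tr_tr c'' hz
  rw [← h1.fderiv_eq, fderiv_comp y (differentiableAt_tr (tr_mem_target hy')
    (by rwa [symm_tr hy'])) (differentiableAt_tr hy hy')]

theorem fderiv_tr_self {c : M} {y : E7} (hy : y ∈ (extChartAt (𝓡 7) c).target) :
    fderiv ℝ (tr c c) y = ContinuousLinearMap.id ℝ E7 := by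
  have h1 : tr c c =ᶠ[𝓝 y] id := by
    filter_upwards [eventually_mem_target hy] with z hz
    exact tr_self hz
  rw [h1.fderiv_eq, fderiv_id]

/-- The opposite coordinate change supplies the inverse, by the cocycle rule. -/
theorem exists_equiv_fderiv_tr {c c' : M} {y : E7} (hy : y ∈ (extChartAt (𝓡 7) c).target)
    (hy' : (extChartAt (𝓡 7) c).symm y ∈ (extChartAt (𝓡 7) c').source) :
    ∃ e : E7 ≃L[ℝ] E7, (e : E7 →L[ℝ] E7) = fderiv ℝ (tr c c') y := by
  have hc := (extChartAt (𝓡 7) c).map_target hy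
  have h1 := fderiv_tr_comp hy hy' hc
  rw [fderiv_tr_self hy] at h1
  have h2 := fderiv_tr_comp (c'' := c') (tr_mem_target hy') (by rwa [symm_tr hy'])
    (by rwa [symm_tr hy'])
  rw [fderiv_tr_self (tr_mem_target hy'), tr_tr c hy', tr_self hy] at h2
  exact ⟨ContinuousLinearEquiv.equivOfInverse (fderiv ℝ (tr c c') y)
    (fderiv ℝ (tr c' c) (tr c c' y)) (fun v => DFunLike.congr_fun h1 v)
    (fun v => DFunLike.congr_fun h2 v), rfl⟩

/-- The tangent space at `x` is the model space read in the preferred chart at `x`, so the manifold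
derivative of an inverse chart is the derivative of the coordinate change to that chart. -/
theorem chartInvDeriv_eq {c : M} {y : E7} (hy : y ∈ (extChartAt (𝓡 7) c).target) :
    chartInvDeriv c y = fderiv ℝ (tr c ((extChartAt (𝓡 7) c).symm y)) y := by
  have h : MDifferentiableAt (𝓡 7) (𝓡 7) (extChartAt (𝓡 7) c).symm y := by
    have h := mdifferentiableWithinAt_extChartAt_symm (I := 𝓡 7) hy
    rwa [(𝓡 7).range_eq_univ, mdifferentiableWithinAt_univ] at h
  refine h.mfderiv.trans ?_
  rw [(𝓡 7).range_eq_univ, fderivWithin_univ]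
  rfl

theorem chartDeriv_eq (x : M) : chartDeriv x = ContinuousLinearMap.id ℝ E7 := by
  have h : MDifferentiableAt (𝓡 7) (𝓡 7) (extChartAt (𝓡 7) x) x :=
    mdifferentiableAt_extChartAt (mem_chart_source E7 x)
  refine h.mfderiv.trans ?_
  rw [(𝓡 7).range_eq_univ, fderivWithin_univ]
  exact fderiv_tr_self (mem_extChartAt_target x)

theorem coordForm_eq {k : ℕ} (α : Form M k) {c : M} {y : E7}
    (hy : y ∈ (extChartAt (𝓡 7) c).target) {x : M} (hx : (extChartAt (𝓡 7) c).symm y = x) :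
    coordForm α c y = (show E7 [⋀^Fin k]→L[ℝ] ℝ from α x).compContinuousLinearMap
      (fderiv ℝ (tr c x) y) := by
  subst hx
  rw [coordForm, chartInvDeriv_eq hy]
  rfl

theorem coordForm_self {k : ℕ} (α : Form M k) (x : M) :
    coordForm α x (extChartAt (𝓡 7) x x) = α x := by
  rw [coordForm_eq α (mem_extChartAt_target x) (extChartAt_to_inv x),
    fderiv_tr_self (mem_extChartAt_target x)]
  rfl

theorem coordForm_tr {k : ℕ} (α : Form M k) {c c' : M} {y : E7}
    (hy : y ∈ (extChartAt (𝓡 7) c).target)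
    (hy' : (extChartAt (𝓡 7) c).symm y ∈ (extChartAt (𝓡 7) c').source) :
    coordForm α c y
      = (coordForm α c' (tr c c' y)).compContinuousLinearMap (fderiv ℝ (tr c c') y) := by
  rw [coordForm_eq α hy rfl, coordForm_eq α (tr_mem_target hy') (symm_tr hy'),
    ← fderiv_tr_comp hy hy' (mem_extChartAt_source _)]
  rfl

theorem IsPositive.coordForm {Ω : Form M 3} (h : ∀ x, IsPositive (Ω x)) {c : M} {y : E7}
    (hy : y ∈ (extChartAt (𝓡 7) c).target) : IsPositive (coordForm Ω c y) := by
  obtain ⟨e, he⟩ := exists_equiv_fderiv_tr hy (mem_extChartAt_source _)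
  have h1 : IsPositive (V := E7) (Ω ((extChartAt (𝓡 7) c).symm y)) := h _
  rw [coordForm_eq Ω hy rfl, ← he]
  exact h1.comp e

theorem IsSmoothForm.contDiffAt {k : ℕ} {α : Form M k} (h : IsSmoothForm α) {c : M} {y : E7}
    (hy : y ∈ (extChartAt (𝓡 7) c).target) : ContDiffAt ℝ ∞ (coordForm α c) y :=
  (h c).contDiffAt ((isOpen_extChartAt_target c).mem_nhds hy)

end Charts

end

section

attribute [local irreducible] stdForm actInv act

/-! ### The geometric quantities in charts -/

section Fields

variable {M : Type*} [TopologicalSpace M] [ChartedSpace E7 M] [IsManifold (𝓡 7) ∞ M]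
  {Ω : Form M 3}

theorem gram_eq (h : ∀ x, IsPositive (Ω x)) {c : M} {y : E7}
    (hy : y ∈ (extChartAt (𝓡 7) c).target) : gram Ω c y = gramMatrix (coordForm Ω c y) := by
  obtain ⟨e, he⟩ := exists_equiv_fderiv_tr hy (mem_extChartAt_source _)
  have h1 : IsPositive (V := E7) (Ω ((extChartAt (𝓡 7) c).symm y)) := h _
  ext i j
  have h2 := metric_comp h1 e (stdVec i) (stdVec j)
  rw [gramMatrix, Matrix.of_apply, coordForm_eq Ω hy rfl, ← he]
  refine Eq.trans ?_ h2.symm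
  rw [gram, Matrix.of_apply, chartInvDeriv_eq hy, ← he]
  rfl

/-- The 1-jet of a 3-form in a chart. -/
def jet (Ω : Form M 3) (c : M) (y : E7) : Lam × (E7 →L[ℝ] Lam) :=
  (coordForm Ω c y, fderiv ℝ (coordForm Ω c) y)

theorem sqrt_det_gram (h : ∀ x, IsPositive (Ω x)) {c : M} {y : E7}
    (hy : y ∈ (extChartAt (𝓡 7) c).target) :
    Real.sqrt (gram Ω c y).det = volDensity (coordForm Ω c y) := by
  rw [gram_eq h hy, volDensity]

theorem gramDeriv_eq (hΩ : IsG2Structure Ω) {c : M} {y : E7}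
    (hy : y ∈ (extChartAt (𝓡 7) c).target) (l i j : Fin 7) :
    gramDeriv Ω c y l i j = metricDeriv (coordForm Ω c y) (fderiv ℝ (coordForm Ω c) y (stdVec l))
      (stdVec i) (stdVec j) := by
  have h1 : (fun z => gram Ω c z i j) =ᶠ[𝓝 y]
      (fun s : Lam => metric s (stdVec i) (stdVec j)) ∘ coordForm Ω c := by
    filter_upwards [eventually_mem_target hy] with z hz
    rw [gram_eq hΩ.2 hz]
    rfl
  rw [gramDeriv, h1.fderiv_eq, fderiv_comp y
    (hasFDerivAt_metric (IsPositive.coordForm hΩ.2 hy) _ _).differentiableAt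
    ((hΩ.1.contDiffAt hy).differentiableAt (by simp))]
  rfl

theorem christoffelMap_eq (hΩ : IsG2Structure Ω) {c : M} {y : E7}
    (hy : y ∈ (extChartAt (𝓡 7) c).target) (u v : E7) :
    christoffelMap Ω c y u v = chrMap (coordForm Ω c y) (fderiv ℝ (coordForm Ω c) y) u v := by
  rw [chrMap_apply, christoffelMap]
  simp only [christoffel, chr, gramDeriv_eq hΩ hy, gram_eq hΩ.2 hy]

theorem covDeriv_eq (hΩ : IsG2Structure Ω) (x : M) (u : E7) (v : Fin 3 → E7) :
    covDeriv Ω Ω x u v = nabla (jet Ω x (extChartAt (𝓡 7) x x)).1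
      (jet Ω x (extChartAt (𝓡 7) x x)).2 u v := by
  rw [nabla_apply, ContinuousAlternatingMap.sub_apply, act_apply]
  simp only [covDeriv, jet]
  rw [chartDeriv_eq]
  simp only [christoffelMap_eq hΩ (mem_extChartAt_target x)]
  rfl

theorem positive_jet (h : ∀ x, IsPositive (Ω x)) {c : M} {y : E7}
    (hy : y ∈ (extChartAt (𝓡 7) c).target) : IsPositive (jet Ω c y).1 :=
  IsPositive.coordForm h hy

theorem jet_fst_self (Ω : Form M 3) (x : M) : (jet Ω x (extChartAt (𝓡 7) x x)).1 = Ω x :=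
  coordForm_self Ω x

/-- The integrand of the Dirichlet energy. -/
def energyAt (Ω : Form M 3) (x : M) : ℝ :=
  formNormSq (Ω x) (extD Ω x) + formNormSq (Ω x) (codiff Ω Ω x)

theorem energyAt_eq (hΩ : IsG2Structure Ω) (x : M) :
    energyAt Ω x = energy (jet Ω x (extChartAt (𝓡 7) x x)).1
      (nabla (jet Ω x (extChartAt (𝓡 7) x x)).1 (jet Ω x (extChartAt (𝓡 7) x x)).2) := by
  have hx := mem_extChartAt_target (I := 𝓡 7) x
  have hp := positive_jet hΩ.2 hx
  have h1 : extD Ω x = ContinuousAlternatingMap.alternatizeUncurryFin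
      (nabla (jet Ω x (extChartAt (𝓡 7) x x)).1 (jet Ω x (extChartAt (𝓡 7) x x)).2) := by
    rw [alternatizeUncurryFin_nabla hp, extD, chartDeriv_eq]
    rfl
  have h2 : codiff Ω Ω x = contraction (jet Ω x (extChartAt (𝓡 7) x x)).1
      (nabla (jet Ω x (extChartAt (𝓡 7) x x)).1 (jet Ω x (extChartAt (𝓡 7) x x)).2) := by
    ext v
    refine congrArg Neg.neg (Finset.sum_congr rfl fun i _ => (covDeriv_eq hΩ x _ _).trans ?_)
    have hf : frame (jet Ω x (extChartAt (𝓡 7) x x)).1 i = frame (Ω x) i :=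
      congrArg (fun s : Lam => frame s i) (jet_fst_self Ω x)
    rw [hf]
    rfl
  rw [energyAt, h1, h2, energy, jet_fst_self]
  rfl

theorem nabla_jet (hΩ : IsG2Structure Ω) {c c' : M} {y : E7}
    (hy : y ∈ (extChartAt (𝓡 7) c).target)
    (hy' : (extChartAt (𝓡 7) c).symm y ∈ (extChartAt (𝓡 7) c').source) (T : E7 ≃L[ℝ] E7)
    (hT : (T : E7 →L[ℝ] E7) = fderiv ℝ (tr c c') y) (u : E7) :
    nabla (jet Ω c y).1 (jet Ω c y).2 u
      = (nabla (jet Ω c' (tr c c' y)).1 (jet Ω c' (tr c c' y)).2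
        (T u)).compContinuousLinearMap (T : E7 →L[ℝ] E7) := by
  refine nabla_pullback ((contDiffAt_tr hy hy').of_le (by norm_cast))
    ((hΩ.1.contDiffAt (tr_mem_target hy')).differentiableAt (by simp))
    (positive_jet hΩ.2 (tr_mem_target hy')) T hT ?_ u
  filter_upwards [eventually_mem_target hy, eventually_symm_mem_source hy hy'] with z hz hz'
  exact coordForm_tr Ω hz hz'

/-- Each value of `energyAt` is defined in the preferred chart at its own point. Covariance of `∇Ω`
and naturality of the energy move the computation to one fixed chart, where regularity and
integration make sense. -/
theorem energy_jet (hΩ : IsG2Structure Ω) {c : M} {y : E7}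
    (hy : y ∈ (extChartAt (𝓡 7) c).target) :
    energy (jet Ω c y).1 (nabla (jet Ω c y).1 (jet Ω c y).2)
      = energyAt Ω ((extChartAt (𝓡 7) c).symm y) := by
  have hx := mem_extChartAt_source (I := 𝓡 7) ((extChartAt (𝓡 7) c).symm y)
  obtain ⟨T, hT⟩ := exists_equiv_fderiv_tr hy hx
  rw [energyAt_eq hΩ]
  have h1 := energy_comp (positive_jet hΩ.2 (tr_mem_target hx)) T (nabla_jet hΩ hy hx T hT)
  refine Eq.trans ?_ h1
  congr 1
  rw [hT]
  exact coordForm_tr Ω hy hx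

theorem energyDensity_jet (hΩ : IsG2Structure Ω) {c : M} {y : E7}
    (hy : y ∈ (extChartAt (𝓡 7) c).target) :
    energyDensity (jet Ω c y)
      = energyAt Ω ((extChartAt (𝓡 7) c).symm y) * volDensity (coordForm Ω c y) := by
  rw [energyDensity, energy_jet hΩ hy]
  rfl

theorem formInner_coordForm (h : ∀ x, IsPositive (Ω x)) {k : ℕ} (α β : Form M k) {c : M} {y : E7}
    (hy : y ∈ (extChartAt (𝓡 7) c).target) :
    formInner (coordForm Ω c y) (coordForm α c y) (coordForm β c y)
      = formInner (Ω ((extChartAt (𝓡 7) c).symm y)) (α ((extChartAt (𝓡 7) c).symm y))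
        (β ((extChartAt (𝓡 7) c).symm y)) := by
  obtain ⟨T, hT⟩ := exists_equiv_fderiv_tr hy (mem_extChartAt_source _)
  set x := (extChartAt (𝓡 7) c).symm y with hx
  have h1 : IsPositive (V := E7) (Ω x) := h _
  have h2 := formInner_comp h1 T (show E7 [⋀^Fin k]→L[ℝ] ℝ from α x).toMultilinearMap
    (show E7 [⋀^Fin k]→L[ℝ] ℝ from β x).toMultilinearMap
  rw [coordForm_eq Ω hy rfl, coordForm_eq α hy rfl, coordForm_eq β hy rfl, ← hT]
  exact h2

theorem isTorsionFree_iff (hΩ : IsG2Structure Ω) :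
    IsTorsionFree Ω ↔ ∀ x, energyAt Ω x = 0 := by
  refine forall_congr' fun x => ?_
  rw [energyAt_eq hΩ, energy_eq_zero_iff (positive_jet hΩ.2 (mem_extChartAt_target x))]
  refine ⟨fun h => ?_, fun h u v => ?_⟩
  · ext u v
    have := h u v
    rw [covDeriv_eq hΩ] at this
    exact this
  · refine (covDeriv_eq hΩ x u v).trans ?_
    rw [h]
    rfl

theorem energyAt_nonneg (hΩ : IsG2Structure Ω) (x : M) : 0 ≤ energyAt Ω x := by
  rw [energyAt_eq hΩ]
  exact energy_nonneg _ _

theorem covDerivNormSq_le (hΩ : IsG2Structure Ω) (x : M) :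
    covDerivNormSq Ω Ω x ≤ 2 * energyAt Ω x := by
  rw [energyAt_eq hΩ]
  refine le_trans (le_of_eq ?_)
    (sum_nabla_sq_le (positive_jet hΩ.2 (mem_extChartAt_target x)) _)
  rw [covDerivNormSq, jet_fst_self]
  refine Finset.sum_congr rfl fun i _ => ?_
  have : covDeriv Ω Ω x (frame (Ω x) i) = nabla (jet Ω x (extChartAt (𝓡 7) x x)).1
      (jet Ω x (extChartAt (𝓡 7) x x)).2 (frame (Ω x) i) := by
    ext v
    exact covDeriv_eq hΩ x _ v
  rw [this, jet_fst_self]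
  rfl

theorem continuousOn_volDensity (hΩ : IsG2Structure Ω) (c : M) :
    ContinuousOn (fun y => volDensity (coordForm Ω c y)) (extChartAt (𝓡 7) c).target := fun y hy =>
  ((contDiffAt_volDensity (IsPositive.coordForm hΩ.2 hy)).continuousAt.comp
    (hΩ.1.contDiffAt hy).continuousAt).continuousWithinAt

end Fields

end

section

attribute [local irreducible] stdForm actInv act

/-! ### Integration on `M` in charts -/

section Integration

variable {M : Type*} [TopologicalSpace M] [ChartedSpace E7 M]

/-- The part of a set in a chart domain, seen in the chart. -/
def piece (c : M) (A : Set M) : Set E7 :=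
  (extChartAt (𝓡 7) c).target ∩ (extChartAt (𝓡 7) c).symm ⁻¹' A

variable (M) in
/-- A finite partition of `M` into measurable sets, each of which is contained in a compact subset
of a chart domain. -/
structure Cover [MeasurableSpace M] where
  n : ℕ
  c : Fin n → M
  K : Fin n → Set M
  L : Fin n → Set M
  measurableSet_K : ∀ i, MeasurableSet (K i)
  disjoint_K : Pairwise (Function.onFun Disjoint K)
  iUnion_K : ⋃ i, K i = univ
  K_subset : ∀ i, K i ⊆ L i
  isCompact_L : ∀ i, IsCompact (L i)
  L_subset : ∀ i, L i ⊆ (extChartAt (𝓡 7) (c i)).source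

/-- Finitely many compact neighbourhoods inside chart domains cover `M`; removing from each the
preceding ones makes them disjoint. The compact sets supply the uniform bounds needed under the
integral. -/
theorem nonempty_cover [T2Space M] [CompactSpace M] [MeasurableSpace M] [BorelSpace M] :
    Nonempty (Cover M) := by
  have h1 : ∀ x : M, ∃ s ∈ 𝓝 x, s ⊆ (extChartAt (𝓡 7) x).source ∧ IsCompact s := fun x =>
    local_compact_nhds (extChartAt_source_mem_nhds x)
  choose L hL hLs hLc using h1
  obtain ⟨t, -, ht⟩ := isCompact_univ.elim_nhds_subcover L fun x _ => hL x
  set c : Fin t.card → M := fun i => (t.equivFin.symm i : M) with hc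
  refine ⟨⟨t.card, c, disjointed fun i => L (c i), fun i => L (c i), fun i => ?_,
    disjoint_disjointed _, ?_, fun i => disjointed_le _ i, fun i => hLc _, fun i => hLs _⟩⟩
  · have hm : ∀ j, MeasurableSet (L (c j)) := fun j => (hLc _).measurableSet
    rw [disjointed_apply]
    refine (hm i).diff ?_
    rw [Finset.sup_set_eq_biUnion]
    exact Finset.measurableSet_biUnion _ fun j _ => hm j
  · rw [iUnion_disjointed, eq_univ_iff_forall]
    intro x
    obtain ⟨y, hy, hxy⟩ := mem_iUnion₂.1 (ht (mem_univ x))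
    refine mem_iUnion.2 ⟨t.equivFin ⟨y, hy⟩, ?_⟩
    simpa [hc] using hxy

theorem piece_subset_image {c : M} {A B : Set M} (h : A ⊆ B) :
    piece c A ⊆ extChartAt (𝓡 7) c '' B := fun y hy =>
  ⟨_, h hy.2, (extChartAt (𝓡 7) c).right_inv hy.1⟩

theorem Cover.isCompact_image [MeasurableSpace M] (C : Cover M) (i : Fin C.n) :
    IsCompact (extChartAt (𝓡 7) (C.c i) '' C.L i) :=
  (C.isCompact_L i).image_of_continuousOn
    ((continuousOn_extChartAt (C.c i)).mono (C.L_subset i))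

theorem Cover.image_subset [MeasurableSpace M] (C : Cover M) (i : Fin C.n) :
    extChartAt (𝓡 7) (C.c i) '' C.L i ⊆ (extChartAt (𝓡 7) (C.c i)).target := by
  rintro _ ⟨x, hx, rfl⟩
  exact (extChartAt (𝓡 7) (C.c i)).map_source (C.L_subset i hx)

variable [MeasurableSpace M] [BorelSpace M]

theorem measurableSet_target (c : M) : MeasurableSet (extChartAt (𝓡 7) c).target :=
  (isOpen_extChartAt_target c).measurableSet

theorem measurableSet_piece (c : M) {A : Set M} (hA : MeasurableSet A) :
    MeasurableSet (piece c A) := by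
  have h1 : Measurable ((extChartAt (𝓡 7) c).target.restrict (extChartAt (𝓡 7) c).symm) :=
    (continuousOn_iff_continuous_restrict.1 (continuousOn_extChartAt_symm c)).measurable
  have h2 := MeasurableSet.subtype_image (measurableSet_target c) (h1 hA)
  convert h2 using 1
  ext y
  exact ⟨fun h => ⟨⟨y, h.1⟩, h.2, rfl⟩, by rintro ⟨z, hz, rfl⟩; exact ⟨z.2, hz⟩⟩

theorem aemeasurable_symm (c : M) :
    AEMeasurable (extChartAt (𝓡 7) c).symm (volume.restrict (extChartAt (𝓡 7) c).target) :=
  (continuousOn_extChartAt_symm c).aemeasurable (measurableSet_target c)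

variable [IsManifold (𝓡 7) ∞ M] {Ω : Form M 3}

theorem chartVolume_restrict (hΩ : IsG2Structure Ω) (c : M) {A : Set M} (hA : MeasurableSet A) :
    (chartVolume Ω c).restrict A = Measure.map (extChartAt (𝓡 7) c).symm
      ((volume.restrict (piece c A)).withDensity
        fun y => ENNReal.ofReal (volDensity (coordForm Ω c y))) := by
  have h1 : (volume.restrict (extChartAt (𝓡 7) c).target).withDensity
      (fun y => ENNReal.ofReal (Real.sqrt (gram Ω c y).det))
      = (volume.restrict (extChartAt (𝓡 7) c).target).withDensity
      (fun y => ENNReal.ofReal (volDensity (coordForm Ω c y))) := by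
    refine withDensity_congr_ae ?_
    filter_upwards [ae_restrict_mem (measurableSet_target c)] with y hy
    rw [sqrt_det_gram hΩ.2 hy]
  rw [chartVolume, h1, Measure.restrict_map_of_aemeasurable
    ((aemeasurable_symm c).mono_ac (withDensity_absolutelyContinuous _ _)) hA,
    restrict_withDensity', Measure.restrict_restrict' (measurableSet_target c), inter_comm]
  rfl

theorem aemeasurable_symm_piece (c : M) (A : Set M) (f : E7 → ENNReal) :
    AEMeasurable (extChartAt (𝓡 7) c).symm ((volume.restrict (piece c A)).withDensity f) :=
  ((aemeasurable_symm c).mono_measure (Measure.restrict_mono inter_subset_left le_rfl)).mono_ac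
    (withDensity_absolutelyContinuous _ _)

theorem chartVolume_apply (hΩ : IsG2Structure Ω) (c : M) {A : Set M} (hA : MeasurableSet A) :
    chartVolume Ω c A = ∫⁻ y in piece c A, ENNReal.ofReal (volDensity (coordForm Ω c y)) := by
  rw [← Measure.restrict_apply_univ, chartVolume_restrict hΩ c hA,
    Measure.map_apply_of_aemeasurable (aemeasurable_symm_piece c A _) MeasurableSet.univ,
    preimage_univ, withDensity_apply _ MeasurableSet.univ, Measure.restrict_univ]

theorem chartVolume_inter_source (hΩ : IsG2Structure Ω) (c : M) {A : Set M}
    (hA : MeasurableSet A) :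
    chartVolume Ω c (A ∩ (extChartAt (𝓡 7) c).source) = chartVolume Ω c A := by
  rw [chartVolume_apply hΩ c hA,
    chartVolume_apply hΩ c (hA.inter (isOpen_extChartAt_source c).measurableSet)]
  congr 2
  ext y
  exact ⟨fun h => ⟨h.1, h.2.1⟩, fun h => ⟨h.1, h.2, (extChartAt (𝓡 7) c).map_target h.1⟩⟩

/-- Change of variables: the Jacobian of the coordinate change is the factor by which `volDensity`
transforms. -/
theorem chartVolume_eq (hΩ : IsG2Structure Ω) (c c' : M) {A : Set M} (hA : MeasurableSet A)
    (hc : A ⊆ (extChartAt (𝓡 7) c).source) (hc' : A ⊆ (extChartAt (𝓡 7) c').source) :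
    chartVolume Ω c A = chartVolume Ω c' A := by
  have h1 : piece c' A = tr c c' '' piece c A := by
    ext z
    refine ⟨fun hz => ⟨tr c' c z, ⟨tr_mem_target (hc hz.2), ?_⟩, ?_⟩, ?_⟩
    · rw [mem_preimage, symm_tr (hc hz.2)]
      exact hz.2
    · rw [tr_tr c' (hc hz.2), tr_self hz.1]
    · rintro ⟨y, hy, rfl⟩
      refine ⟨tr_mem_target (hc' hy.2), ?_⟩
      rw [mem_preimage, symm_tr (hc' hy.2)]
      exact hy.2
  have h2 : InjOn (tr c c') (piece c A) := fun y hy z hz h => by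
    rw [← tr_self hy.1, ← tr_self hz.1, ← tr_tr c (hc' hy.2), h, tr_tr c (hc' hz.2)]
  rw [chartVolume_apply hΩ c hA, chartVolume_apply hΩ c' hA, h1,
    lintegral_image_eq_lintegral_abs_det_fderiv_mul volume (measurableSet_piece c hA)
      (fun y hy => (differentiableAt_tr hy.1 (hc' hy.2)).hasFDerivAt.hasFDerivWithinAt) h2]
  refine setLIntegral_congr_fun (measurableSet_piece c hA) fun y hy => ?_
  obtain ⟨e, he⟩ := exists_equiv_fderiv_tr hy.1 (hc' hy.2)
  rw [coordForm_tr Ω hy.1 (hc' hy.2), ← he,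
    volDensity_comp (IsPositive.coordForm hΩ.2 (tr_mem_target (hc' hy.2))),
    ENNReal.ofReal_mul (abs_nonneg _)]

/-- On each piece all chart volumes agree where defined, so the sum over the partition dominates
every chart volume. It is itself below their supremum, piece by piece. -/
theorem vol_eq (C : Cover M) (hΩ : IsG2Structure Ω) :
    vol Ω = ∑ i, (chartVolume Ω (C.c i)).restrict (C.K i) := by
  have hdec : ∀ (μ : Measure M) (A : Set M), MeasurableSet A → μ A = ∑ i, μ (A ∩ C.K i) := by
    intro μ A hA
    have h1 : A = ⋃ i ∈ (Finset.univ : Finset (Fin C.n)), A ∩ C.K i := by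
      simp [← inter_iUnion, C.iUnion_K]
    conv_lhs => rw [h1]
    refine measure_biUnion_finset ?_ fun i _ => hA.inter (C.measurableSet_K i)
    intro i _ j _ hij
    exact (C.disjoint_K hij).mono inter_subset_right inter_subset_right
  refine le_antisymm (iSup_le fun c => Measure.le_iff.2 fun A hA => ?_)
    (Measure.le_iff.2 fun A hA => ?_)
  · rw [Measure.finsetSum_apply]
    have hA' := hA.inter (isOpen_extChartAt_source (I := 𝓡 7) c).measurableSet
    rw [← chartVolume_inter_source hΩ c hA, hdec _ _ hA']
    refine Finset.sum_le_sum fun i _ => ?_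
    rw [Measure.restrict_apply hA, chartVolume_eq hΩ c (C.c i) (hA'.inter (C.measurableSet_K i))
      (fun x hx => hx.1.2) fun x hx => C.L_subset i (C.K_subset i hx.2)]
    exact measure_mono fun x hx => ⟨hx.1.1, hx.2⟩
  · rw [Measure.finsetSum_apply, hdec _ _ hA]
    refine Finset.sum_le_sum fun i _ => ?_
    rw [Measure.restrict_apply hA]
    exact Measure.le_iff'.1 (le_iSup (fun c => chartVolume Ω c) (C.c i)) _

theorem isFiniteMeasure_vol (C : Cover M) (hΩ : IsG2Structure Ω) : IsFiniteMeasure (vol Ω) := by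
  refine ⟨?_⟩
  rw [vol_eq C hΩ, Measure.finsetSum_apply]
  refine ENNReal.sum_lt_top.2 fun i _ => ?_
  rw [Measure.restrict_apply_univ, chartVolume_apply hΩ _ (C.measurableSet_K i)]
  refine Integrable.lintegral_lt_top ?_
  exact (((continuousOn_volDensity hΩ (C.c i)).mono (C.image_subset i)).integrableOn_compact
    (C.isCompact_image i)).mono_set (piece_subset_image (C.K_subset i))

variable [CompactSpace M]

theorem integrable_vol (C : Cover M) (hΩ : IsG2Structure Ω) {f : M → ℝ} (hf : Continuous f) :
    Integrable f (vol Ω) :=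
  have := isFiniteMeasure_vol C hΩ
  hf.integrable_of_hasCompactSupport (HasCompactSupport.of_compactSpace f)

theorem integral_vol (C : Cover M) (hΩ : IsG2Structure Ω) {f : M → ℝ} (hf : Continuous f) :
    ∫ x, f x ∂(vol Ω) = ∑ i, ∫ y in piece (C.c i) (C.K i),
      f ((extChartAt (𝓡 7) (C.c i)).symm y) * volDensity (coordForm Ω (C.c i) y) := by
  have hint := integrable_vol C hΩ hf
  have hle : ∀ i, (chartVolume Ω (C.c i)).restrict (C.K i) ≤ vol Ω := fun i =>
    Measure.restrict_le_self.trans (le_iSup (fun c => chartVolume Ω c) (C.c i))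
  conv_lhs => rw [vol_eq C hΩ]
  rw [integral_finsetSum_measure fun i _ => hint.mono_measure (hle i)]
  refine Finset.sum_congr rfl fun i _ => ?_
  have hs : piece (C.c i) (C.K i) ⊆ (extChartAt (𝓡 7) (C.c i)).target := inter_subset_left
  rw [chartVolume_restrict hΩ _ (C.measurableSet_K i),
    integral_map (aemeasurable_symm_piece _ _ _) hf.aestronglyMeasurable,
    integral_withDensity_eq_integral_toReal_smul₀]
  · refine setIntegral_congr_fun (measurableSet_piece _ (C.measurableSet_K i)) fun y hy => ?_
    rw [ENNReal.toReal_ofReal (volDensity_pos (IsPositive.coordForm hΩ.2 (hs hy))).le, smul_eq_mul,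
      mul_comm]
  · exact (((continuousOn_volDensity hΩ _).mono hs).aemeasurable
      (measurableSet_piece _ (C.measurableSet_K i))).ennreal_ofReal
  · exact Filter.Eventually.of_forall fun y => ENNReal.ofReal_lt_top

end Integration

end

section

/-! ### Differentiation of integrals of Lagrangians along families -/

/-- The derivative of a function at `x` in the direction `v`. -/
def dirDeriv {X : Type*} [NormedAddCommGroup X] [NormedSpace ℝ X] (F : X → ℝ) (x v : X) : ℝ :=
  fderiv ℝ F x v

theorem dirDeriv_comp_fst {X Y : Type*} [NormedAddCommGroup X] [NormedSpace ℝ X]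
    [NormedAddCommGroup Y] [NormedSpace ℝ Y] {f : X → ℝ} {j : X × Y}
    (hf : DifferentiableAt ℝ f j.1) (q : X × Y) :
    dirDeriv (fun i : X × Y => f i.1) j q = fderiv ℝ f j.1 q.1 := by
  have h1 : HasFDerivAt (fun i : X × Y => f i.1)
      ((fderiv ℝ f j.1).comp (ContinuousLinearMap.fst ℝ X Y)) j :=
    hf.hasFDerivAt.comp j hasFDerivAt_fst
  rw [dirDeriv, h1.fderiv]
  rfl

section Variation

variable {E G : Type*} [NormedAddCommGroup E] [NormedSpace ℝ E] [NormedAddCommGroup G]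
  [NormedSpace ℝ G] {J : Set ℝ} {U : Set E} {σ : ℝ × E → G}

/-- The 1-jet in the space direction of a family of fields. -/
def spaceJet (σ : ℝ × E → G) (t : ℝ) (y : E) : G × (E →L[ℝ] G) :=
  (σ (t, y), fderiv ℝ (fun z => σ (t, z)) y)

theorem hasFDerivAt_slice (hU : IsOpen U) {H : Type*}
    [NormedAddCommGroup H] [NormedSpace ℝ H] {f : ℝ × E → H} (hf : ContDiffOn ℝ ∞ f (J ×ˢ U))
    {t : ℝ} {y : E} (ht : t ∈ J) (hy : y ∈ U) :
    HasFDerivAt (fun z => f (t, z))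
      ((fderivWithin ℝ f (J ×ˢ U) (t, y)).comp (ContinuousLinearMap.inr ℝ ℝ E)) y := by
  have h1 := ((hf.differentiableOn (by simp)) (t, y) ⟨ht, hy⟩).hasFDerivWithinAt
  have h2 : HasFDerivWithinAt (fun z : E => (t, z)) (ContinuousLinearMap.inr ℝ ℝ E) U y :=
    (hasFDerivAt_prodMk_right t y).hasFDerivWithinAt
  exact (h1.comp y h2 fun z hz => ⟨ht, hz⟩).hasFDerivAt (hU.mem_nhds hy)

theorem hasDerivWithinAt_slice {H : Type*}
    [NormedAddCommGroup H] [NormedSpace ℝ H] {f : ℝ × E → H} (hf : ContDiffOn ℝ ∞ f (J ×ˢ U))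
    {t : ℝ} {y : E} (ht : t ∈ J) (hy : y ∈ U) :
    HasDerivWithinAt (fun τ => f (τ, y)) (fderivWithin ℝ f (J ×ˢ U) (t, y) (1, 0)) J t := by
  have h1 := ((hf.differentiableOn (by simp)) (t, y) ⟨ht, hy⟩).hasFDerivWithinAt
  have h2 : HasFDerivWithinAt (fun τ : ℝ => (τ, y)) (ContinuousLinearMap.inl ℝ ℝ E) J t :=
    (hasFDerivAt_prodMk_left t y).hasFDerivWithinAt
  have hm : MapsTo (fun τ : ℝ => (τ, y)) J (J ×ˢ U) := fun z hz => ⟨hz, hy⟩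
  have h3 : HasDerivWithinAt (fun τ => f (τ, y)) _ J t :=
    (h1.comp (f := fun τ : ℝ => (τ, y)) t h2 hm).hasDerivWithinAt
  simpa using h3

theorem continuousOn_spaceJet (hJ : UniqueDiffOn ℝ J) (hU : IsOpen U)
    (hσ : ContDiffOn ℝ ∞ σ (J ×ˢ U)) :
    ContinuousOn (fun p : ℝ × E => spaceJet σ p.1 p.2) (J ×ˢ U) := by
  have hs : UniqueDiffOn ℝ (J ×ˢ U) := hJ.prod hU.uniqueDiffOn
  have h1 : ContinuousOn (fun p => (σ p, (fderivWithin ℝ σ (J ×ˢ U) p).comp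
      (ContinuousLinearMap.inr ℝ ℝ E))) (J ×ˢ U) :=
    hσ.continuousOn.prodMk ((hσ.continuousOn_fderivWithin hs (by simp)).clm_comp continuousOn_const)
  refine h1.congr fun p hp => ?_
  rw [spaceJet, (hasFDerivAt_slice hU hσ hp.1 hp.2).fderiv]

/-- Symmetry of second derivatives identifies the time derivative of the space jet with the jet of
the time derivative. The hypothesis on `closure (interior J)` secures this symmetry at endpoints of
the time interval. -/
theorem exists_hasDerivWithinAt_spaceJet (hJ : UniqueDiffOn ℝ J) (hJc : J ⊆ closure (interior J))
    (hU : IsOpen U) (hσ : ContDiffOn ℝ ∞ σ (J ×ˢ U)) :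
    ∃ j : ℝ → E → G × (E →L[ℝ] G), ContinuousOn (fun p : ℝ × E => j p.1 p.2) (J ×ˢ U) ∧
      (∀ t ∈ J, ∀ y ∈ U, HasDerivWithinAt (fun τ => spaceJet σ τ y) (j t y) J t) ∧
      ∀ q : E → G, ∀ t ∈ J, (∀ y ∈ U, HasDerivWithinAt (fun τ => σ (τ, y)) (q y) J t) →
        ∀ y ∈ U, j t y = (q y, fderiv ℝ q y) := by
  have hs : UniqueDiffOn ℝ (J ×ˢ U) := hJ.prod hU.uniqueDiffOn
  set σ' := fderivWithin ℝ σ (J ×ˢ U) with hσ'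
  have hσ1 : ContDiffOn ℝ ∞ σ' (J ×ˢ U) := hσ.fderivWithin hs (by simp)
  set σ'' := fderivWithin ℝ σ' (J ×ˢ U) with hσ''
  have hσ2 : ContinuousOn σ'' (J ×ˢ U) := hσ1.continuousOn_fderivWithin hs (by simp)
  refine ⟨fun t y => (σ' (t, y) (1, 0),
    (σ'' (t, y) (1, 0)).comp (ContinuousLinearMap.inr ℝ ℝ E)), ?_, fun t ht y hy => ?_,
    fun q t ht hq y hy => ?_⟩
  · exact (hσ1.continuousOn.clm_apply continuousOn_const).prodMk
      ((hσ2.clm_apply continuousOn_const).clm_comp continuousOn_const)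
  · have h1 := hasDerivWithinAt_slice hσ ht hy
    have h2 := hasDerivWithinAt_slice hσ1 ht hy
    have h3 : HasDerivWithinAt (fun τ => (σ' (τ, y)).comp (ContinuousLinearMap.inr ℝ ℝ E))
        ((σ'' (t, y) (1, 0)).comp (ContinuousLinearMap.inr ℝ ℝ E)) J t := by
      have := h2.clm_comp (hasDerivWithinAt_const t J (ContinuousLinearMap.inr ℝ ℝ E))
      simpa using this
    refine (h1.prodMk h3).congr (fun τ hτ => ?_) ?_
    · rw [spaceJet, (hasFDerivAt_slice hU hσ hτ hy).fderiv]
    · rw [spaceJet, (hasFDerivAt_slice hU hσ ht hy).fderiv]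
  · have h1 : ∀ z ∈ U, q z = σ' (t, z) (1, 0) := fun z hz =>
      (hJ t ht).eq_deriv _ (hq z hz) (hasDerivWithinAt_slice hσ ht hz)
    have h2 := (hasFDerivAt_slice hU hσ1 ht hy).clm_apply
      (hasFDerivAt_const ((1 : ℝ), (0 : E)) y)
    have h3 : q =ᶠ[𝓝 y] fun z => σ' (t, z) (1, 0) := by
      filter_upwards [hU.mem_nhds hy] with z hz
      exact h1 z hz
    have hsymm : IsSymmSndFDerivWithinAt ℝ σ (J ×ˢ U) (t, y) := by
      refine (hσ (t, y) ⟨ht, hy⟩).isSymmSndFDerivWithinAt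
        (by rw [minSmoothness_of_isRCLikeNormedField]; norm_cast) hs ?_ ⟨ht, hy⟩
      rw [interior_prod_eq, closure_prod_eq, hU.interior_eq]
      exact ⟨hJc ht, subset_closure hy⟩
    refine Prod.ext (h1 y hy).symm ?_
    rw [h3.fderiv_eq, h2.fderiv]
    ext v
    simpa using hsymm (1, 0) (0, v)

/-! ### Differentiation under the integral sign -/

variable [MeasurableSpace E] [BorelSpace E] {μ : Measure E} [IsFiniteMeasureOnCompacts μ]

/-- Dominated convergence for difference quotients: by the mean value inequality they are bounded by
the maximum of `|g'|` on the compact set `[a, b] × K`. Endpoints are included, giving one-sided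
derivatives. -/
theorem hasDerivWithinAt_setIntegral {a b : ℝ} {K S : Set E} (hK : IsCompact K)
    (hKU : K ⊆ U) (hS : MeasurableSet S) (hSK : S ⊆ K) {g g' : ℝ → E → ℝ}
    (hg : ∀ t ∈ Icc a b, ContinuousOn (g t) U)
    (hg' : ContinuousOn (fun p : ℝ × E => g' p.1 p.2) (Icc a b ×ˢ U))
    (h : ∀ t ∈ Icc a b, ∀ y ∈ U, HasDerivWithinAt (fun τ => g τ y) (g' t y) (Icc a b) t)
    {t₀ : ℝ} (ht₀ : t₀ ∈ Icc a b) :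
    HasDerivWithinAt (fun t => ∫ y in S, g t y ∂μ) (∫ y in S, g' t₀ y ∂μ) (Icc a b) t₀ := by
  obtain ⟨B, hB⟩ := (isCompact_Icc.prod hK).exists_bound_of_continuousOn
    (hg'.mono (prod_mono_right hKU))
  have hfin : μ S < ⊤ := (measure_mono hSK).trans_lt hK.measure_lt_top
  have hint : ∀ t ∈ Icc a b, IntegrableOn (g t) S μ := fun t ht =>
    (((hg t ht).mono hKU).integrableOn_compact hK).mono_set hSK
  rw [hasDerivWithinAt_iff_tendsto_slope]
  have h1 : ∀ᶠ t in 𝓝[Icc a b \ {t₀}] t₀, ∫ y in S, slope (fun τ => g τ y) t₀ t ∂μ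
      = slope (fun t => ∫ y in S, g t y ∂μ) t₀ t := by
    filter_upwards [self_mem_nhdsWithin] with t ht
    simp only [slope_def_field]
    rw [integral_div, integral_sub (hint t ht.1) (hint t₀ ht₀)]
  refine Filter.Tendsto.congr' h1 ?_
  refine tendsto_integral_filter_of_dominated_convergence (fun _ => B) ?_ ?_ ?_ ?_
  · filter_upwards [self_mem_nhdsWithin] with t ht
    simp only [slope_def_field]
    exact (((hint t ht.1).sub (hint t₀ ht₀)).div_const _).aestronglyMeasurable
  · filter_upwards [self_mem_nhdsWithin] with t ht
    filter_upwards [ae_restrict_mem hS] with y hy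
    have h2 := (convex_Icc a b).norm_image_sub_le_of_norm_hasDerivWithin_le
      (fun τ hτ => h τ hτ y (hKU (hSK hy))) (fun τ hτ => hB (τ, y) ⟨hτ, hSK hy⟩) ht₀ ht.1
    rw [slope_def_field, norm_div]
    refine div_le_of_le_mul₀ (norm_nonneg _) ((norm_nonneg _).trans (hB (t₀, y) ⟨ht₀, hSK hy⟩)) h2
  · exact integrableOn_const hfin.ne
  · filter_upwards [ae_restrict_mem hS] with y hy
    exact hasDerivWithinAt_iff_tendsto_slope.1 (h t₀ ht₀ y (hKU (hSK hy)))

/-- Differentiation of the integral of a Lagrangian along a family of fields. -/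
theorem hasDerivWithinAt_integral_spaceJet {a b : ℝ} (hab : a < b) (hU : IsOpen U) {K S : Set E}
    (hK : IsCompact K) (hKU : K ⊆ U) (hS : MeasurableSet S) (hSK : S ⊆ K)
    (hσ : ContDiffOn ℝ ∞ σ (Icc a b ×ˢ U)) {F : G × (E →L[ℝ] G) → ℝ}
    (hF : ∀ t ∈ Icc a b, ∀ y ∈ U, ContDiffAt ℝ ∞ F (spaceJet σ t y)) {t₀ : ℝ}
    (ht₀ : t₀ ∈ Icc a b) {q : E → G}
    (hq : ∀ y ∈ U, HasDerivWithinAt (fun τ => σ (τ, y)) (q y) (Icc a b) t₀) :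
    HasDerivWithinAt (fun t => ∫ y in S, F (spaceJet σ t y) ∂μ)
      (∫ y in S, dirDeriv F (spaceJet σ t₀ y) (q y, fderiv ℝ q y) ∂μ) (Icc a b) t₀ := by
  have hJ := uniqueDiffOn_Icc hab
  have hJc : Icc a b ⊆ closure (interior (Icc a b)) := by
    rw [interior_Icc, closure_Ioo hab.ne]
  obtain ⟨j, hj, hjd, hjq⟩ := exists_hasDerivWithinAt_spaceJet hJ hJc hU hσ
  have hsj := continuousOn_spaceJet hJ hU hσ
  have h1 := hasDerivWithinAt_setIntegral (μ := μ) (g := fun t y => F (spaceJet σ t y))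
    (g' := fun t y => fderiv ℝ F (spaceJet σ t y) (j t y)) hK hKU hS hSK
    (fun t ht y hy => ?_) ?_ (fun t ht y hy => ?_) ht₀
  · have h2 : ∫ y in S, fderiv ℝ F (spaceJet σ t₀ y) (j t₀ y) ∂μ
        = ∫ y in S, dirDeriv F (spaceJet σ t₀ y) (q y, fderiv ℝ q y) ∂μ :=
      setIntegral_congr_fun hS fun y hy => by
        simp only [dirDeriv, hjq q t₀ ht₀ hq y (hKU (hSK hy))]
    rwa [h2] at h1
  · have h2 : ContinuousWithinAt (fun z => spaceJet σ t z) U y :=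
      (hsj (t, y) ⟨ht, hy⟩).comp (f := fun z : E => (t, z))
        (Continuous.continuousWithinAt (by fun_prop)) fun z hz => ⟨ht, hz⟩
    exact (hF t ht y hy).continuousAt.comp_continuousWithinAt h2
  · intro p hp
    have h2 : ContinuousAt (fderiv ℝ F) (spaceJet σ p.1 p.2) :=
      ((hF p.1 hp.1 p.2 hp.2).fderiv_right (m := 0) (by simp)).continuousAt
    exact (ContinuousAt.comp_continuousWithinAt (f := fun p : ℝ × E => spaceJet σ p.1 p.2) h2
      (hsj p hp)).clm_apply (hj p hp)
  · exact ((hF t ht y hy).differentiableAt (by simp)).hasFDerivAt.comp_hasDerivWithinAt t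
      (hjd t ht y hy)

end Variation

end

section

attribute [local irreducible] stdForm actInv act

/-! ### The first variation of the functionals -/

section Functionals

variable {M : Type*} [TopologicalSpace M] [ChartedSpace E7 M]

theorem coordForm_add {k : ℕ} (α β : Form M k) (c : M) (y : E7) :
    coordForm (α + β) c y = coordForm α c y + coordForm β c y := by
  ext v; rfl

theorem coordForm_smul {k : ℕ} (s : ℝ) (α : Form M k) (c : M) (y : E7) :
    coordForm (s • α) c y = s • coordForm α c y := by
  ext v; rfl

theorem IsSmoothForm.add {k : ℕ} {α β : Form M k} (hα : IsSmoothForm α) (hβ : IsSmoothForm β) :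
    IsSmoothForm (α + β) := fun c =>
  ((hα c).add (hβ c)).congr fun y _ => coordForm_add α β c y

theorem IsSmoothForm.smul {k : ℕ} {α : Form M k} (hα : IsSmoothForm α) (s : ℝ) :
    IsSmoothForm (s • α) := fun c =>
  ((hα c).const_smul s).congr fun y _ => coordForm_smul s α c y

variable [IsManifold (𝓡 7) ∞ M] {Ω : Form M 3}

theorem continuous_of_chart {f : M → ℝ} (g : M → E7 → ℝ)
    (h : ∀ c, ∀ y ∈ (extChartAt (𝓡 7) c).target, f ((extChartAt (𝓡 7) c).symm y) = g c y)
    (hg : ∀ c, ContinuousOn (g c) (extChartAt (𝓡 7) c).target) : Continuous f := by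
  refine continuous_iff_continuousAt.2 fun x => ?_
  have h1 : f =ᶠ[𝓝 x] g x ∘ extChartAt (𝓡 7) x := by
    filter_upwards [extChartAt_source_mem_nhds (I := 𝓡 7) x] with z hz
    rw [Function.comp_apply, ← h x _ ((extChartAt (𝓡 7) x).map_source hz),
      (extChartAt (𝓡 7) x).left_inv hz]
  refine ContinuousAt.congr ?_ h1.symm
  exact ((hg x).continuousAt (extChartAt_target_mem_nhds x)).comp (continuousAt_extChartAt x)

theorem contDiffAt_jet {α : Form M 3} (h : IsSmoothForm α) {c : M} {y : E7}
    (hy : y ∈ (extChartAt (𝓡 7) c).target) : ContDiffAt ℝ ∞ (jet α c) y :=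
  (h.contDiffAt hy).prodMk ((h.contDiffAt hy).fderiv_right (by simp))

theorem continuous_energyAt (hΩ : IsG2Structure Ω) : Continuous (energyAt Ω) := by
  refine continuous_of_chart
    (fun c y => energyDensity (jet Ω c y) / volDensity (coordForm Ω c y)) (fun c y hy => ?_)
    fun c => ContinuousOn.div (fun y hy => ?_) (continuousOn_volDensity hΩ c)
      fun y hy => (volDensity_pos (IsPositive.coordForm hΩ.2 hy)).ne'
  · rw [energyDensity_jet hΩ hy,
      mul_div_cancel_right₀ _ (volDensity_pos (IsPositive.coordForm hΩ.2 hy)).ne']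
  · exact ((contDiffAt_energyDensity (positive_jet hΩ.2 hy)).continuousAt.comp
      (contDiffAt_jet hΩ.1 hy).continuousAt).continuousWithinAt

/-- By `fderiv_volDensity` the pairing with `Ω` is three times the logarithmic derivative of the
volume density, an expression free of frames. -/
theorem continuous_formInner (hΩ : IsG2Structure Ω) {α : Form M 3} (hα : IsSmoothForm α) :
    Continuous fun x => formInner (Ω x) (α x) (Ω x) := by
  refine continuous_of_chart
    (fun c y => 3 * fderiv ℝ volDensity (coordForm Ω c y) (coordForm α c y)
      / volDensity (coordForm Ω c y)) (fun c y hy => ?_)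
    fun c => ContinuousOn.div (continuousOn_const.mul fun y hy => ?_)
      (continuousOn_volDensity hΩ c)
      fun y hy => (volDensity_pos (IsPositive.coordForm hΩ.2 hy)).ne'
  · have hp := IsPositive.coordForm hΩ.2 hy
    have := (volDensity_pos hp).ne'
    rw [← formInner_coordForm hΩ.2 α Ω hy, fderiv_volDensity hp]
    field_simp
  · have h1 : ContinuousAt (fderiv ℝ volDensity) (coordForm Ω c y) :=
      ((contDiffAt_volDensity (IsPositive.coordForm hΩ.2 hy)).fderiv_right
        (m := 0) (by simp)).continuousAt
    exact ((ContinuousAt.comp (f := coordForm Ω c) h1 (hΩ.1.contDiffAt hy).continuousAt).clm_apply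
      (hα.contDiffAt hy).continuousAt).continuousWithinAt

theorem isPositive_of_coordForm {c : M} {x : M} (hx : x ∈ (extChartAt (𝓡 7) c).source)
    (h : IsPositive (coordForm Ω c (extChartAt (𝓡 7) c x))) : IsPositive (Ω x) := by
  have hy := (extChartAt (𝓡 7) c).map_source hx
  have hxy := (extChartAt (𝓡 7) c).left_inv hx
  obtain ⟨e, he⟩ := exists_equiv_fderiv_tr (c' := x) hy (by rw [hxy]; exact mem_extChartAt_source x)
  rw [coordForm_eq Ω hy hxy, ← he] at h
  have h1 := h.comp e.symm
  refine (congrArg (IsPositive (V := E7)) (ContinuousAlternatingMap.ext fun v => ?_)).mp h1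
  change Ω x (fun a => e (e.symm (v a))) = Ω x v
  simp_rw [e.apply_symm_apply]

theorem IsG2Structure.smul (hΩ : IsG2Structure Ω) {μ : ℝ} (hμ : μ ≠ 0) :
    IsG2Structure (μ ^ 3 • Ω) :=
  have h : ∀ σ : Lam, IsPositive σ → IsPositive (μ ^ 3 • σ) := fun _ hσ => hσ.smul hμ
  ⟨hΩ.1.smul _, fun x => h (Ω x) (hΩ.2 x)⟩

/-! ### Stability of positivity and variation of integrated Lagrangians -/

variable [MeasurableSpace M]

/-- Small perturbations of a positive form are positive. -/
theorem exists_isG2Structure_add_smul (C : Cover M) (hΩ : IsG2Structure Ω) {η : Form M 3}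
    (hη : IsSmoothForm η) :
    ∃ ε : ℝ, 0 < ε ∧ ∀ s ∈ Icc (-ε) ε, IsG2Structure (Ω + s • η) := by
  have h1 : ∀ i : Fin C.n, ∀ᶠ s : ℝ in 𝓝 0, ∀ y ∈ extChartAt (𝓡 7) (C.c i) '' C.L i,
      IsPositive (coordForm (Ω + s • η) (C.c i) y) := by
    intro i
    set U := (extChartAt (𝓡 7) (C.c i)).target
    have hcont : ContinuousOn (fun p : ℝ × E7 => coordForm Ω (C.c i) p.2
        + p.1 • coordForm η (C.c i) p.2) (univ ×ˢ U) := by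
      have h2 : MapsTo (Prod.snd : ℝ × E7 → E7) (univ ×ˢ U) U := fun p hp => hp.2
      exact ((hΩ.1 (C.c i)).continuousOn.comp continuousOn_snd h2).add
        (continuousOn_fst.smul ((hη (C.c i)).continuousOn.comp continuousOn_snd h2))
    have hopen := hcont.isOpen_inter_preimage
      (isOpen_univ.prod (isOpen_extChartAt_target (C.c i))) isOpen_isPositive
    -- Positivity is open in `(s, y)` and holds for `s = 0` on a compact set, so the tube lemma
    -- gives a uniform range of `s`.
    obtain ⟨u, v, hu, -, h0u, hKv, huv⟩ := generalized_tube_lemma (s := {(0 : ℝ)})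
      isCompact_singleton (C.isCompact_image i) hopen (by
        rintro ⟨s, y⟩ ⟨hs, hy⟩
        have hyU := C.image_subset i hy
        refine ⟨⟨mem_univ _, hyU⟩, ?_⟩
        obtain rfl : s = 0 := hs
        change IsPositive (coordForm Ω (C.c i) y + (0 : ℝ) • coordForm η (C.c i) y)
        rw [zero_smul, add_zero]
        exact IsPositive.coordForm hΩ.2 hyU)
    filter_upwards [hu.mem_nhds (h0u rfl)] with s hs y hy
    have h3 := (huv (mk_mem_prod hs (hKv hy))).2
    rw [coordForm_add, coordForm_smul]
    exact h3
  obtain ⟨ε, hε, hball⟩ := Metric.eventually_nhds_iff.1 (Filter.eventually_all.2 h1)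
  refine ⟨ε / 2, half_pos hε, fun s hs => ⟨hΩ.1.add (hη.smul s), fun x => ?_⟩⟩
  obtain ⟨i, hi⟩ := mem_iUnion.1 (C.iUnion_K ▸ mem_univ x : x ∈ ⋃ i, C.K i)
  have hL := C.K_subset i hi
  refine isPositive_of_coordForm (C.L_subset i hL) (hball ?_ i _ (mem_image_of_mem _ hL))
  rw [Real.dist_eq, sub_zero]
  exact (abs_le.2 hs).trans_lt (half_lt_self hε)

/-- The integral of a Lagrangian, computed in the charts of a cover. -/
def action (C : Cover M) (F : Lam × (E7 →L[ℝ] Lam) → ℝ) (Ω : Form M 3) : ℝ :=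
  ∑ i, ∫ y in piece (C.c i) (C.K i), F (jet Ω (C.c i) y)

/-- The first variation of the integral of a Lagrangian. -/
def actionDeriv (C : Cover M) (F : Lam × (E7 →L[ℝ] Lam) → ℝ) (Ω Q : Form M 3) : ℝ :=
  ∑ i, ∫ y in piece (C.c i) (C.K i), dirDeriv F (jet Ω (C.c i) y) (jet Q (C.c i) y)

variable [BorelSpace M]

theorem hasDerivWithinAt_action (C : Cover M) {F : Lam × (E7 →L[ℝ] Lam) → ℝ}
    (hF : ∀ j, IsPositive j.1 → ContDiffAt ℝ ∞ F j) {a b : ℝ} (hab : a < b) {Ω : ℝ → Form M 3}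
    (hs : IsSmoothFamily (Icc a b) Ω) (hp : ∀ t ∈ Icc a b, IsG2Structure (Ω t)) {t₀ : ℝ}
    (ht₀ : t₀ ∈ Icc a b) {Q : Form M 3} (hQ : ∀ (x : M) (v : Fin 3 → TangentSpace (𝓡 7) x),
      HasDerivWithinAt (fun s => Ω s x v) (Q x v) (Icc a b) t₀) :
    HasDerivWithinAt (fun t => action C F (Ω t)) (actionDeriv C F (Ω t₀) Q) (Icc a b) t₀ := by
  refine HasDerivWithinAt.fun_sum fun i _ => ?_
  refine hasDerivWithinAt_integral_spaceJet (μ := volume)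
    (σ := fun p : ℝ × E7 => coordForm (Ω p.1) (C.c i) p.2) hab
    (isOpen_extChartAt_target (C.c i)) (C.isCompact_image i) (C.image_subset i)
    (measurableSet_piece _ (C.measurableSet_K i)) (piece_subset_image (C.K_subset i)) (hs (C.c i))
    (fun t ht y hy => hF _ (IsPositive.coordForm (hp t ht).2 hy)) ht₀
    (q := coordForm Q (C.c i)) fun y hy => ?_
  have h1 := hasDerivWithinAt_slice (hs (C.c i)) ht₀ hy
  convert h1 using 1
  -- The flow equation is assumed for each fixed argument `v` only; smoothness of the family already
  -- gives a derivative as a form, and evaluation at `v` identifies it with `Q`.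
  ext v
  have h2 := (ContinuousAlternatingMap.apply ℝ E7 ℝ v).hasFDerivAt.comp_hasDerivWithinAt t₀ h1
  exact (uniqueDiffOn_Icc hab t₀ ht₀).eq_deriv _ (hQ _ _) h2

theorem hasDerivAt_action_add_smul (C : Cover M) {F : Lam × (E7 →L[ℝ] Lam) → ℝ}
    (hF : ∀ j, IsPositive j.1 → ContDiffAt ℝ ∞ F j) (hΩ : IsG2Structure Ω) {η : Form M 3}
    (hη : IsSmoothForm η) :
    HasDerivAt (fun s : ℝ => action C F (Ω + s • η)) (actionDeriv C F Ω η) 0 := by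
  obtain ⟨ε, hε, hp⟩ := exists_isG2Structure_add_smul C hΩ hη
  have h0 : (0 : ℝ) ∈ Icc (-ε) ε := ⟨by linarith, hε.le⟩
  have h1 := hasDerivWithinAt_action C hF (a := -ε) (b := ε) (by linarith)
    (Ω := fun s : ℝ => Ω + s • η) (t₀ := 0) (Q := η) (fun c => ?_) hp h0 fun x v => ?_
  · have h2 := h1.hasDerivAt (Icc_mem_nhds (by linarith) hε)
    have h3 : Ω + (0 : ℝ) • η = Ω := by rw [zero_smul, add_zero]
    rwa [h3] at h2
  · have h2 : MapsTo (Prod.snd : ℝ × E7 → E7) (Icc (-ε) ε ×ˢ (extChartAt (𝓡 7) c).target)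
      (extChartAt (𝓡 7) c).target := fun p hp => hp.2
    refine (((hΩ.1 c).comp contDiffOn_snd h2).add
      (contDiffOn_fst.smul ((hη c).comp contDiffOn_snd h2))).congr fun p _ => ?_
    rw [coordForm_add, coordForm_smul]
    rfl
  · have h2 : HasDerivAt (fun s : ℝ => Ω x v + s * η x v) (η x v) 0 := by
      simpa using ((hasDerivAt_id (0 : ℝ)).mul_const (η x v)).const_add (Ω x v)
    exact h2.hasDerivWithinAt

/-! ### The functionals, their first variations and the Sobolev bound -/

variable [CompactSpace M]

theorem dirichletEnergy_eq (C : Cover M) (hΩ : IsG2Structure Ω) :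
    dirichletEnergy Ω = 1 / 2 * action C energyDensity Ω := by
  rw [dirichletEnergy, action]
  congr 1
  refine (integral_vol C hΩ (continuous_energyAt hΩ)).trans ?_
  refine Finset.sum_congr rfl fun i _ => setIntegral_congr_fun
    (measurableSet_piece _ (C.measurableSet_K i)) fun y hy => ?_
  exact (energyDensity_jet hΩ hy.1).symm

theorem hitchin_eq (C : Cover M) (hΩ : IsG2Structure Ω) :
    hitchin Ω = action C (fun j => volDensity j.1) Ω := by
  rw [hitchin, action]
  refine (integral_vol C hΩ continuous_const).trans ?_
  simp only [one_mul]
  rfl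

theorem contDiffAt_volDensity_fst (j : Lam × (E7 →L[ℝ] Lam)) (h : IsPositive j.1) :
    ContDiffAt ℝ ∞ (fun j : Lam × (E7 →L[ℝ] Lam) => volDensity j.1) j :=
  (contDiffAt_volDensity h).comp j contDiffAt_fst

theorem actionDeriv_volDensity (C : Cover M) (hΩ : IsG2Structure Ω) {Q : Form M 3}
    (hQ : IsSmoothForm Q) :
    actionDeriv C (fun j => volDensity j.1) Ω Q = 1 / 3 * l2Inner Ω Q Ω := by
  rw [actionDeriv, l2Inner, integral_vol C hΩ (continuous_formInner hΩ hQ), Finset.mul_sum]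
  refine Finset.sum_congr rfl fun i _ => ?_
  rw [← integral_const_mul]
  refine setIntegral_congr_fun (measurableSet_piece _ (C.measurableSet_K i)) fun y hy => ?_
  have hp := IsPositive.coordForm hΩ.2 hy.1
  refine (dirDeriv_comp_fst ((contDiffAt_volDensity hp).differentiableAt (by simp)) _).trans ?_
  refine (fderiv_volDensity hp _).trans ?_
  rw [← formInner_coordForm hΩ.2 Q Ω hy.1, mul_assoc]
  rfl

theorem action_energyDensity_smul (C : Cover M) (hΩ : IsG2Structure Ω) {μ : ℝ} (hμ : 0 < μ) :
    action C energyDensity (μ ^ 3 • Ω) = μ ^ 5 * action C energyDensity Ω := by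
  rw [action, action, Finset.mul_sum]
  refine Finset.sum_congr rfl fun i _ => ?_
  rw [← integral_const_mul]
  refine setIntegral_congr_fun (measurableSet_piece _ (C.measurableSet_K i)) fun y hy => ?_
  beta_reduce
  refine Eq.trans ?_ (energyDensity_smul (IsPositive.coordForm hΩ.2 hy.1) _ hμ)
  rw [jet]
  congr 1
  have h1 : coordForm (μ ^ 3 • Ω) (C.c i) = μ ^ 3 • coordForm Ω (C.c i) := by
    ext1 y; exact coordForm_smul _ _ _ _
  rw [h1, fderiv_const_smul ((hΩ.1.contDiffAt hy.1).differentiableAt (by simp))]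
  rfl

/-- Euler's identity for the Dirichlet energy. -/
theorem actionDeriv_energyDensity_self (C : Cover M) (hΩ : IsG2Structure Ω) :
    actionDeriv C energyDensity Ω Ω = 5 / 3 * action C energyDensity Ω := by
  have h1 := hasDerivAt_action_add_smul C (fun j => contDiffAt_energyDensity) hΩ hΩ.1
  -- The affine variation is reparametrised as `Ω + (μ³ - 1)Ω = μ³Ω`. At `μ = 1` the chain rule
  -- gives three times the first variation, homogeneity gives five times the action.
  have h2 : HasDerivAt (fun μ : ℝ => μ ^ 3 - 1) 3 1 := by
    simpa using (hasDerivAt_pow 3 (1 : ℝ)).sub_const 1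
  have h3 : HasDerivAt (fun μ : ℝ => action C energyDensity (Ω + (μ ^ 3 - 1) • Ω))
      (actionDeriv C energyDensity Ω Ω * 3) 1 := by
    refine HasDerivAt.comp (h₂ := fun s : ℝ => action C energyDensity (Ω + s • Ω)) 1 ?_ h2
    simpa using h1
  have h4 : (fun μ : ℝ => action C energyDensity (Ω + (μ ^ 3 - 1) • Ω))
      =ᶠ[𝓝 1] fun μ => μ ^ 5 * action C energyDensity Ω := by
    filter_upwards [lt_mem_nhds (one_pos : (0 : ℝ) < 1)] with μ hμ
    rw [← action_energyDensity_smul C hΩ hμ]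
    congr 1
    module
  have h5 := (hasDerivAt_pow 5 (1 : ℝ)).mul_const (action C energyDensity Ω)
  have h6 := h3.unique (h5.congr_of_eventuallyEq h4)
  norm_num at h6
  linarith

/-- Affine variations stay positive for small `s`, where `𝒟` is half the action; uniqueness of the
derivative does the rest. -/
theorem IsNegGradient.actionDeriv_eq (C : Cover M) (hΩ : IsG2Structure Ω) {Q η : Form M 3}
    (hQ : IsNegGradient Ω Q) (hη : IsSmoothForm η) :
    1 / 2 * actionDeriv C energyDensity Ω η = -l2Inner Ω Q η := by
  have h1 := (hasDerivAt_action_add_smul C (fun j => contDiffAt_energyDensity) hΩ hη).const_mul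
    (1 / 2)
  refine h1.unique ((hQ.2 η hη).congr_of_eventuallyEq ?_)
  obtain ⟨ε, hε, hp⟩ := exists_isG2Structure_add_smul C hΩ hη
  filter_upwards [Icc_mem_nhds (neg_lt_zero.2 hε) hε] with s hs
  exact (dirichletEnergy_eq C (hp s hs)).symm

/-- Positivity of the form is not required, so a form of zero energy is a global minimiser even
along affine lines that leave the positive forms. -/
theorem dirichletEnergy_nonneg (Ω : Form M 3) : 0 ≤ dirichletEnergy Ω := by
  have : ∀ (x : M) {k : ℕ} (α : (Fin k → TangentSpace (𝓡 7) x) → ℝ), 0 ≤ formNormSq (Ω x) α :=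
    fun x k α => mul_nonneg (by positivity) (Finset.sum_nonneg fun _ _ => mul_self_nonneg _)
  exact mul_nonneg (by norm_num) (integral_nonneg fun x => add_nonneg (this x _) (this x _))

theorem l2Inner_self_nonneg (Ω : Form M 3) {k : ℕ} (α : Form M k) : 0 ≤ l2Inner Ω α α :=
  integral_nonneg fun _ => mul_nonneg (by positivity)
    (Finset.sum_nonneg fun _ _ => mul_self_nonneg _)

/-- The density is strictly positive in every chart. Full support lets the vanishing of the energy
integral force its continuous integrand to vanish everywhere. -/
theorem isOpenPosMeasure_vol (hΩ : IsG2Structure Ω) : (vol Ω).IsOpenPosMeasure := by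
  refine ⟨fun U hU ⟨x, hx⟩ h0 => ?_⟩
  have h1 : chartVolume Ω x U = 0 :=
    le_antisymm ((Measure.le_iff'.1 (le_iSup (fun c => chartVolume Ω c) x) U).trans h0.le) zero_le
  have hm := measurableSet_piece x hU.measurableSet
  have hae : AEMeasurable (fun y => ENNReal.ofReal (volDensity (coordForm Ω x y)))
      (volume.restrict (piece x U)) :=
    (((continuousOn_volDensity hΩ x).mono inter_subset_left).aemeasurable hm).ennreal_ofReal
  rw [chartVolume_apply hΩ x hU.measurableSet, lintegral_eq_zero_iff' hae] at h1
  have h2 : ∀ᵐ y ∂(volume.restrict (piece x U)), False := by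
    filter_upwards [h1, ae_restrict_mem hm] with y hy hyU
    have h3 := volDensity_pos (IsPositive.coordForm hΩ.2 hyU.1)
    exact (ENNReal.ofReal_pos.2 h3).ne' hy
  have h3 : volume (piece x U) = 0 := by
    simpa [ae_iff] using h2
  have h4 : IsOpen (piece x U) :=
    (continuousOn_extChartAt_symm x).isOpen_inter_preimage (isOpen_extChartAt_target x) hU
  refine (h4.measure_pos volume ⟨extChartAt (𝓡 7) x x, mem_extChartAt_target x, ?_⟩).ne' h3
  rw [mem_preimage, extChartAt_to_inv]
  exact hx

theorem dirichletEnergy_eq_zero_iff (C : Cover M) (hΩ : IsG2Structure Ω) :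
    dirichletEnergy Ω = 0 ↔ IsTorsionFree Ω := by
  rw [isTorsionFree_iff hΩ]
  have h1 : dirichletEnergy Ω = 1 / 2 * ∫ x, energyAt Ω x ∂(vol Ω) := rfl
  have hc := continuous_energyAt hΩ
  have := isOpenPosMeasure_vol hΩ
  rw [h1, mul_eq_zero, or_iff_right (by norm_num), integral_eq_zero_iff_of_nonneg
    (fun x => energyAt_nonneg hΩ x) (integrable_vol C hΩ hc),
    Continuous.ae_eq_iff_eq (vol Ω) hc (continuous_zero), funext_iff]
  rfl

theorem sobolevNormSq_le (C : Cover M) (hΩ : IsG2Structure Ω) :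
    sobolevNormSq Ω Ω ≤ boundC Ω := by
  have hi := integrable_vol C hΩ (continuous_energyAt hΩ)
  have h1 : boundC Ω = ∫ x, (7 * (1 : ℝ) + 2 * energyAt Ω x) ∂(vol Ω) := by
    rw [integral_add ((integrable_vol C hΩ continuous_const)) (hi.const_mul 2),
      integral_const_mul, integral_const_mul, boundC, hitchin]
    have h2 : dirichletEnergy Ω = 1 / 2 * ∫ x, energyAt Ω x ∂(vol Ω) := rfl
    rw [h2]
    ring
  rw [h1, sobolevNormSq]
  -- Only the larger integrand has to be integrable, so regularity of `|∇Ω|²` is not needed.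
  refine integral_mono_of_nonneg (Filter.Eventually.of_forall fun x => ?_)
    ((integrable_vol C hΩ continuous_const).add (hi.const_mul 2))
    (Filter.Eventually.of_forall fun x => ?_)
  · have : ∀ {k : ℕ} (α : (Fin k → TangentSpace (𝓡 7) x) → ℝ), 0 ≤ formNormSq (Ω x) α :=
      fun α => mul_nonneg (by positivity) (Finset.sum_nonneg fun _ _ => mul_self_nonneg _)
    exact add_nonneg (this _) (Finset.sum_nonneg fun i _ => this _)
  · have h2 : formNormSq (Ω x) (Ω x) = 7 := formNormSq_self (V := E7) (hΩ.2 x)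
    have h3 := covDerivNormSq_le hΩ x
    beta_reduce
    rw [h2]
    linarith

end Functionals

end

section

/-! ### The Dirichlet energy flow -/

section Flow

variable {M : Type*} [TopologicalSpace M] [CompactSpace M] [ChartedSpace E7 M]
  [IsManifold (𝓡 7) ∞ M] [MeasurableSpace M] [BorelSpace M] {T : EReal} {Ω : ℝ → Form M 3}

theorem ordConnected_timeInterval (T : EReal) : (timeInterval T).OrdConnected :=
  ⟨fun _ hx _ hy _ hz => ⟨hx.1.trans hz.1, (EReal.coe_le_coe_iff.2 hz.2).trans_lt hy.2⟩⟩

theorem exists_Icc_subset_timeInterval {t₀ : ℝ} (ht₀ : t₀ ∈ timeInterval T) :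
    ∃ b : ℝ, 0 < b ∧ t₀ ∈ Icc 0 b ∧ Icc 0 b ⊆ timeInterval T ∧
      Icc 0 b ∈ 𝓝[timeInterval T] t₀ := by
  obtain ⟨b, hb, hbT⟩ := EReal.lt_iff_exists_real_btwn.1 ht₀.2
  have hb' : t₀ < b := EReal.coe_lt_coe_iff.1 hb
  refine ⟨b, ht₀.1.trans_lt hb', ⟨ht₀.1, hb'.le⟩,
    fun t ht => ⟨ht.1, (EReal.coe_le_coe_iff.2 ht.2).trans_lt hbT⟩, ?_⟩
  filter_upwards [self_mem_nhdsWithin, mem_nhdsWithin_of_mem_nhds (Iio_mem_nhds hb')] with t ht h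
  exact ⟨ht.1, le_of_lt h⟩

theorem uniqueDiffOn_timeInterval (T : EReal) : UniqueDiffOn ℝ (timeInterval T) := fun t ht => by
  obtain ⟨b, hb, htb, hbT, -⟩ := exists_Icc_subset_timeInterval ht
  exact (uniqueDiffOn_Icc hb t htb).mono hbT

/-- The derivative of `C_t` along the flow. -/
theorem IsDirichletFlow.hasDerivWithinAt_boundC (C : Cover M) (h : IsDirichletFlow T Ω) {t₀ : ℝ}
    (ht₀ : t₀ ∈ timeInterval T) {Q : Form M 3} (hQ : IsNegGradient (Ω t₀) Q)
    (hdQ : ∀ (x : M) (v : Fin 3 → TangentSpace (𝓡 7) x),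
      HasDerivWithinAt (fun s => Ω s x v) (Q x v) (timeInterval T) t₀) :
    HasDerivWithinAt (fun t => boundC (Ω t))
      (-(4 * l2Inner (Ω t₀) Q Q + 35 / 9 * dirichletEnergy (Ω t₀))) (timeInterval T) t₀ := by
  -- The differentiation lemma works on compact time intervals; `[0, b]` is a neighbourhood of `t₀`
  -- within `[0, T)`, also when `t₀ = 0`.
  obtain ⟨b, hb, htb, hbT, hbn⟩ := exists_Icc_subset_timeInterval ht₀
  have hΩ := h.2.1 t₀ ht₀
  have hp : ∀ t ∈ Icc 0 b, IsG2Structure (Ω t) := fun t ht => h.2.1 t (hbT ht)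
  have hs : IsSmoothFamily (Icc 0 b) Ω := fun c => (h.1 c).mono (prod_mono_left hbT)
  have hd : ∀ (x : M) (v : Fin 3 → TangentSpace (𝓡 7) x),
      HasDerivWithinAt (fun s => Ω s x v) (Q x v) (Icc 0 b) t₀ := fun x v => (hdQ x v).mono hbT
  have h1 := hasDerivWithinAt_action C (fun j => contDiffAt_energyDensity) hb hs hp htb hd
  have h2 := hasDerivWithinAt_action C contDiffAt_volDensity_fst hb hs hp htb hd
  have h3 := ((h1.const_mul (1 / 2)).const_mul 4).add (h2.const_mul 7)
  have e1 := hQ.actionDeriv_eq C hΩ hQ.1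
  have e2 := hQ.actionDeriv_eq C hΩ hΩ.1
  rw [actionDeriv_energyDensity_self C hΩ] at e2
  have e3 := dirichletEnergy_eq C hΩ
  rw [actionDeriv_volDensity C hΩ hQ.1] at h3
  have h4 := h3.congr (f₁ := fun t => boundC (Ω t)) (fun t ht => by
    rw [boundC, dirichletEnergy_eq C (hp t ht), hitchin_eq C (hp t ht)]; rfl)
    (by rw [boundC, dirichletEnergy_eq C hΩ, hitchin_eq C hΩ]; rfl)
  refine (h4.mono_of_mem_nhdsWithin hbn).congr_deriv ?_
  -- The energy contributes `-4‖Q‖²`. The volume contributes `(7/3)⟨Q, Ω⟩`, and Euler's identity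
  -- evaluates it as `-(7/3)(5/3)𝒟 = -(35/9)𝒟`.
  linarith

/-- At a torsion-free form the gradient of the Dirichlet energy vanishes. -/
theorem IsNegGradient.l2Inner_self_eq_zero {Ω Q : Form M 3} (hQ : IsNegGradient Ω Q)
    (h0 : dirichletEnergy Ω = 0) : l2Inner Ω Q Q = 0 := by
  have h1 : IsLocalMin (fun s : ℝ => dirichletEnergy (Ω + s • Q)) 0 := by
    refine Filter.Eventually.of_forall fun s => ?_
    have : Ω + (0 : ℝ) • Q = Ω := by rw [zero_smul, add_zero]
    beta_reduce
    rw [this, h0]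
    exact dirichletEnergy_nonneg _
  exact neg_eq_zero.1 (h1.hasDerivAt_eq_zero (hQ.2 Q hQ.1))

theorem IsDirichletFlow.antitoneOn_boundC (C : Cover M) (h : IsDirichletFlow T Ω) :
    AntitoneOn (fun t => boundC (Ω t)) (timeInterval T) := by
  have hd : ∀ t ∈ timeInterval T, ∃ d ≤ 0,
      HasDerivWithinAt (fun t => boundC (Ω t)) d (timeInterval T) t := by
    intro t ht
    obtain ⟨Q, hQ, hdQ⟩ := h.2.2 t ht
    refine ⟨_, ?_, h.hasDerivWithinAt_boundC C ht hQ hdQ⟩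
    have h1 := l2Inner_self_nonneg (Ω t) Q
    have h2 := dirichletEnergy_nonneg (Ω t)
    linarith
  refine antitoneOn_of_deriv_nonpos (ordConnected_timeInterval T).convex (fun t ht => ?_)
    (fun t ht => ?_) fun t ht => ?_
  · obtain ⟨d, -, hd⟩ := hd t ht
    exact hd.continuousWithinAt
  · obtain ⟨d, -, hd⟩ := hd t (interior_subset ht)
    exact (hd.hasDerivAt (mem_interior_iff_mem_nhds.1 ht)).differentiableAt.differentiableWithinAt
  · obtain ⟨d, hd0, hd⟩ := hd t (interior_subset ht)
    rw [(hd.hasDerivAt (mem_interior_iff_mem_nhds.1 ht)).deriv]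
    exact hd0

end Flow

end

end G2Flow

end

theorem mainTheorem7 {M : Type*} [TopologicalSpace M] [T2Space M] [CompactSpace M]
    [ChartedSpace G2Flow.E7 M] [IsManifold (𝓡 7) ∞ M] [MeasurableSpace M] [BorelSpace M]
    (T : EReal) (hT : 0 < T) (Ω : ℝ → G2Flow.Form M 3) (hΩ : G2Flow.IsDirichletFlow T Ω) :
    (∀ t ∈ G2Flow.timeInterval T,
      G2Flow.sobolevNormSq (Ω t) (Ω t) ≤ G2Flow.boundC (Ω t) ∧
        G2Flow.boundC (Ω t) ≤ G2Flow.boundC (Ω 0)) ∧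
    AntitoneOn (fun t => G2Flow.boundC (Ω t)) (G2Flow.timeInterval T) ∧
    ∀ t₀ ∈ G2Flow.timeInterval T,
      DifferentiableWithinAt ℝ (fun t => G2Flow.boundC (Ω t)) (G2Flow.timeInterval T) t₀ ∧
      (derivWithin (fun t => G2Flow.boundC (Ω t)) (G2Flow.timeInterval T) t₀ = 0 ↔
        G2Flow.IsTorsionFree (Ω t₀)) := by
  obtain ⟨C⟩ := G2Flow.nonempty_cover (M := M)
  have hanti := hΩ.antitoneOn_boundC C
  have h0 : (0 : ℝ) ∈ G2Flow.timeInterval T := ⟨le_rfl, hT⟩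
  refine ⟨fun t ht => ⟨G2Flow.sobolevNormSq_le C (hΩ.2.1 t ht), hanti h0 ht ht.1⟩, hanti,
    fun t ht => ?_⟩
  obtain ⟨Q, hQ, hdQ⟩ := hΩ.2.2 t ht
  have hd := hΩ.hasDerivWithinAt_boundC C ht hQ hdQ
  refine ⟨hd.differentiableWithinAt, ?_⟩
  rw [hd.derivWithin (G2Flow.uniqueDiffOn_timeInterval T t ht),
    ← G2Flow.dirichletEnergy_eq_zero_iff C (hΩ.2.1 t ht), neg_eq_zero]
  have h1 := G2Flow.l2Inner_self_nonneg (Ω t) Q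
  have h2 := G2Flow.dirichletEnergy_nonneg (Ω t)
  -- A sum of two nonnegative terms vanishes only if both do; conversely a form of zero energy is a
  -- minimiser, where the gradient term is zero as well.
  refine ⟨fun h => by linarith, fun h => ?_⟩
  rw [hQ.l2Inner_self_eq_zero h, h]
  ring
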